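/- Let $K=\{(x_n)_{n\ge 0}\in[0,1]^{\mathbb N} : x_n=T(x_{n+1})\ \text{for all } n\}$, with $T(t)=1-|2t-1|$, be the Knaster continuum. A continuous map $f:X\to Y$ is a \emph{branched covering} if every $y\in Y$ has an open neighbourhood $V$ such that $f^{-1}(V)$ is a disjoint union of open sets $U$, each of which contains exactly one point $x$ of $f^{-1}(y)$ and for which $f|_{U\setminus\{x\}}:U\setminus\{x\}\to V\setminus\{y\}$ is a covering map of some degree $k\ge 1$. The number $k=\deg(f,x)$ is the local degree of $f$ at $x$; $x$ is critical if $\deg(f,x)\ge 2$, with multiplicity $\deg(f,x)-1$, and regular otherwise; critical values are the images of critical points. The map $f$ has degree $d$ if every point that is not a critical value has exactly $d$ preimages. An endpoint of a space is a point that is an endpoint of every arc containing it. Let $d\ge 1$ and let $f:K\to K$ be a branched covering of degree $d$. Then $K$ has exactly one endpoint, $p=(0,0,0,\dots)$; $f(p)=p$ and $p$ is a regular point of $f$; every other preimage of $p$ is a critical point of multiplicity $1$; $f$ has no critical value other than $p$; $d$ is odd, and $f$ has exactly $\frac{d-1}{2}$ critical points. If moreover $d\ge 2$, then $p$ is a critical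 value, so that $f$ has exactly one critical value, namely $p$; the Riemann--Hurwitz formula $d-1=r$ fails, where $r$ is the number of critical points of $f$ counted with multiplicity; and $f$ does not extend to a branched covering of the sphere: there are no topological embedding $e:K\to S^2$ and branched covering $F:S^2\to S^2$ with $F\circ e=e\circ f$. -/

import Mathlib

namespace KnasterBranched

section Branched

variable {X Y : Type*} [TopologicalSpace X] [TopologicalSpace Y]

/-- The restriction `U \ {x} → V \ {y}` of `f` is a covering map of degree `k`. -/
structure IsPuncturedCovering (f : X → Y) (U : Set X) (x : X) (V : Set Y) (y : Y) (k : ℕ) :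
    Prop where
  mapsTo : Set.MapsTo f (U \ {x}) (V \ {y})
  isCoveringMap : IsCoveringMap mapsTo.restrict
  encard_fiber : ∀ v ∈ V \ {y}, ((U \ {x}) ∩ f ⁻¹' {v}).encard = k

/-- `V` is an open neighbourhood of `y` whose preimage is the disjoint union of the open sets
`U ∈ 𝒰`; every `U ∈ 𝒰` contains exactly one point `x` of the fibre over `y`, and `U \ {x} → V \ {y}`
is a covering map of some degree `k ≥ 1`. -/
structure IsBranchedNhd (f : X → Y) (y : Y) (V : Set Y) (𝒰 : Set (Set X)) : Prop where
  isOpen : IsOpen V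
  mem : y ∈ V
  isOpen_sheet : ∀ U ∈ 𝒰, IsOpen U
  pairwiseDisjoint : 𝒰.PairwiseDisjoint id
  preimage_eq : f ⁻¹' V = ⋃₀ 𝒰
  sheet : ∀ U ∈ 𝒰, ∃ (x : X) (k : ℕ), U ∩ f ⁻¹' {y} = {x} ∧ 1 ≤ k ∧ IsPuncturedCovering f U x V y k

/-- Branched coverings. The neighbourhoods `V` can be shrunk, so on a surface they may be
taken to be topological disks. -/
def IsBranchedCovering (f : X → Y) : Prop :=
  Continuous f ∧ ∀ y : Y, ∃ (V : Set Y) (𝒰 : Set (Set X)), IsBranchedNhd f y V 𝒰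

/-- `k` is the degree of the covering `U \ {x} → V \ {f x}` for a sheet `U ∋ x` over a
neighbourhood `V` of `f x` as in the definition of branched coverings. -/
def HasLocalDegree (f : X → Y) (x : X) (k : ℕ) : Prop :=
  ∃ (V : Set Y) (𝒰 : Set (Set X)) (U : Set X),
    IsBranchedNhd f (f x) V 𝒰 ∧ U ∈ 𝒰 ∧ x ∈ U ∧ IsPuncturedCovering f U x V (f x) k

/-- The local degree `deg(f, x)`. For a branched covering between compact Hausdorff spaces without
isolated points exactly one `k` satisfies `HasLocalDegree f x k`, and the infimum picks it. -/
noncomputable def localDegree (f : X → Y) (x : X) : ℕ := sInf {k | HasLocalDegree f x k}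

/-- The critical points: the points of local degree at least two. -/
def criticalPoints (f : X → Y) : Set X := {x | 2 ≤ localDegree f x}

/-- The critical values: the images of the critical points. -/
def criticalValues (f : X → Y) : Set Y := f '' criticalPoints f

/-- The multiplicity `deg(f, x) - 1` of a critical point `x`. -/
noncomputable def critMultiplicity (f : X → Y) (x : X) : ℕ := localDegree f x - 1

/-- The number of critical points counted with multiplicity. -/
noncomputable def totalRamification (f : X → Y) : ℕ :=
  ∑ᶠ x ∈ criticalPoints f, critMultiplicity f x

/-- A branched covering of degree `d`: every point which is not a critical value has exactly `d`
preimages. -/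
def IsBranchedCoveringOfDegree (f : X → Y) (d : ℕ) : Prop :=
  IsBranchedCovering f ∧ ∀ y : Y, y ∉ criticalValues f → (f ⁻¹' {y}).encard = d

/-- `q` is an endpoint of `X`: it is an endpoint of every arc in `X` that contains it. -/
def IsEndpoint (q : X) : Prop :=
  ∀ γ : unitInterval → X, Continuous γ → Function.Injective γ →
    ∀ t : unitInterval, γ t = q → t = 0 ∨ t = 1

end Branched

/-- The tent map: `t ↦ 2 t` on `[0, 1/2]`, `t ↦ 2 - 2 t` on `[1/2, 1]`. -/
def tent (t : ℝ) : ℝ := 1 - |2 * t - 1|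

/-- The Knaster continuum (buckethandle), as the inverse limit of the tent map on `[0, 1]`, with the
topology induced by the product topology. -/
def Knaster : Set (ℕ → ℝ) :=
  {x | ∀ n, x n ∈ Set.Icc (0 : ℝ) 1 ∧ x n = tent (x (n + 1))}

/-- The point `(0, 0, 0, …)` of the Knaster continuum. -/
def knasterPoint : Knaster := ⟨fun _ => 0, fun _ => by simp [tent]⟩

/-- The two-dimensional sphere. -/
abbrev Sphere2 : Type := Metric.sphere (0 : EuclideanSpace ℝ (Fin 3)) 1

end KnasterBranched

namespace KnasterBranched

open Set Filter Topology

/-! ### The tent map and the circle `ℝ / 2ℤ` -/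

/-! The norm on `ℝ / 2ℤ` carries doubling to the tent map, so the Knaster continuum is the dyadic
solenoid modulo negation (`fold_eq_iff`). Negation fixes only `0`. Hence `p = knasterPoint` is the
one point where a leaf is folded onto a half-line, while a leaf runs through every other point like
a line. In terms of simple paths issuing from a point (rays): two rays that meet only at their start
issue from each point other than `p` (`exists_rays_fold`), never more than two from any point, and
no such pair from `p` (`card_rays_le`).

A ray at `y` lifts through a punctured covering of degree `k` to `k` rays at `x`
(`IsBranchedNhd.exists_ray_lifts`). If `y ≠ p`, two rays lift to `2 * k ≤ 2` rays, so `k = 1` and `x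
≠ p`. If `y = p`, one ray lifts to `k` rays, so `k ≤ 2`, and `k = 1` when `x = p`. When `x ≠ p`,
degree one would make `f` injective near `x` and push two separate rays forward to `p`, so `k = 2`.
Counting a fibre near `p` sheet by sheet gives `d = 2 * r + 1`, with `r` critical points
(`degree_eq`).

Now suppose that `F` on the sphere extends `f`, and let `c` be critical. In a plane chart centred at
the image of `p`, the embedding becomes an even function `k` on the solenoid that vanishes only at
`0` and separates points up to sign. Near the image of `c` the map `F` is `z ↦ z ^ m` in suitable
coordinates (`exists_root_of_punctured_covering`). Composed with a lift through `f` of a half-box at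
`0`, the source coordinate is an `m`-th root of `k`. There are two such lifts, and negation
exchanges them, since otherwise a path would turn around at `c` (`IsBoxLift.neg_ne`). Their ratio
must then be `-1`: `m` is even and the root is odd where negation acts (`exists_odd_root_halfBox`).
Extended to an odd nonvanishing function off `0` and corrected by the exponential of an even
function, it becomes a global odd `m`-th root of `k`. Such a root is injective, so the solenoid
embeds in the plane (`false_of_odd_root`).

That is impossible (`solenoid_not_planar`). On a planar compact set a nonvanishing function is a
rational function times an exponential (`exists_ratFun_factor`). If it has roots of all orders `2 ^
n`, its total multiplicity in each bounded complementary component is divisible by every `2 ^ n`,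
hence zero, and the function has a logarithm. The zeroth coordinate of the solenoid has all these
roots, but a logarithm of it would be unbounded along a leaf of a compact space. -/

theorem norm_coe_of_abs_le {t : ℝ} (h : |t| ≤ 1) : ‖(t : AddCircle (2 : ℝ))‖ = |t| :=
  (AddCircle.norm_coe_eq_abs_iff (p := 2) two_ne_zero).2 (by simpa using h)

theorem exists_abs_le_one_coe (a : AddCircle (2 : ℝ)) : ∃ t : ℝ, |t| ≤ 1 ∧ (t : AddCircle (2 : ℝ)) = a := by
  have : Fact ((0 : ℝ) < 2) := ⟨two_pos⟩
  obtain ⟨t, ht, rfl⟩ := (AddCircle.eq_coe_Ico (p := (2 : ℝ)) a)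
  rcases le_or_gt t 1 with h | h
  · exact ⟨t, abs_le.2 ⟨by linarith [ht.1], h⟩, rfl⟩
  · refine ⟨t - 2, abs_le.2 ⟨by linarith [ht.1], by linarith [ht.2]⟩, ?_⟩
    have := AddCircle.coe_period (2 : ℝ)
    rw [AddCircle.coe_sub, this, sub_zero]

theorem circle_norm_le_one (a : AddCircle (2 : ℝ)) : ‖a‖ ≤ 1 := by
  simpa using AddCircle.norm_le_half_period (p := 2) (x := a) two_ne_zero

theorem eq_or_eq_neg_of_norm_eq {a b : AddCircle (2 : ℝ)} (h : ‖a‖ = ‖b‖) : a = b ∨ a = -b := by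
  obtain ⟨s, hs, rfl⟩ := exists_abs_le_one_coe a
  obtain ⟨t, ht, rfl⟩ := exists_abs_le_one_coe b
  rw [norm_coe_of_abs_le hs, norm_coe_of_abs_le ht] at h
  rcases abs_eq_abs.1 h with h | h
  · exact .inl (by rw [h])
  · exact .inr (by rw [h, AddCircle.coe_neg])

/-- This semiconjugacy is what makes the Knaster continuum a quotient of the solenoid. -/
theorem tent_norm (a : AddCircle (2 : ℝ)) : tent ‖a‖ = ‖a + a‖ := by
  obtain ⟨s, hs, rfl⟩ := exists_abs_le_one_coe a
  rw [norm_coe_of_abs_le hs, ← AddCircle.coe_add, tent]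
  have key : ∀ s : ℝ, 0 ≤ s → s ≤ 1 → 1 - |2 * s - 1| = ‖((s + s : ℝ) : AddCircle (2 : ℝ))‖ := by
    intro s h0 h1
    rcases le_total s (1 / 2) with h | h
    · rw [norm_coe_of_abs_le (abs_le.2 ⟨by linarith, by linarith⟩), abs_of_nonneg (by linarith : 0 ≤ s + s),
        abs_of_nonpos (by linarith)]
      ring
    · have : ((s + s : ℝ) : AddCircle (2 : ℝ)) = ((s + s - 2 : ℝ) : AddCircle (2 : ℝ)) := by
        rw [AddCircle.coe_sub, AddCircle.coe_period (2 : ℝ), sub_zero]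
      rw [this, norm_coe_of_abs_le (abs_le.2 ⟨by linarith, by linarith⟩),
        abs_of_nonpos (by linarith : s + s - 2 ≤ 0), abs_of_nonneg (by linarith)]
      ring
  rw [key _ (abs_nonneg s) hs]
  rcases abs_cases s with ⟨h, _⟩ | ⟨h, _⟩ <;> rw [h]
  rw [show -s + -s = -(s + s) by ring, AddCircle.coe_neg, norm_neg]

/-! ### The dyadic solenoid -/

/-- The dyadic solenoid, as the inverse limit of the doubling map on `ℝ / 2ℤ`. -/
def solenoid : AddSubgroup (ℕ → AddCircle (2 : ℝ)) where
  carrier := {θ | ∀ n, θ n = θ (n + 1) + θ (n + 1)}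
  add_mem' {a b} ha hb n := by
    simp only [Pi.add_apply]; rw [ha n, hb n]; abel
  zero_mem' n := by simp
  neg_mem' {a} ha n := by
    simp only [Pi.neg_apply]; rw [ha n]; abel

theorem solenoid_double (θ : solenoid) (n : ℕ) : θ.1 n = θ.1 (n + 1) + θ.1 (n + 1) := θ.2 n

theorem isClosed_solenoid : IsClosed (solenoid : Set (ℕ → AddCircle (2 : ℝ))) := by
  have : (solenoid : Set (ℕ → AddCircle (2 : ℝ))) = ⋂ n, {θ | θ n = θ (n + 1) + θ (n + 1)} := by
    ext θ; simp [solenoid]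
  rw [this]
  exact isClosed_iInter fun n => isClosed_eq (by fun_prop) (by fun_prop)

instance : CompactSpace solenoid := by
  have : Fact ((0 : ℝ) < 2) := ⟨two_pos⟩
  exact isCompact_iff_compactSpace.1 isClosed_solenoid.isCompact

theorem continuous_coord (n : ℕ) : Continuous fun θ : solenoid => θ.1 n :=
  (continuous_apply n).comp continuous_subtype_val

theorem solenoid_eq_of_le {θ θ' : solenoid} {n m : ℕ} (hmn : m ≤ n) (h : θ.1 n = θ'.1 n) :
    θ.1 m = θ'.1 m := by
  induction n, hmn using Nat.le_induction with
  | base => exact h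
  | succ n _ ih => exact ih (by rw [solenoid_double, solenoid_double θ', h])

/-- Coordinate `n` of `θ` is coordinate `n + 1` of `θ + θ`. The absence of 2-torsion leaves `0` as
the only fixed point of negation, hence as the only fold. -/
theorem solenoid_eq_zero_of_add_self {θ : solenoid} (h : θ + θ = 0) : θ = 0 := by
  ext n
  rw [solenoid_double]
  exact congrFun (congrArg Subtype.val h) (n + 1)

theorem solenoid_eq_zero_of_eq_neg {θ : solenoid} (h : θ = -θ) : θ = 0 :=
  solenoid_eq_zero_of_add_self (by nth_rewrite 1 [h]; simp)

/-- The one-parameter subgroup of the solenoid through `0`. -/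
noncomputable def flow : ℝ →+ solenoid where
  toFun s := ⟨fun n => ((s / 2 ^ n : ℝ) : AddCircle (2 : ℝ)), fun n => by
    rw [← AddCircle.coe_add]
    exact congrArg (fun r : ℝ => (r : AddCircle (2 : ℝ))) (by rw [pow_succ]; ring)⟩
  map_zero' := by ext n; simp
  map_add' s t := by
    ext n
    simp only [AddSubgroup.coe_add, Pi.add_apply, ← AddCircle.coe_add, add_div]

theorem flow_apply (s : ℝ) (n : ℕ) : (flow s).1 n = ((s / 2 ^ n : ℝ) : AddCircle (2 : ℝ)) := rfl

theorem continuous_flow : Continuous flow := by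
  refine Continuous.subtype_mk (continuous_pi fun n => ?_) _
  exact (AddCircle.continuous_mk' (2 : ℝ)).comp (by fun_prop)

theorem exists_abs_div_pow_lt (s : ℝ) {δ : ℝ} (hδ : 0 < δ) (N : ℕ) : ∃ n, N ≤ n ∧ |s / 2 ^ n| < δ := by
  have h : Tendsto (fun n : ℕ => s / 2 ^ n) atTop (𝓝 0) := by
    simpa [div_eq_mul_inv] using (tendsto_inv_atTop_zero.comp
      (tendsto_pow_atTop_atTop_of_one_lt (one_lt_two (α := ℝ)))).const_mul s
  obtain ⟨n, h1, h2⟩ := ((eventually_ge_atTop N).and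
    (Metric.tendsto_nhds.1 h δ hδ)).exists
  exact ⟨n, h1, by rwa [Real.dist_eq, sub_zero] at h2⟩

/-- For large `n` the coordinate `s / 2 ^ n` is so small that the circle norm reads off its absolute
value. -/
theorem flow_injective : Function.Injective flow := by
  refine (injective_iff_map_eq_zero flow).2 fun s hs => ?_
  obtain ⟨n, -, hn⟩ := exists_abs_div_pow_lt s one_pos 0
  have h := congrFun (congrArg Subtype.val hs) n
  rw [flow_apply] at h
  have h2 := norm_coe_of_abs_le hn.le
  rw [h] at h2
  have : s / 2 ^ n = 0 := by simpa using h2.symm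
  simpa using this

/-- The quotient map from the solenoid to the Knaster continuum. -/
noncomputable def fold (θ : solenoid) : Knaster :=
  ⟨fun n => ‖θ.1 n‖, fun n => ⟨⟨norm_nonneg _, circle_norm_le_one _⟩, by
    rw [tent_norm, ← solenoid_double]⟩⟩

theorem fold_apply (θ : solenoid) (n : ℕ) : (fold θ).1 n = ‖θ.1 n‖ := rfl

theorem continuous_fold : Continuous fold :=
  Continuous.subtype_mk (continuous_pi fun n => (continuous_coord n).norm) _

theorem fold_zero : fold 0 = knasterPoint := by
  ext n; simp [fold_apply, knasterPoint]

theorem fold_neg (θ : solenoid) : fold (-θ) = fold θ := by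
  ext n; simp [fold_apply]

/-- Each coordinate agrees up to a sign depending on the coordinate. Later coordinates determine
earlier ones, so a sign that works infinitely often works everywhere. -/
theorem fold_eq_iff {θ θ' : solenoid} : fold θ = fold θ' ↔ θ = θ' ∨ θ = -θ' := by
  constructor
  · intro h
    have hn : ∀ n, θ.1 n = θ'.1 n ∨ θ.1 n = (-θ').1 n := fun n =>
      eq_or_eq_neg_of_norm_eq (congrFun (congrArg Subtype.val h) n)
    by_cases hf : ∀ N, ∃ n, N ≤ n ∧ θ.1 n = θ'.1 n
    · left
      ext m
      obtain ⟨n, hmn, hn⟩ := hf m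
      exact solenoid_eq_of_le hmn hn
    · right
      push Not at hf
      obtain ⟨N, hN⟩ := hf
      ext m
      exact solenoid_eq_of_le (le_max_left m N)
        ((hn (max m N)).resolve_left (hN _ (le_max_right m N)))
  · rintro (rfl | rfl)
    · rfl
    · exact fold_neg θ'

theorem fold_eq_point_iff {θ : solenoid} : fold θ = knasterPoint ↔ θ = 0 := by
  rw [← fold_zero, fold_eq_iff]; simp

/-- A preimage is built coordinate by coordinate: of the two lifts `± b` of the next coordinate, one
doubles to the lift already chosen. -/
theorem fold_surjective : Function.Surjective fold := by
  intro x
  have step : ∀ (n : ℕ) (a : AddCircle (2 : ℝ)), ‖a‖ = x.1 n →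
      ∃ b : AddCircle (2 : ℝ), ‖b‖ = x.1 (n + 1) ∧ a = b + b := by
    intro n a ha
    have hx := (x.2 (n + 1)).1
    set b : AddCircle (2 : ℝ) := ((x.1 (n + 1) : ℝ) : AddCircle (2 : ℝ)) with hb
    have hbn : ‖b‖ = x.1 (n + 1) := by
      rw [hb, norm_coe_of_abs_le (abs_le.2 ⟨by linarith [hx.1], hx.2⟩), abs_of_nonneg hx.1]
    have : ‖a‖ = ‖b + b‖ := by rw [← tent_norm, hbn, ha, ← (x.2 n).2]
    rcases eq_or_eq_neg_of_norm_eq this with h | h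
    · exact ⟨b, hbn, h⟩
    · exact ⟨-b, by rw [norm_neg, hbn], by rw [h]; abel⟩
  choose! nxt hn1 hn2 using step
  have h0 : ‖((x.1 0 : ℝ) : AddCircle (2 : ℝ))‖ = x.1 0 := by
    have hx := (x.2 0).1
    rw [norm_coe_of_abs_le (abs_le.2 ⟨by linarith [hx.1], hx.2⟩), abs_of_nonneg hx.1]
  let θ : ℕ → AddCircle (2 : ℝ) := fun n => Nat.rec ((x.1 0 : ℝ) : AddCircle (2 : ℝ)) (fun n a => nxt n a) n
  have hθ : ∀ n, ‖θ n‖ = x.1 n := by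
    intro n
    induction n with
    | zero => exact h0
    | succ n ih => exact hn1 n _ ih
  refine ⟨⟨θ, fun n => hn2 n _ (hθ n)⟩, ?_⟩
  ext n
  exact hθ n

theorem fold_flow_eq {θ : solenoid} {s t : ℝ} (h : fold (θ + flow s) = fold (θ + flow t)) :
    s = t ∨ θ + θ = flow (-(s + t)) := by
  rcases fold_eq_iff.1 h with h | h
  · exact .inl (flow_injective (add_left_cancel h))
  · right
    rw [map_neg, map_add]
    have : θ + θ = (θ + flow s) - flow s + θ := by abel
    rw [this, h]; abel

instance : CompactSpace Knaster := fold_surjective.compactSpace continuous_fold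

/-- Each point other than `knasterPoint` is the midpoint of an arc of a leaf. -/
theorem exists_injOn_fold_flow {θ : solenoid} (hθ : θ ≠ 0) :
    ∃ δ > 0, InjOn (fun s : ℝ => fold (θ + flow s)) (Icc (-δ) δ) := by
  by_cases h : ∃ r, θ + θ = flow r
  · obtain ⟨r, hr⟩ := h
    have hr0 : r ≠ 0 := by
      rintro rfl
      exact hθ (solenoid_eq_zero_of_add_self (by rw [hr, map_zero]))
    -- Folding identifies times `s` and `t` on the leaf when `s + t = -r`, and on this interval `|s
    -- + t| ≤ |r| / 2`.
    refine ⟨|r| / 4, by positivity, fun s hs t ht hst => ?_⟩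
    rcases fold_flow_eq hst with h | h
    · exact h
    · exfalso
      have : r = -(s + t) := flow_injective (by rw [← hr, h])
      have h1 := abs_pos.2 hr0
      rcases abs_cases r with ⟨h2, _⟩ | ⟨h2, _⟩ <;> rw [h2] at hs ht h1 <;>
        linarith [hs.1, hs.2, ht.1, ht.2]
  · refine ⟨1, one_pos, fun s _ t _ hst => ?_⟩
    exact (fold_flow_eq hst).resolve_right fun h' => h ⟨_, h'⟩

/-! ### Leaves of the Knaster continuum -/

theorem tent_half : tent (1 / 2) = 1 := by norm_num [tent]

theorem eq_of_tent_eq_of_le {a b : ℝ} (h : tent a = tent b) (ha : a ≤ 1 / 2) (hb : b ≤ 1 / 2) :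
    a = b := by
  unfold tent at h
  rw [abs_of_nonpos (by linarith), abs_of_nonpos (by linarith)] at h
  linarith

theorem eq_of_tent_eq_of_ge {a b : ℝ} (h : tent a = tent b) (ha : 1 / 2 ≤ a) (hb : 1 / 2 ≤ b) :
    a = b := by
  unfold tent at h
  rw [abs_of_nonneg (by linarith), abs_of_nonneg (by linarith)] at h
  linarith

theorem Knaster.eq_of_le {x y : Knaster} {n m : ℕ} (hmn : m ≤ n) (h : x.1 n = y.1 n) :
    x.1 m = y.1 m := by
  induction n, hmn using Nat.le_induction with
  | base => exact h
  | succ n _ ih => exact ih (by rw [(x.2 n).2, (y.2 n).2, h])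

theorem continuous_knaster_coord (n : ℕ) : Continuous fun x : Knaster => x.1 n :=
  (continuous_apply n).comp continuous_subtype_val

/-- The tent map sends both `0` and `1` to `0`, so an interior coordinate has only interior
successors. -/
theorem Knaster.coord_mem_Ioo_of_le {x : Knaster} {N : ℕ} (h : x.1 N ∈ Ioo (0 : ℝ) 1) {n : ℕ} (hn : N ≤ n) :
    x.1 n ∈ Ioo (0 : ℝ) 1 := by
  induction n, hn using Nat.le_induction with
  | base => exact h
  | succ n _ ih =>
    have h1 := (x.2 n).2
    have h2 := (x.2 (n + 1)).1
    refine ⟨lt_of_le_of_ne h2.1 fun h0 => ?_, lt_of_le_of_ne h2.2 fun h0 => ?_⟩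
    · rw [← h0] at h1; norm_num [tent] at h1; linarith [ih.1]
    · rw [h0] at h1; norm_num [tent] at h1; linarith [ih.1]

theorem side_of_preconnected {C : Set Knaster} (hC : IsPreconnected C) {n : ℕ}
    (h : ∀ x ∈ C, x.1 n ≠ 1 / 2) {x y : Knaster} (hx : x ∈ C) (hy : y ∈ C) (hxl : x.1 n < 1 / 2) :
    y.1 n < 1 / 2 := by
  by_contra hcon
  obtain ⟨z, hz, hz2⟩ := hC.intermediate_value hx hy (continuous_knaster_coord n).continuousOn
    ⟨hxl.le, not_lt.1 hcon⟩
  exact h z hz hz2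

/-- On a connected set where a coordinate stays off `{0, 1}`, this coordinate is injective. -/
theorem injOn_coord_of_preconnected {C : Set Knaster} (hC : IsPreconnected C) {N : ℕ}
    (h : ∀ x ∈ C, x.1 N ∈ Ioo (0 : ℝ) 1) : InjOn (fun x : Knaster => x.1 N) C := by
  intro x hx y hy hxy
  have key : ∀ n, N ≤ n → x.1 n = y.1 n := by
    intro n hn
    induction n, hn using Nat.le_induction with
    | base => exact hxy
    | succ n hn ih =>
      -- The turning point maps to `1`, which coordinate `n` avoids. So coordinate `n + 1` of the
      -- connected set stays on one monotone branch of the tent map.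
      have hne : ∀ z ∈ C, z.1 (n + 1) ≠ 1 / 2 := by
        intro z hz h0
        have h1 := (z.2 n).2
        rw [h0, tent_half] at h1
        exact (Knaster.coord_mem_Ioo_of_le (h z hz) hn).2.ne h1
      have ht : tent (x.1 (n + 1)) = tent (y.1 (n + 1)) := by rw [← (x.2 n).2, ← (y.2 n).2, ih]
      by_cases hl : x.1 (n + 1) < 1 / 2
      · exact eq_of_tent_eq_of_le ht hl.le (side_of_preconnected hC hne hx hy hl).le
      · refine eq_of_tent_eq_of_ge ht (not_lt.1 hl) (not_lt.1 fun hl' => hl ?_)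
        exact side_of_preconnected hC hne hy hx hl'
  ext m
  exact Knaster.eq_of_le (le_max_left m N) (key _ (le_max_right m N))

/-- All coordinates of `knasterPoint` are `0`. If coordinate `n` stays below `1` on `C`, then
coordinate `n + 1` never crosses `1 / 2`, so `C` remains on the left branch at every level. -/
theorem injOn_coord_of_point_mem {C : Set Knaster} (hC : IsPreconnected C) (hp : knasterPoint ∈ C)
    (h : ∀ x ∈ C, x.1 0 < 1) : InjOn (fun x : Knaster => x.1 0) C := by
  have all : ∀ n, (∀ x ∈ C, x.1 n < 1) ∧ ∀ x ∈ C, ∀ y ∈ C, x.1 0 = y.1 0 → x.1 n = y.1 n := by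
    intro n
    induction n with
    | zero => exact ⟨h, fun x _ y _ h => h⟩
    | succ n ih =>
      have hl : ∀ x ∈ C, x.1 (n + 1) < 1 / 2 := by
        intro x hx
        refine side_of_preconnected hC (fun z hz h0 => ?_) hp hx (by norm_num [knasterPoint])
        have h1 := (z.2 n).2
        rw [h0, tent_half] at h1
        exact (ih.1 z hz).ne h1
      refine ⟨fun x hx => by linarith [hl x hx], fun x hx y hy hxy => ?_⟩
      refine eq_of_tent_eq_of_le ?_ (hl x hx).le (hl y hy).le
      rw [← (x.2 n).2, ← (y.2 n).2, ih.2 x hx y hy hxy]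
  intro x hx y hy hxy
  ext n
  exact (all n).2 x hx y hy hxy

/-- After a nonzero coordinate no later one is `0`, and the next one is not `1`, which the tent map
would send to `0`. -/
theorem exists_coord_mem_Ioo {x : Knaster} (hx : x ≠ knasterPoint) : ∃ N, x.1 N ∈ Ioo (0 : ℝ) 1 := by
  obtain ⟨n, hn⟩ : ∃ n, x.1 n ≠ 0 := by
    by_contra! h
    exact hx (by ext n; simpa [knasterPoint] using h n)
  have h0 : ∀ {m}, x.1 m ≠ 0 → x.1 (m + 1) ∈ Ioc (0 : ℝ) 1 := by
    intro m hm
    have h1 := (x.2 (m + 1)).1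
    refine ⟨lt_of_le_of_ne h1.1 fun h => hm ?_, h1.2⟩
    rw [(x.2 m).2, ← h]; norm_num [tent]
  have hn' : x.1 (n + 1) < 1 := by
    refine lt_of_le_of_ne (h0 hn).2 fun h => hn ?_
    rw [(x.2 n).2, h]; norm_num [tent]
  exact ⟨n + 1, (h0 hn).1, hn'⟩

/-- A neighbourhood of a point and a coordinate that is injective on each connected set through
this point in the neighbourhood. -/
theorem exists_leaf_coordinate (x : Knaster) : ∃ (W : Set Knaster) (φ : Knaster → ℝ), IsOpen W ∧
    x ∈ W ∧ Continuous φ ∧ (∀ C ⊆ W, IsPreconnected C → x ∈ C → InjOn φ C) ∧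
    (x ≠ knasterPoint → ∀ C ⊆ W, IsPreconnected C → InjOn φ C) ∧
    (x = knasterPoint → ∀ y, φ x ≤ φ y) := by
  by_cases hx : x = knasterPoint
  · subst hx
    refine ⟨{y | y.1 0 < 1}, fun y => y.1 0, isOpen_lt (continuous_knaster_coord 0) continuous_const,
      by simp [knasterPoint], continuous_knaster_coord 0,
      fun C hC hC2 hp => injOn_coord_of_point_mem hC2 hp hC, fun h => absurd rfl h, fun _ y => (y.2 0).1.1⟩
  · obtain ⟨N, hN⟩ := exists_coord_mem_Ioo hx
    exact ⟨{y | y.1 N ∈ Ioo (0 : ℝ) 1}, fun y => y.1 N, isOpen_Ioo.preimage (continuous_knaster_coord N),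
      hN, continuous_knaster_coord N, fun C hC hC2 _ => injOn_coord_of_preconnected hC2 hC,
      fun _ C hC hC2 => injOn_coord_of_preconnected hC2 hC, fun h => absurd h hx⟩


/-! ### Half-open paths at a point of the Knaster continuum -/

/-- A simple path that starts at `x`, parametrized by `[0, 1]`. -/
structure IsRay {X : Type*} [TopologicalSpace X] (x : X) (γ : ℝ → X) : Prop where
  continuousOn : ContinuousOn γ (Icc 0 1)
  zero : γ 0 = x
  injOn : InjOn γ (Icc 0 1)

/-- A short piece of the ray lies in `W` and contains `x`, so `φ` is injective on it and must leave
the value `φ x`. -/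
theorem IsRay.exists_initial {x : Knaster} {γ : ℝ → Knaster} (h : IsRay x γ) {W : Set Knaster}
    {φ : Knaster → ℝ} (hW : IsOpen W) (hx : x ∈ W)
    (hinj : ∀ C ⊆ W, IsPreconnected C → x ∈ C → InjOn φ C) :
    ∃ t ∈ Ioc (0 : ℝ) 1, γ '' Icc 0 t ⊆ W ∧ φ (γ t) ≠ φ x := by
  have hc : ContinuousWithinAt γ (Icc 0 1) 0 := h.continuousOn 0 (by simp)
  have hm : γ ⁻¹' W ∈ 𝓝[Icc 0 1] (0 : ℝ) := hc (hW.mem_nhds (by rwa [h.zero]))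
  obtain ⟨δ, hδ, hδ2⟩ := Metric.mem_nhdsWithin_iff.1 hm
  set t := min (δ / 2) 1 with ht
  have ht0 : 0 < t := lt_min (by positivity) one_pos
  have ht1 : t ≤ 1 := min_le_right _ _
  have hsub : γ '' Icc 0 t ⊆ W := by
    rintro _ ⟨s, hs, rfl⟩
    refine hδ2 ⟨?_, hs.1, hs.2.trans ht1⟩
    rw [Metric.mem_ball, Real.dist_eq, sub_zero, abs_of_nonneg hs.1]
    linarith [hs.2, min_le_left (δ / 2) 1]
  refine ⟨t, ⟨ht0, ht1⟩, hsub, fun heq => ?_⟩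
  have hpre : IsPreconnected (γ '' Icc 0 t) :=
    isPreconnected_Icc.image _ (h.continuousOn.mono (Icc_subset_Icc_right ht1))
  have h0 : x ∈ γ '' Icc 0 t := ⟨0, ⟨le_rfl, ht0.le⟩, h.zero⟩
  have := hinj _ hsub hpre h0 (mem_image_of_mem γ ⟨ht0.le, le_rfl⟩) h0 heq
  rw [← h.zero] at this
  exact ht0.ne' (h.injOn ⟨ht0.le, ht1⟩ (by simp) this)

/-- At most two rays without further common points start at a point, and at most one at
`knasterPoint`. -/
theorem card_rays_le {x : Knaster} {ι : Type*} {γ : ι → ℝ → Knaster}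
    (h : ∀ i, IsRay x (γ i))
    (hd : ∀ i j, i ≠ j → ∀ s ∈ Ioc (0 : ℝ) 1, ∀ t ∈ Ioc (0 : ℝ) 1, γ i s ≠ γ j t) :
    Nat.card ι ≤ 2 ∧ (x = knasterPoint → Nat.card ι ≤ 1) := by
  classical
  obtain ⟨W, φ, hW, hx, hφ, hinj, -, hmin⟩ := exists_leaf_coordinate x
  choose t ht htW htne using fun i => (h i).exists_initial hW hx hinj
  have himg : ∀ i, ContinuousOn (fun s => φ (γ i s)) (Icc 0 (t i)) := fun i =>
    hφ.comp_continuousOn ((h i).continuousOn.mono (Icc_subset_Icc_right (ht i).2))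
  -- Two initial pieces form a connected set through `x`, on which `φ` is injective. A common value
  -- other than `φ x` is thus a common point of the rays.
  have key : ∀ i j, ∀ v, v ≠ φ x → v ∈ (fun s => φ (γ i s)) '' Icc 0 (t i) →
      v ∈ (fun s => φ (γ j s)) '' Icc 0 (t j) → i = j := by
    rintro i j v hv ⟨s, hs, rfl⟩ ⟨s', hs', hss⟩
    by_contra hij
    have h0 : ∀ i, x ∈ γ i '' Icc 0 (t i) := fun i => ⟨0, ⟨le_rfl, (ht i).1.le⟩, (h i).zero⟩
    have hpre : ∀ i, IsPreconnected (γ i '' Icc 0 (t i)) := fun i =>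
      isPreconnected_Icc.image _ ((h i).continuousOn.mono (Icc_subset_Icc_right (ht i).2))
    have heq := hinj _ (union_subset (htW i) (htW j)) ((hpre i).union x (h0 i) (h0 j) (hpre j))
      (.inl (h0 i)) (.inr (mem_image_of_mem _ hs')) (.inl (mem_image_of_mem _ hs)) hss
    have pos : ∀ i s, s ∈ Icc 0 (t i) → φ (γ i s) ≠ φ x → s ∈ Ioc (0 : ℝ) 1 := by
      intro i s hs hne
      refine ⟨lt_of_le_of_ne hs.1 fun h0 => hne ?_, hs.2.trans (ht i).2⟩
      rw [← h0, (h i).zero]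
    have hss' : φ (γ j s') = φ (γ i s) := hss
    exact hd i j hij s (pos i s hs hv) s' (pos j s' hs' (by rwa [hss'])) heq.symm
  -- By the intermediate value theorem, two rays ending above `φ x` both attain the lower of their
  -- end values. So at most one ray goes up, and likewise at most one goes down.
  have hup : ∀ i j, φ x < φ (γ i (t i)) → φ x < φ (γ j (t j)) → i = j := by
    intro i j hi hj
    have hm : φ x < min (φ (γ i (t i))) (φ (γ j (t j))) := lt_min hi hj
    refine key i j _ hm.ne' ?_ ?_
    · refine intermediate_value_Icc (ht i).1.le (himg i) ⟨?_, min_le_left _ _⟩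
      simpa only [(h i).zero] using hm.le
    · refine intermediate_value_Icc (ht j).1.le (himg j) ⟨?_, min_le_right _ _⟩
      simpa only [(h j).zero] using hm.le
  have hdown : ∀ i j, φ (γ i (t i)) < φ x → φ (γ j (t j)) < φ x → i = j := by
    intro i j hi hj
    have hm : max (φ (γ i (t i))) (φ (γ j (t j))) < φ x := max_lt hi hj
    refine key i j _ hm.ne ?_ ?_
    · refine intermediate_value_Icc' (ht i).1.le (himg i) ⟨le_max_left _ _, ?_⟩
      simpa only [(h i).zero] using hm.le
    · refine intermediate_value_Icc' (ht j).1.le (himg j) ⟨le_max_right _ _, ?_⟩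
      simpa only [(h j).zero] using hm.le
  constructor
  · have hinj2 : Function.Injective fun i => decide (φ x < φ (γ i (t i))) := by
      intro i j hij
      have hij' : φ x < φ (γ i (t i)) ↔ φ x < φ (γ j (t j)) := by simpa using hij
      by_cases hi : φ x < φ (γ i (t i))
      · exact hup i j hi (hij'.1 hi)
      · exact hdown i j (lt_of_le_of_ne (not_lt.1 hi) (htne i))
          (lt_of_le_of_ne (not_lt.1 fun hj => hi (hij'.2 hj)) (htne j))
    simpa using Nat.card_le_card_of_injective _ hinj2
  · intro hxp
    have : Subsingleton ι := ⟨fun i j => hup i j (lt_of_le_of_ne (hmin hxp _) (htne i).symm)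
      (lt_of_le_of_ne (hmin hxp _) (htne j).symm)⟩
    exact Finite.card_le_one_iff_subsingleton.2 this

/-- Two rays from `knasterPoint` have further common points. -/
theorem not_disjoint_rays_point {γ γ' : ℝ → Knaster} (h : IsRay knasterPoint γ)
    (h' : IsRay knasterPoint γ') :
    ∃ s ∈ Ioc (0 : ℝ) 1, ∃ t ∈ Ioc (0 : ℝ) 1, γ s = γ' t := by
  by_contra! hcon
  have := (card_rays_le (ι := Bool) (γ := fun b => bif b then γ else γ') (x := knasterPoint)
    (by rintro (_ | _); exacts [h', h]) (by
      rintro (_ | _) (_ | _) hb s hs t ht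
      · exact absurd rfl hb
      · exact (hcon t ht s hs).symm
      · exact hcon s hs t ht
      · exact absurd rfl hb)).2 rfl
  simp at this

theorem isRay_fold_flow {θ : solenoid} {δ : ℝ} (h : InjOn (fun s : ℝ => fold (θ + flow s)) (Icc (-δ) δ))
    (c : ℝ) (hc : c ≠ 0) (hc2 : |c| ≤ δ) : IsRay (fold θ) fun s => fold (θ + flow (c * s)) := by
  refine ⟨(continuous_fold.comp (continuous_const.add (continuous_flow.comp
    (continuous_const.mul continuous_id)))).continuousOn, by simp, fun s hs t ht hst => ?_⟩
  have hm : ∀ s ∈ Icc (0 : ℝ) 1, c * s ∈ Icc (-δ) δ := by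
    intro s hs
    rw [mem_Icc, ← abs_le, abs_mul, abs_of_nonneg hs.1]
    exact (mul_le_of_le_one_right (abs_nonneg c) hs.2).trans hc2
  exact mul_left_cancel₀ hc (h (hm s hs) (hm t ht) hst)

/-- Folding identifies `flow u` only with `flow u` and `flow (-u)`, and the times `c * s` with `s ≥
0` all have the same sign. -/
theorem isRay_fold_flow_zero (c : ℝ) (hc : c ≠ 0) :
    IsRay knasterPoint fun s => fold (flow (c * s)) := by
  refine ⟨(continuous_fold.comp (continuous_flow.comp
    (continuous_const.mul continuous_id))).continuousOn, by simp [fold_zero], fun s hs t ht hst => ?_⟩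
  have hst' : fold (flow (c * s)) = fold (flow (c * t)) := hst
  rcases fold_eq_iff.1 hst' with h | h
  · exact mul_left_cancel₀ hc (flow_injective h)
  · rw [← map_neg] at h
    have h2 := flow_injective h
    have : c * (s + t) = 0 := by linarith
    have := (mul_eq_zero.1 this).resolve_left hc
    linarith [hs.1, ht.1]

/-- A point other than `knasterPoint` is the midpoint of a leaf segment. An arc with `knasterPoint`
in its interior would split there into two rays with no further common point. -/
theorem isEndpoint_iff (q : Knaster) : IsEndpoint q ↔ q = knasterPoint := by
  constructor
  · intro h
    by_contra hq
    obtain ⟨θ, rfl⟩ := fold_surjective q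
    have hθ : θ ≠ 0 := by rintro rfl; exact hq fold_zero
    obtain ⟨δ, hδ, hinj⟩ := exists_injOn_fold_flow hθ
    have hcont : Continuous fun u : unitInterval => fold (θ + flow (δ * (2 * u - 1))) :=
      continuous_fold.comp (continuous_const.add (continuous_flow.comp (by fun_prop)))
    have := h _ hcont (fun u v huv => by
      have hm : ∀ u : unitInterval, δ * (2 * (u : ℝ) - 1) ∈ Icc (-δ) δ := fun u =>
        ⟨by nlinarith [u.2.1], by nlinarith [u.2.2]⟩
      have := mul_left_cancel₀ hδ.ne' (hinj (hm u) (hm v) huv)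
      exact Subtype.ext (by linarith)) ⟨1 / 2, by norm_num, by norm_num⟩ (by norm_num)
    rcases this with h | h <;> have := congrArg Subtype.val h <;> norm_num at this
  · rintro rfl γ hγ hinj t ht
    by_contra! hcon
    have h0 : 0 < (t : ℝ) := lt_of_le_of_ne t.2.1 fun h => hcon.1 (Subtype.ext h.symm)
    have h1 : (t : ℝ) < 1 := lt_of_le_of_ne t.2.2 fun h => hcon.2 (Subtype.ext h)
    have ray : ∀ c : ℝ, c ≠ 0 → (∀ s ∈ Icc (0 : ℝ) 1, (t : ℝ) + c * s ∈ Icc (0 : ℝ) 1) →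
        IsRay knasterPoint fun s => γ (projIcc 0 1 zero_le_one (t + c * s)) := by
      intro c hc hm
      refine ⟨(hγ.comp (continuous_projIcc.comp (by fun_prop))).continuousOn, ?_,
        fun s hs u hu hsu => ?_⟩
      · rw [mul_zero, add_zero, projIcc_val, ht]
      · have := hinj hsu
        rw [projIcc_of_mem _ (hm s hs), projIcc_of_mem _ (hm u hu)] at this
        have := congrArg Subtype.val this
        exact mul_left_cancel₀ hc (add_left_cancel this)
    have hm1 : ∀ s ∈ Icc (0 : ℝ) 1, (t : ℝ) + (1 - t) * s ∈ Icc (0 : ℝ) 1 := fun s hs =>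
      ⟨by nlinarith [hs.1], by nlinarith [hs.2]⟩
    have hm2 : ∀ s ∈ Icc (0 : ℝ) 1, (t : ℝ) + (-t) * s ∈ Icc (0 : ℝ) 1 := fun s hs =>
      ⟨by nlinarith [hs.2], by nlinarith [hs.1]⟩
    obtain ⟨s, hs, u, hu, hsu⟩ := not_disjoint_rays_point (ray (1 - t) (by linarith) hm1)
      (ray (-t) (by linarith) hm2)
    have := hinj hsu
    rw [projIcc_of_mem _ (hm1 s ⟨hs.1.le, hs.2⟩), projIcc_of_mem _ (hm2 u ⟨hu.1.le, hu.2⟩)] at this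
    have := congrArg Subtype.val this
    simp only at this
    nlinarith [mul_pos (by linarith : 0 < 1 - (t : ℝ)) hs.1, mul_pos h0 hu.1]

/-! ### Lifting rays through branched coverings -/

section Lift

variable {X Y : Type*} [TopologicalSpace X] [TopologicalSpace Y]

/-- Points of a sheet whose images tend to `y` tend to the point of the sheet over `y`. -/
theorem IsBranchedNhd.tendsto_sheet [CompactSpace X] [T2Space Y] {f : X → Y} (hf : Continuous f)
    {y : Y} {V : Set Y} {𝒰 : Set (Set X)} (hV : IsBranchedNhd f y V 𝒰) {U : Set X} (hU : U ∈ 𝒰) {x : X}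
    (hx : U ∩ f ⁻¹' {y} = {x}) {α : Type*} {l : Filter α} {u : α → X} (hu : ∀ᶠ a in l, u a ∈ U)
    (hfu : Tendsto (fun a => f (u a)) l (𝓝 y)) : Tendsto u l (𝓝 x) := by
  refine isCompact_univ.le_nhds_of_unique_clusterPt univ_mem fun z _ hz => ?_
  -- Compactness reduces the claim to cluster points `z`. Such a `z` lies over `y`, hence in some
  -- sheet; disjointness makes this sheet `U`, whose only point over `y` is `x`.
  have hz' : f z = y := by
    have h1 : ClusterPt (f z) (map f (map u l)) := hz.map hf.continuousAt tendsto_map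
    have h2 : map f (map u l) ≤ 𝓝 y := hfu
    have h3 : ClusterPt (f z) (𝓝 y) := h1.mono h2
    exact eq_of_nhds_neBot h3
  have hzV : z ∈ ⋃₀ 𝒰 := by rw [← hV.preimage_eq, mem_preimage, hz']; exact hV.mem
  obtain ⟨U', hU', hzU'⟩ := hzV
  have hUU : U' = U := by
    by_contra hne
    have hdis : Disjoint U' U := hV.pairwiseDisjoint hU' hU hne
    have h1 : U' ∈ 𝓝 z := (hV.isOpen_sheet U' hU').mem_nhds hzU'
    have h2 : U ∈ map u l := hu
    exact (clusterPt_iff_nonempty.1 hz h1 h2 : (U' ∩ U).Nonempty).ne_empty hdis.inter_eq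
  have : z ∈ U ∩ f ⁻¹' {y} := ⟨hUU ▸ hzU', hz'⟩
  rwa [hx] at this

/-- Over `(0, 1]` the ray lifts uniquely from each point over its far end, and
`IsBranchedNhd.tendsto_sheet` closes every lift up at `x`. Uniqueness keeps different lifts apart.
-/
theorem IsBranchedNhd.exists_ray_lifts [CompactSpace X] [T2Space X] [T2Space Y] {f : X → Y}
    (hf : Continuous f) {y : Y} {V : Set Y} {𝒰 : Set (Set X)} (hV : IsBranchedNhd f y V 𝒰) {U : Set X}
    (hU : U ∈ 𝒰) {x : X} (hx : U ∩ f ⁻¹' {y} = {x}) {k : ℕ} (hk : IsPuncturedCovering f U x V y k)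
    {h : ℝ → Y} (hh : IsRay y h) (hhV : ∀ s ∈ Ioc (0 : ℝ) 1, h s ∈ V) :
    ∃ Γ : ((U \ {x}) ∩ f ⁻¹' {h 1} : Set X) → ℝ → X, (∀ a, IsRay x (Γ a)) ∧
      (∀ a, ∀ s ∈ Icc (0 : ℝ) 1, f (Γ a s) = h s) ∧
      (∀ a b, ∀ s ∈ Ioc (0 : ℝ) 1, Γ a s = Γ b s → a = b) := by
  have hhV' : ∀ s ∈ Ioc (0 : ℝ) 1, h s ∈ V \ {y} := fun s hs => ⟨hhV s hs, fun h0 => by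
    rw [mem_singleton_iff, ← hh.zero] at h0
    exact hs.1.ne' (hh.injOn ⟨hs.1.le, hs.2⟩ (by simp) h0)⟩
  have hmem : ∀ r : ℝ, min 1 (Real.exp r) ∈ Ioc (0 : ℝ) 1 := fun r =>
    ⟨lt_min one_pos (Real.exp_pos r), min_le_left _ _⟩
  -- The logarithm turns `(0, 1]` into `r ≤ 0`, and the path is held constant for `r ≥ 0`, so that
  -- the lifting theorem applies on the simply connected line.
  let g : C(ℝ, (V \ {y} : Set Y)) := ⟨fun r => ⟨h (min 1 (Real.exp r)), hhV' _ (hmem r)⟩, by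
    refine Continuous.subtype_mk (hh.continuousOn.comp_continuous (by fun_prop) fun r => ?_) _
    exact ⟨(hmem r).1.le, (hmem r).2⟩⟩
  have hex : ∀ a : ((U \ {x}) ∩ f ⁻¹' {h 1} : Set X), ∃ F : C(ℝ, (U \ {x} : Set X)),
      F 0 = ⟨a.1, a.2.1⟩ ∧ hk.mapsTo.restrict ∘ F = g := by
    intro a
    refine (hk.isCoveringMap.existsUnique_continuousMap_lifts g (a₀ := 0) (e₀ := ⟨a.1, a.2.1⟩) ?_).exists
    ext
    have := a.2.2
    simp only [mem_preimage, mem_singleton_iff] at this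
    simp [g, this]
  choose F hF0 hF using hex
  have hFf : ∀ a r, f (F a r) = h (min 1 (Real.exp r)) := fun a r =>
    congrArg Subtype.val (congrFun (hF a) r)
  refine ⟨fun a s => if s ≤ 0 then x else F a (Real.log s), fun a => ?_, fun a s hs => ?_,
    fun a b s hs hab => ?_⟩
  · have hcov : ∀ s ∈ Icc (0 : ℝ) 1, f (if s ≤ 0 then x else F a (Real.log s)) = h s := by
      intro s hs
      split_ifs with h0
      · obtain rfl : s = 0 := le_antisymm h0 hs.1
        have : x ∈ U ∩ f ⁻¹' {y} := by rw [hx]; rfl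
        rw [hh.zero]; exact this.2
      · rw [hFf, Real.exp_log (not_le.1 h0), min_eq_right hs.2]
    refine ⟨fun s hs => ?_, by simp, fun s hs t ht hst => hh.injOn hs ht ?_⟩
    · rcases hs.1.eq_or_lt with rfl | h0
      · simp only [ContinuousWithinAt, le_refl, if_true]
        refine hV.tendsto_sheet hf hU hx ?_ ?_
        · refine Eventually.of_forall fun s => ?_
          have : x ∈ U ∩ f ⁻¹' {y} := by rw [hx]; rfl
          split_ifs
          exacts [this.1, (F a _).2.1]
        · have h1 : Tendsto h (𝓝[Icc 0 1] 0) (𝓝 y) := by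
            simpa [hh.zero, ContinuousWithinAt] using hh.continuousOn 0 (by simp)
          refine h1.congr' ?_
          filter_upwards [self_mem_nhdsWithin] with s hs
          exact (hcov s hs).symm
      · refine ContinuousAt.continuousWithinAt ?_
        have h1 : ContinuousAt (fun s => (F a (Real.log s) : X)) s :=
          (continuous_subtype_val.comp (F a).continuous).continuousAt.comp
            (Real.continuousAt_log h0.ne')
        refine h1.congr ?_
        filter_upwards [lt_mem_nhds h0] with r hr
        rw [if_neg (not_le.2 hr)]
    · have hst' : (if s ≤ 0 then x else (F a (Real.log s) : X)) = if t ≤ 0 then x else F a (Real.log t) := hst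
      rw [← hcov s hs, ← hcov t ht, hst']
  · dsimp only
    split_ifs with h0
    · obtain rfl : s = 0 := le_antisymm h0 hs.1
      have : x ∈ U ∩ f ⁻¹' {y} := by rw [hx]; rfl
      rw [hh.zero]; exact this.2
    · rw [hFf, Real.exp_log (not_le.1 h0), min_eq_right hs.2]
  · dsimp only at hab
    rw [if_neg (not_le.2 hs.1), if_neg (not_le.2 hs.1)] at hab
    have heq := hk.isCoveringMap.eq_of_comp_eq (F a).continuous (F b).continuous
      ((hF a).trans (hF b).symm) (Real.log s) (Subtype.ext hab)
    have h0 := congrFun heq 0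
    rw [hF0, hF0] at h0
    simp only [Subtype.mk.injEq] at h0
    exact Subtype.ext h0

end Lift


/-! ### Local degrees of branched coverings of the Knaster continuum -/

section Degree

variable {f : Knaster → Knaster} {V : Set Knaster} {𝒰 : Set (Set Knaster)} {U : Set Knaster}
  {x y : Knaster} {k : ℕ}

theorem exists_small_flow {θ : solenoid} (hV : IsOpen V) (hθ : fold θ ∈ V) :
    ∃ δ > 0, ∀ s, |s| ≤ δ → fold (θ + flow s) ∈ V := by
  have hc : Continuous fun s : ℝ => fold (θ + flow s) :=
    continuous_fold.comp (continuous_const.add continuous_flow)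
  have h0 : (fun s : ℝ => fold (θ + flow s)) ⁻¹' V ∈ 𝓝 (0 : ℝ) :=
    hc.continuousAt.preimage_mem_nhds (hV.mem_nhds (by simpa using hθ))
  obtain ⟨δ, hδ, hδ2⟩ := Metric.mem_nhds_iff.1 h0
  refine ⟨δ / 2, by positivity, fun s hs => hδ2 ?_⟩
  rw [Metric.mem_ball, Real.dist_eq, sub_zero]
  linarith

theorem nat_card_fiber (hk : IsPuncturedCovering f U x V y k) {v : Knaster} (hv : v ∈ V \ {y}) :
    Nat.card ((U \ {x}) ∩ f ⁻¹' {v} : Set Knaster) = k := by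
  rw [Nat.card_coe_set_eq, Set.ncard, hk.encard_fiber v hv]; simp

theorem exists_rays_fold (x : Knaster) (hx : x ≠ knasterPoint) {V : Set Knaster} (hV : IsOpen V) (hxV : x ∈ V) :
    ∃ h : Bool → ℝ → Knaster, (∀ b, IsRay x (h b)) ∧ (∀ b, ∀ s ∈ Icc (0 : ℝ) 1, h b s ∈ V) ∧
      ∀ s ∈ Ioc (0 : ℝ) 1, ∀ t ∈ Ioc (0 : ℝ) 1, h true s ≠ h false t := by
  obtain ⟨θ, rfl⟩ := fold_surjective x
  have hθ : θ ≠ 0 := by rintro rfl; exact hx fold_zero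
  obtain ⟨δ₁, hδ₁, hinj⟩ := exists_injOn_fold_flow hθ
  obtain ⟨δ₂, hδ₂, hsub⟩ := exists_small_flow hV hxV
  set δ := min δ₁ δ₂ with hδ
  have hδ0 : 0 < δ := lt_min hδ₁ hδ₂
  have habs : ∀ b : Bool, |(bif b then δ else -δ)| = δ := by
    rintro (_ | _) <;> simp [abs_of_pos hδ0]
  refine ⟨fun b s => fold (θ + flow ((bif b then δ else -δ) * s)), fun b => ?_, fun b s hs => ?_,
    fun s hs t ht hst => ?_⟩
  · refine isRay_fold_flow hinj _ ?_ ?_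
    · cases b <;> simp [hδ0.ne']
    · rw [habs]; exact min_le_left _ _
  · refine hsub _ ?_
    rw [abs_mul, habs, abs_of_nonneg hs.1]
    exact (mul_le_of_le_one_right hδ0.le hs.2).trans (min_le_right _ _)
  · have hm : ∀ c ∈ Icc (-1 : ℝ) 1, δ * c ∈ Icc (-δ₁) δ₁ := by
      intro c hc
      have : δ ≤ δ₁ := min_le_left _ _
      constructor <;> nlinarith [hc.1, hc.2]
    have h1 := hinj (hm s ⟨by linarith [hs.1], hs.2⟩) (hm (-t) ⟨by linarith [ht.2], by linarith [ht.1]⟩)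
      (by simpa using hst)
    have := mul_left_cancel₀ hδ0.ne' h1
    linarith [hs.1, ht.1]

/-- Two separate rays issue from `y`, and their `2 * k` lifts are separate rays at `x`; there is
room for two, and at `knasterPoint` for one. -/
theorem degree_of_ne_point (hf : Continuous f) (hV : IsBranchedNhd f y V 𝒰) (hU : U ∈ 𝒰)
    (hx : U ∩ f ⁻¹' {y} = {x}) (hk1 : 1 ≤ k) (hk : IsPuncturedCovering f U x V y k)
    (hy : y ≠ knasterPoint) : k = 1 ∧ x ≠ knasterPoint := by
  obtain ⟨h, hray, hin, hd⟩ := exists_rays_fold y hy hV.isOpen hV.mem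
  have hoc : ∀ b, ∀ s ∈ Ioc (0 : ℝ) 1, h b s ∈ V := fun b s hs => hin b s ⟨hs.1.le, hs.2⟩
  choose Γ hΓ hΓf hΓd using fun b => hV.exists_ray_lifts hf hU hx hk (hray b) (hoc b)
  have hcard := card_rays_le (ι := Σ b, ((U \ {x}) ∩ f ⁻¹' {h b 1} : Set Knaster))
    (γ := fun i => Γ i.1 i.2) (fun i => hΓ i.1 i.2) (by
      rintro ⟨b, i⟩ ⟨c, j⟩ hij s hs t ht hst
      dsimp only at hst
      have heq : h b s = h c t := by
        rw [← hΓf b i s ⟨hs.1.le, hs.2⟩, ← hΓf c j t ⟨ht.1.le, ht.2⟩, hst]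
      by_cases hbc : b = c
      · subst hbc
        have := (hray b).injOn ⟨hs.1.le, hs.2⟩ ⟨ht.1.le, ht.2⟩ heq
        subst this
        exact hij (by rw [hΓd b i j s hs hst])
      · cases b <;> cases c
        · exact hbc rfl
        · exact hd t ht s hs heq.symm
        · exact hd s hs t ht heq
        · exact hbc rfl)
  have hfc : ∀ b, Nat.card ((U \ {x}) ∩ f ⁻¹' {h b 1} : Set Knaster) = k := fun b =>
    nat_card_fiber hk ⟨hin b 1 (by simp), fun h0 => by
      rw [mem_singleton_iff, ← (hray b).zero] at h0
      exact one_ne_zero ((hray b).injOn (by simp) (by simp) h0)⟩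
  have hfin : ∀ b, Finite ((U \ {x}) ∩ f ⁻¹' {h b 1} : Set Knaster) := fun b =>
    Nat.finite_of_card_ne_zero (by rw [hfc b]; omega)
  rw [Nat.card_sigma] at hcard
  simp only [hfc, Finset.sum_const, Finset.card_univ, Fintype.card_bool, smul_eq_mul] at hcard
  exact ⟨by omega, fun h => by have := hcard.2 h; omega⟩

/-- One ray at `knasterPoint` lifts to `k` rays at `x`, which gives the upper bounds. For `x ≠
knasterPoint`, degree one is excluded by pushing two separate rays forward. -/
theorem degree_over_point (hf : Continuous f) (hV : IsBranchedNhd f knasterPoint V 𝒰) (hU : U ∈ 𝒰)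
    (hx : U ∩ f ⁻¹' {knasterPoint} = {x}) (hk1 : 1 ≤ k) (hk : IsPuncturedCovering f U x V knasterPoint k) :
    (x = knasterPoint → k = 1) ∧ (x ≠ knasterPoint → k = 2) := by
  obtain ⟨δ, hδ, hin⟩ := exists_small_flow (θ := 0) hV.isOpen (by rw [fold_zero]; exact hV.mem)
  have hray := isRay_fold_flow_zero δ hδ.ne'
  have hin' : ∀ s ∈ Icc (0 : ℝ) 1, fold (flow (δ * s)) ∈ V := fun s hs => by
    have := hin (δ * s) (by
      rw [abs_mul, abs_of_pos hδ, abs_of_nonneg hs.1]; exact mul_le_of_le_one_right hδ.le hs.2)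
    rwa [zero_add] at this
  obtain ⟨Γ, hΓ, hΓf, hΓd⟩ := hV.exists_ray_lifts hf hU hx hk hray fun s hs => hin' s ⟨hs.1.le, hs.2⟩
  have hcard := card_rays_le hΓ (by
    intro i j hij s hs t ht hst
    have heq : fold (flow (δ * s)) = fold (flow (δ * t)) := by
      rw [← hΓf i s ⟨hs.1.le, hs.2⟩, ← hΓf j t ⟨ht.1.le, ht.2⟩, hst]
    have := hray.injOn ⟨hs.1.le, hs.2⟩ ⟨ht.1.le, ht.2⟩ heq
    subst this
    exact hij (hΓd i j s hs hst))
  rw [nat_card_fiber hk ⟨hin' 1 (by simp), fun h0 => by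
    have h0' : fold (flow (δ * 1)) = fold (flow (δ * 0)) := by simpa [fold_zero] using h0
    exact one_ne_zero (hray.injOn (by simp) (by simp) h0')⟩] at hcard
  refine ⟨fun h => by have := hcard.2 h; omega, fun hxp => ?_⟩
  by_contra hk2
  obtain rfl : k = 1 := by omega
  have hxU : x ∈ U ∩ f ⁻¹' {knasterPoint} := by rw [hx]; rfl
  have hinj : InjOn f U := by
    have only : ∀ u ∈ U, f u = knasterPoint → u = x := fun u hu h0 => by
      have : u ∈ U ∩ f ⁻¹' {knasterPoint} := ⟨hu, h0⟩
      rwa [hx] at this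
    intro u hu u' hu' huu
    by_cases h0 : f u = knasterPoint
    · rw [only u hu h0, only u' hu' (huu ▸ h0)]
    · have hux : u ≠ x := by rintro rfl; exact h0 hxU.2
      have hux' : u' ≠ x := by rintro rfl; exact h0 (huu.trans hxU.2)
      have h1 := hk.encard_fiber (f u) (hk.mapsTo ⟨hu, hux⟩)
      rw [Nat.cast_one, encard_eq_one] at h1
      obtain ⟨z, hz⟩ := h1
      have e1 : u ∈ (U \ {x}) ∩ f ⁻¹' {f u} := ⟨⟨hu, hux⟩, rfl⟩
      have e2 : u' ∈ (U \ {x}) ∩ f ⁻¹' {f u} := ⟨⟨hu', hux'⟩, huu.symm⟩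
      rw [hz] at e1 e2
      exact e1.trans e2.symm
  obtain ⟨h, hr, hin, hd⟩ := exists_rays_fold x hxp (hV.isOpen_sheet U hU) hxU.1
  have hr' : ∀ b, IsRay knasterPoint fun s => f (h b s) := fun b =>
    ⟨hf.comp_continuousOn (hr b).continuousOn, by rw [(hr b).zero]; exact hxU.2,
      fun s hs t ht hst => (hr b).injOn hs ht (hinj (hin b s hs) (hin b t ht) hst)⟩
  obtain ⟨s, hs, t, ht, hst⟩ := not_disjoint_rays_point (hr' true) (hr' false)
  exact hd s hs t ht (hinj (hin true s ⟨hs.1.le, hs.2⟩) (hin false t ⟨ht.1.le, ht.2⟩) hst)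

theorem IsBranchedCovering.exists_hasLocalDegree {X Y : Type*} [TopologicalSpace X] [TopologicalSpace Y]
    {f : X → Y} (hf : IsBranchedCovering f) (x : X) : ∃ k, 1 ≤ k ∧ HasLocalDegree f x k := by
  obtain ⟨V, 𝒰, hV⟩ := hf.2 (f x)
  have : x ∈ ⋃₀ 𝒰 := by rw [← hV.preimage_eq]; exact hV.mem
  obtain ⟨U, hU, hxU⟩ := this
  obtain ⟨x', k, hx', hk1, hk⟩ := hV.sheet U hU
  have : x ∈ U ∩ f ⁻¹' {f x} := ⟨hxU, rfl⟩
  rw [hx'] at this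
  obtain rfl : x = x' := this
  exact ⟨k, hk1, V, 𝒰, U, hV, hU, hxU, hk⟩

theorem eq_of_mem_sheet {X Y : Type*} [TopologicalSpace X] [TopologicalSpace Y] {f : X → Y} {y : Y}
    {V : Set Y} {𝒰 : Set (Set X)} (hV : IsBranchedNhd f y V 𝒰) {U : Set X} (hU : U ∈ 𝒰) {x : X}
    (hx : x ∈ U) (hxy : f x = y) : U ∩ f ⁻¹' {y} = {x} := by
  obtain ⟨x', k, hx', -, -⟩ := hV.sheet U hU
  have : x ∈ U ∩ f ⁻¹' {y} := ⟨hx, hxy⟩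
  rw [hx'] at this ⊢
  rw [mem_singleton_iff.1 this]

theorem diff_singleton_nonempty {V : Set Knaster} (hV : IsOpen V) {y : Knaster} (hy : y ∈ V) :
    (V \ {y}).Nonempty := by
  by_cases h : y = knasterPoint
  · subst h
    obtain ⟨δ, hδ, hin⟩ := exists_small_flow (θ := 0) hV (by rwa [fold_zero])
    refine ⟨fold (0 + flow δ), hin δ (abs_of_pos hδ).le, fun h0 => ?_⟩
    rw [zero_add, mem_singleton_iff, fold_eq_point_iff, ← map_zero flow] at h0
    exact hδ.ne' (flow_injective h0)
  · obtain ⟨g, hr, hin, -⟩ := exists_rays_fold y h hV hy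
    refine ⟨g true 1, hin true 1 (by simp), fun h0 => ?_⟩
    rw [mem_singleton_iff, ← (hr true).zero] at h0
    exact one_ne_zero ((hr true).injOn (by simp) (by simp) h0)

theorem HasLocalDegree.eq (hf : Continuous f) (h : HasLocalDegree f x k) :
    (f x ≠ knasterPoint → k = 1 ∧ x ≠ knasterPoint) ∧
      (f x = knasterPoint → (x = knasterPoint → k = 1) ∧ (x ≠ knasterPoint → k = 2)) := by
  obtain ⟨V, 𝒰, U, hV, hU, hxU, hk⟩ := h
  have hx := eq_of_mem_sheet hV hU hxU rfl
  -- `HasLocalDegree` does not demand `1 ≤ k`. The bound comes from the degree that `IsBranchedNhd`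
  -- supplies for the same sheet, compared on a nearby fibre.
  have hk1 : 1 ≤ k := by
    obtain ⟨x', k', hx', hk', hcov⟩ := hV.sheet U hU
    obtain rfl : x = x' := by rw [hx] at hx'; exact singleton_injective hx'
    obtain ⟨v, hv⟩ := diff_singleton_nonempty hV.isOpen hV.mem
    have : (k : ℕ∞) = k' := by rw [← hk.encard_fiber v hv, hcov.encard_fiber v hv]
    have : k = k' := by exact_mod_cast this
    omega
  refine ⟨fun hy => degree_of_ne_point hf hV hU hx hk1 hk hy, fun hy => ?_⟩
  rw [hy] at hV hx hk
  exact degree_over_point hf hV hU hx hk1 hk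

theorem IsBranchedCovering.hasLocalDegree_localDegree {X Y : Type*} [TopologicalSpace X]
    [TopologicalSpace Y] {f : X → Y} (hf : IsBranchedCovering f) (x : X) :
    HasLocalDegree f x (localDegree f x) := by
  obtain ⟨k, -, hk⟩ := hf.exists_hasLocalDegree x
  exact Nat.sInf_mem (s := {k | HasLocalDegree f x k}) ⟨k, hk⟩

variable (hf : IsBranchedCovering f)
include hf

theorem map_knasterPoint : f knasterPoint = knasterPoint := by
  by_contra h
  exact (((hf.hasLocalDegree_localDegree knasterPoint).eq hf.1).1 h).2 rfl

theorem localDegree_knasterPoint : localDegree f knasterPoint = 1 :=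
  (((hf.hasLocalDegree_localDegree knasterPoint).eq hf.1).2 (map_knasterPoint hf)).1 rfl

theorem localDegree_of_map_eq (hx : f x = knasterPoint) (hxp : x ≠ knasterPoint) : localDegree f x = 2 :=
  (((hf.hasLocalDegree_localDegree x).eq hf.1).2 hx).2 hxp

theorem localDegree_of_map_ne (hx : f x ≠ knasterPoint) : localDegree f x = 1 :=
  (((hf.hasLocalDegree_localDegree x).eq hf.1).1 hx).1

theorem criticalPoints_eq : criticalPoints f = f ⁻¹' {knasterPoint} \ {knasterPoint} := by
  ext x
  change 2 ≤ localDegree f x ↔ f x = knasterPoint ∧ ¬ x = knasterPoint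
  by_cases hx : f x = knasterPoint
  · by_cases hxp : x = knasterPoint
    · subst hxp; simp [localDegree_knasterPoint hf]
    · simp [localDegree_of_map_eq hf hx hxp, hx, hxp]
  · simp [localDegree_of_map_ne hf hx, hx]

theorem criticalValues_subset : criticalValues f ⊆ {knasterPoint} := by
  rintro _ ⟨x, hx, rfl⟩
  rw [criticalPoints_eq hf] at hx
  exact hx.1

-- A point `v ≠ knasterPoint` near `knasterPoint` is not a critical value, so its fibre has `d`
-- points. Each sheet over the neighbourhood contributes two of them, except the sheet of
-- `knasterPoint`, which contributes one.
omit hf in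
theorem degree_eq {d : ℕ} (hf : IsBranchedCoveringOfDegree f d) :
    (criticalPoints f).Finite ∧ d = 2 * (criticalPoints f).ncard + 1 := by
  classical
  obtain ⟨V, 𝒰, hV⟩ := hf.1.2 knasterPoint
  obtain ⟨v, hv⟩ := diff_singleton_nonempty hV.isOpen hV.mem
  have hd := hf.2 v fun h => hv.2 (criticalValues_subset hf.1 h)
  choose c k hc hk1 hk using hV.sheet
  let fib : 𝒰 → Set Knaster := fun U => (U.1 \ {c U.1 U.2}) ∩ f ⁻¹' {v}
  have hfib : f ⁻¹' {v} = ⋃ U, fib U := by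
    ext x
    simp only [fib, mem_iUnion]
    constructor
    · intro hx
      have hx' : f x = v := hx
      have : x ∈ ⋃₀ 𝒰 := by rw [← hV.preimage_eq, mem_preimage, hx']; exact hv.1
      obtain ⟨U, hU, hxU⟩ := this
      refine ⟨⟨U, hU⟩, ⟨hxU, fun h => hv.2 ?_⟩, hx⟩
      have : c U hU ∈ U ∩ f ⁻¹' {knasterPoint} := by rw [hc]; rfl
      rw [mem_singleton_iff] at h ⊢
      rw [← hx', h]; exact this.2
    · rintro ⟨U, -, hx⟩; exact hx
  have hcard : ∀ U : 𝒰, Nat.card (fib U) = k U.1 U.2 := fun U => nat_card_fiber (hk U.1 U.2) hv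
  have hdisj : Pairwise fun U U' => Disjoint (fib U) (fib U') := by
    intro U U' h
    have : Disjoint U.1 U'.1 := hV.pairwiseDisjoint U.2 U'.2 fun h' => h (Subtype.ext h')
    exact this.mono (fun x hx => hx.1.1) fun x hx => hx.1.1
  have hne : ∀ U : 𝒰, (fib U).Nonempty := fun U => by
    rw [nonempty_iff_ne_empty]
    intro h
    have := hcard U
    rw [h] at this
    have h1 := hk1 U.1 U.2
    simp at this
    omega
  have hfinv : (f ⁻¹' {v}).Finite := finite_of_encard_eq_coe hd
  choose b hb using hne
  have hfin𝒰 : Finite 𝒰 := by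
    have := hfinv.to_subtype
    refine Finite.of_injective (fun U => (⟨b U, by rw [hfib]; exact mem_iUnion.2 ⟨U, hb U⟩⟩ : f ⁻¹' {v})) ?_
    intro U U' h
    by_contra hne
    have h' : b U = b U' := congrArg Subtype.val h
    exact (disjoint_left.1 (hdisj hne)) (hb U) (h' ▸ hb U')
  have : Fintype 𝒰 := Fintype.ofFinite _
  have hfinfib : ∀ U, Finite (fib U) := fun U =>
    Nat.finite_of_card_ne_zero (by rw [hcard U]; have := hk1 U.1 U.2; omega)
  have hsum : d = ∑ U : 𝒰, k U.1 U.2 := by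
    have h1 : Nat.card (f ⁻¹' {v}) = d := by rw [Nat.card_coe_set_eq, ncard, hd]; simp
    rw [← h1, hfib, Nat.card_congr (unionEqSigmaOfDisjoint hdisj), Nat.card_sigma]
    simp only [hcard]
  have hcinj : ∀ U U' : 𝒰, c U.1 U.2 = c U'.1 U'.2 → U = U' := by
    intro U U' h
    by_contra hne
    have : Disjoint U.1 U'.1 := hV.pairwiseDisjoint U.2 U'.2 fun h' => hne (Subtype.ext h')
    have m : ∀ U : 𝒰, c U.1 U.2 ∈ U.1 := fun U => by
      have : c U.1 U.2 ∈ U.1 ∩ f ⁻¹' {knasterPoint} := by rw [hc]; rfl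
      exact this.1
    exact disjoint_left.1 this (m U) (h ▸ m U')
  have hcrange : range (fun U : 𝒰 => c U.1 U.2) = f ⁻¹' {knasterPoint} := by
    ext x
    constructor
    · rintro ⟨U, rfl⟩
      have : c U.1 U.2 ∈ U.1 ∩ f ⁻¹' {knasterPoint} := by rw [hc]; rfl
      exact this.2
    · intro hx
      have : x ∈ ⋃₀ 𝒰 := by rw [← hV.preimage_eq, mem_preimage, show f x = knasterPoint from hx]; exact hV.mem
      obtain ⟨U, hU, hxU⟩ := this
      refine ⟨⟨U, hU⟩, ?_⟩
      have h1 : x ∈ U ∩ f ⁻¹' {knasterPoint} := ⟨hxU, hx⟩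
      rw [hc U hU] at h1
      exact h1.symm
  have hp : knasterPoint ∈ f ⁻¹' {knasterPoint} := map_knasterPoint hf.1
  have hfinp : (f ⁻¹' {knasterPoint}).Finite := by rw [← hcrange]; exact finite_range _
  have hncard : (f ⁻¹' {knasterPoint}).ncard = Fintype.card 𝒰 := by
    rw [← hcrange, ← Nat.card_coe_set_eq, Nat.card_range_of_injective (fun U U' h => hcinj U U' h),
      Nat.card_eq_fintype_card]
  obtain ⟨U₀, hU₀⟩ : knasterPoint ∈ range (fun U : 𝒰 => c U.1 U.2) := by rw [hcrange]; exact hp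
  -- `U₀` is the sheet of `knasterPoint`; adding one to its degree makes all summands equal to two.
  have hkval : ∀ U : 𝒰, k U.1 U.2 + (if U = U₀ then 1 else 0) = 2 := by
    intro U
    have h1 := degree_over_point hf.1.1 hV U.2 (hc U.1 U.2) (hk1 U.1 U.2) (hk U.1 U.2)
    split_ifs with h
    · rw [h1.1 (h ▸ hU₀)]
    · rw [h1.2 fun h' => h (hcinj U U₀ (h'.trans hU₀.symm))]
  have hsum2 : d + 1 = 2 * Fintype.card 𝒰 := by
    have : ∑ U : 𝒰, (k U.1 U.2 + (if U = U₀ then 1 else 0)) = ∑ U : 𝒰, 2 :=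
      Finset.sum_congr rfl fun U _ => hkval U
    rw [Finset.sum_add_distrib, ← hsum, Finset.sum_ite_eq' Finset.univ U₀] at this
    simpa [mul_comm] using this
  rw [criticalPoints_eq hf.1]
  refine ⟨hfinp.sdiff, ?_⟩
  rw [ncard_sdiff_singleton_of_mem hp, hncard]
  omega

end Degree

/-! ### Continuous logarithms -/

theorem exists_continuous_log {A : Type*} [TopologicalSpace A] [SimplyConnectedSpace A]
    [LocallyPathConnectedSpace A] {f : A → ℂ} (hf : Continuous f) (h0 : ∀ a, f a ≠ 0) :
    ∃ h : A → ℂ, Continuous h ∧ ∀ a, Complex.exp (h a) = f a := by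
  obtain ⟨a₀⟩ : Nonempty A := inferInstance
  obtain ⟨h, ⟨-, hh⟩, -⟩ := Complex.isCoveringMap_exp.existsUnique_continuousMap_lifts
    (⟨fun a => ⟨f a, h0 a⟩, hf.subtype_mk _⟩ : C(A, {z : ℂ // z ≠ 0})) a₀ (Complex.log (f a₀))
    (Subtype.ext (Complex.exp_log (h0 a₀)))
  exact ⟨h, h.continuous, fun a => congrArg Subtype.val (congrFun hh a)⟩

/-- At one point the two logarithms differ by a multiple of `2πi`; uniqueness of lifts through `exp`
propagates it. -/
theorem eq_add_of_exp_eq {A : Type*} [TopologicalSpace A] [PreconnectedSpace A] {f g : A → ℂ}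
    (hf : Continuous f) (hg : Continuous g) (h : ∀ a, Complex.exp (f a) = Complex.exp (g a)) :
    ∃ c : ℂ, ∀ a, f a = g a + c := by
  rcases isEmpty_or_nonempty A with hA | ⟨⟨a₀⟩⟩
  · exact ⟨0, fun a => hA.elim a⟩
  · obtain ⟨n, hn⟩ := Complex.exp_eq_exp_iff_exists_int.1 (h a₀)
    refine ⟨n * (2 * Real.pi * Complex.I), fun a => congrFun (Complex.isCoveringMap_exp.eq_of_comp_eq hf
      (hg.add continuous_const) (funext fun a => Subtype.ext ?_) a₀ hn) a⟩
    simp only [Function.comp, Pi.add_apply]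
    rw [h a, Complex.exp_add, Complex.exp_int_mul_two_pi_mul_I, mul_one]

/-- `f` is the exponential of a continuous function on `X`. -/
def HasLogOn (X : Set ℂ) (f : ℂ → ℂ) : Prop :=
  ∃ h : ℂ → ℂ, ContinuousOn h X ∧ ∀ z ∈ X, Complex.exp (h z) = f z

namespace HasLogOn

variable {X : Set ℂ} {f g : ℂ → ℂ}

theorem congr (hf : HasLogOn X f) (h : ∀ z ∈ X, f z = g z) : HasLogOn X g :=
  let ⟨u, hu, hu2⟩ := hf
  ⟨u, hu, fun z hz => (hu2 z hz).trans (h z hz)⟩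

theorem mono {Y : Set ℂ} (hf : HasLogOn X f) (h : Y ⊆ X) : HasLogOn Y f :=
  let ⟨u, hu, hu2⟩ := hf
  ⟨u, hu.mono h, fun z hz => hu2 z (h hz)⟩

theorem one : HasLogOn X fun _ => 1 := ⟨fun _ => 0, continuousOn_const, by simp⟩

theorem mul (hf : HasLogOn X f) (hg : HasLogOn X g) : HasLogOn X fun z => f z * g z :=
  let ⟨u, hu, hu2⟩ := hf
  let ⟨v, hv, hv2⟩ := hg
  ⟨fun z => u z + v z, hu.add hv, fun z hz => by rw [Complex.exp_add, hu2 z hz, hv2 z hz]⟩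

theorem inv (hf : HasLogOn X f) : HasLogOn X fun z => (f z)⁻¹ :=
  let ⟨u, hu, hu2⟩ := hf
  ⟨fun z => -u z, hu.neg, fun z hz => by rw [Complex.exp_neg, hu2 z hz]⟩

theorem zpow (hf : HasLogOn X f) (n : ℤ) : HasLogOn X fun z => f z ^ n :=
  let ⟨u, hu, hu2⟩ := hf
  ⟨fun z => n * u z, continuousOn_const.mul hu, fun z hz => by rw [Complex.exp_int_mul, hu2 z hz]⟩

theorem prod {ι : Type*} (s : Finset ι) {F : ι → ℂ → ℂ} (h : ∀ i ∈ s, HasLogOn X (F i)) :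
    HasLogOn X fun z => ∏ i ∈ s, F i z := by
  classical
  induction s using Finset.induction_on with
  | empty => simpa using one
  | insert a s ha ih =>
    simp only [Finset.prod_insert ha]
    exact (h a (Finset.mem_insert_self a s)).mul (ih fun i hi => h i (Finset.mem_insert_of_mem hi))

theorem of_slitPlane (hf : ContinuousOn f X) (h : ∀ z ∈ X, f z ∈ Complex.slitPlane) : HasLogOn X f :=
  ⟨fun z => Complex.log (f z), hf.clog h, fun z hz =>
    Complex.exp_log (Complex.slitPlane_ne_zero (h z hz))⟩

theorem const {c : ℂ} (hc : c ≠ 0) : HasLogOn X fun _ => c :=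
  ⟨fun _ => Complex.log c, continuousOn_const, fun _ _ => Complex.exp_log hc⟩

end HasLogOn

/-! ### Rational functions with prescribed zeros and poles -/

open Classical in
/-- `z - a`, with the value `1` at `z = a`. -/
noncomputable def linFactor (a z : ℂ) : ℂ := if z = a then 1 else z - a

theorem linFactor_of_ne {a z : ℂ} (h : z ≠ a) : linFactor a z = z - a := if_neg h

/-- The artificial value `1` at `z = a` serves this purpose: products, inverses and integer powers
need no side conditions. -/
theorem linFactor_ne_zero (a z : ℂ) : linFactor a z ≠ 0 := by
  unfold linFactor; split_ifs with h
  exacts [one_ne_zero, sub_ne_zero.2 h]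

theorem continuousAt_linFactor {a z : ℂ} (h : z ≠ a) : ContinuousAt (linFactor a) z := by
  refine (continuousAt_id.sub continuousAt_const : ContinuousAt (fun z => z - a) z).congr ?_
  filter_upwards [isOpen_ne.mem_nhds h] with w hw
  exact (linFactor_of_ne hw).symm

/-- The rational function with divisor `k` (away from the support of `k`). -/
noncomputable def ratFun (k : ℂ →₀ ℤ) (z : ℂ) : ℂ := k.prod fun a n => linFactor a z ^ n

theorem ratFun_zero (z : ℂ) : ratFun 0 z = 1 := Finsupp.prod_zero_index

theorem ratFun_add (k l : ℂ →₀ ℤ) (z : ℂ) : ratFun (k + l) z = ratFun k z * ratFun l z := by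
  classical
  exact Finsupp.prod_add_index (fun a _ => zpow_zero _) fun a _ m n => zpow_add₀ (linFactor_ne_zero a z) m n

theorem ratFun_mapDomain (ρ : ℂ → ℂ) (k : ℂ →₀ ℤ) (z : ℂ) :
    ratFun (k.mapDomain ρ) z = k.prod fun a n => linFactor (ρ a) z ^ n :=
  Finsupp.prod_mapDomain_index (fun _ => zpow_zero _) fun a m n => zpow_add₀ (linFactor_ne_zero a z) m n

theorem ratFun_ne_zero (k : ℂ →₀ ℤ) (z : ℂ) : ratFun k z ≠ 0 :=
  Finset.prod_ne_zero_iff.2 fun _ _ => zpow_ne_zero _ (linFactor_ne_zero _ _)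

theorem ratFun_neg (k : ℂ →₀ ℤ) (z : ℂ) : ratFun (-k) z = (ratFun k z)⁻¹ := by
  rw [← mul_eq_one_iff_eq_inv₀ (ratFun_ne_zero k z), ← ratFun_add, neg_add_cancel, ratFun_zero]

theorem ratFun_nsmul (m : ℕ) (k : ℂ →₀ ℤ) (z : ℂ) : ratFun (m • k) z = ratFun k z ^ m := by
  induction m with
  | zero => simp [ratFun_zero]
  | succ m ih => rw [succ_nsmul, ratFun_add, ih, pow_succ]

theorem continuousAt_ratFun {k : ℂ →₀ ℤ} {z : ℂ} (h : z ∉ k.support) : ContinuousAt (ratFun k) z := by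
  refine tendsto_finsetProd _ fun a ha => ?_
  exact (continuousAt_linFactor (by rintro rfl; exact h ha)).zpow₀ _ (.inl (linFactor_ne_zero _ _))

theorem HasLogOn.ratFun_of_forall {X : Set ℂ} {k : ℂ →₀ ℤ}
    (h : ∀ a ∈ k.support, HasLogOn X (linFactor a)) : HasLogOn X (ratFun k) :=
  HasLogOn.prod _ fun a ha => (h a ha).zpow _

/-! ### Winding numbers -/

/-- On the circle, `z - a = z * (1 - a / z)`, where the second factor has a principal logarithm. The
explicit logarithm `L` grows by `2πi` times the sum of multiplicities over one turn, while `H`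
returns to its value. -/
theorem sum_eq_zero_of_hasLog_circle {k : ℂ →₀ ℤ} {r : ℝ} (hk : ∀ a ∈ k.support, ‖a‖ < r) {H : ℂ → ℂ}
    (hH : Continuous H) (h : ∀ z, ‖z‖ = r → Complex.exp (H z) = ratFun k z) :
    k.sum (fun _ n => n) = 0 := by
  by_cases hne : k.support = ∅
  · rw [Finsupp.support_eq_empty.1 hne]; rfl
  obtain ⟨a₀, ha₀⟩ := Finset.nonempty_iff_ne_empty.2 hne
  have hr : 0 < r := (norm_nonneg a₀).trans_lt (hk a₀ ha₀)
  have hrc : (r : ℂ) ≠ 0 := by exact_mod_cast hr.ne'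
  let γ : ℝ → ℂ := fun t => r * Complex.exp (t * Complex.I)
  have hγ : ∀ t, ‖γ t‖ = r := fun t => by
    simp [γ, Complex.norm_exp_ofReal_mul_I, abs_of_pos hr]
  have hγ0 : ∀ t, γ t ≠ 0 := fun t => by rw [← norm_pos_iff, hγ]; exact hr
  have hγc : Continuous γ := by fun_prop
  have hsl : ∀ a ∈ k.support, ∀ t, 1 + -(a / γ t) ∈ Complex.slitPlane := fun a ha t => by
    refine Complex.mem_slitPlane_of_norm_lt_one ?_
    rw [norm_neg, norm_div, hγ, div_lt_one hr]
    exact hk a ha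
  let L : ℝ → ℂ := fun t => k.sum fun a n =>
    n * (Complex.log r + t * Complex.I + Complex.log (1 + -(a / γ t)))
  have hLc : Continuous L := by
    refine continuous_finsetSum _ fun a ha => ?_
    refine continuous_const.mul ((by fun_prop : Continuous fun t : ℝ => Complex.log r + t * Complex.I).add ?_)
    refine Continuous.clog ?_ (hsl a ha)
    exact continuous_const.add (continuous_const.div hγc hγ0).neg
  have hexp : ∀ t, Complex.exp (H (γ t)) = Complex.exp (L t) := fun t => by
    rw [h _ (hγ t)]
    simp only [L, Finsupp.sum, Complex.exp_sum, ratFun, Finsupp.prod]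
    refine Finset.prod_congr rfl fun a ha => ?_
    have hne : γ t ≠ a := fun h' => by have := hk a ha; rw [← h', hγ] at this; exact this.false
    rw [Complex.exp_int_mul, Complex.exp_add, Complex.exp_add, Complex.exp_log hrc,
      Complex.exp_log (Complex.slitPlane_ne_zero (hsl a ha t)), linFactor_of_ne hne]
    congr 1
    have := hγ0 t
    change γ t - a = γ t * _
    field_simp
    ring
  obtain ⟨c, hc⟩ := eq_add_of_exp_eq (hH.comp hγc) hLc hexp
  have hper : γ (2 * Real.pi) = γ 0 := by simp [γ]
  have h1 : L (2 * Real.pi) = L 0 := by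
    have e1 := hc (2 * Real.pi)
    have e2 := hc 0
    simp only [Function.comp] at e1 e2
    rw [hper, e2] at e1
    exact (add_right_cancel e1).symm
  have h2 : L (2 * Real.pi) - L 0 = (k.sum fun _ n => n : ℤ) * (2 * Real.pi * Complex.I) := by
    simp only [L, hper, Finsupp.sum, ← Finset.sum_sub_distrib]
    push_cast
    rw [Finset.sum_mul]
    exact Finset.sum_congr rfl fun a _ => by ring
  rw [h1, sub_self] at h2
  have := (mul_eq_zero.1 h2.symm).resolve_right Complex.two_pi_I_ne_zero
  exact_mod_cast this

/-- If a rational function has a logarithm on a compact set, then its zeros and poles in a bounded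
component of the complement cancel. -/
theorem sum_filter_eq_zero {X : Set ℂ} (hX : IsCompact X) {k : ℂ →₀ ℤ} (hk : ∀ a ∈ k.support, a ∉ X)
    (hlog : HasLogOn X (ratFun k)) {Ω : Set ℂ} (hΩ : IsOpen Ω) (hfr : frontier Ω ⊆ X)
    (hb : Bornology.IsBounded Ω) [DecidablePred (· ∈ Ω)] :
    (k.filter (· ∈ Ω)).sum (fun _ n => n) = 0 := by
  obtain ⟨u, hu, hu2⟩ := hlog
  obtain ⟨v, hv⟩ := ContinuousMap.exists_restrict_eq hX.isClosed (⟨X.domRestrict u, hu.domRestrict⟩ : C(X, ℂ))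
  have hvu : ∀ z ∈ X, v z = u z := fun z hz => congrArg (fun F : C(X, ℂ) => F ⟨z, hz⟩) hv
  set k₁ := k.filter (· ∈ Ω) with hk₁
  set k₂ := k.filter (fun a => ¬ a ∈ Ω) with hk₂
  have hsplit : k₁ + k₂ = k := Finsupp.filter_add_filter_not k _
  have hs1 : ∀ a ∈ k₁.support, a ∈ Ω := fun a ha => by
    rw [hk₁, Finsupp.support_filter, Finset.mem_filter] at ha; exact ha.2
  have hs2 : ∀ a ∈ k₂.support, a ∉ Ω ∧ a ∉ X := fun a ha => by
    rw [hk₂, Finsupp.support_filter, Finset.mem_filter] at ha; exact ⟨ha.2, hk a ha.1⟩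
  have hcl : closure Ω ⊆ Ω ∪ X := by
    rw [closure_eq_self_union_frontier]; exact union_subset_union_right _ hfr
  -- On the frontier `exp v = ratFun k₁ * ratFun k₂`, so the two formulas agree there. The glued
  -- function has no zeros, hence has a logarithm on the whole plane, and outside `Ω` it is `ratFun
  -- k₁`.
  have hR : Continuous fun z => if z ∈ Ω then Complex.exp (v z) * (ratFun k₂ z)⁻¹ else ratFun k₁ z := by
    refine continuous_if (fun z hz => ?_) (fun z hz => ?_) (fun z hz => ?_)
    · have hzX := hfr hz
      rw [hvu z hzX, hu2 z hzX, ← hsplit, ratFun_add, mul_inv_cancel_right₀ (ratFun_ne_zero _ _)]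
    · refine ContinuousAt.continuousWithinAt ?_
      refine (Complex.continuous_exp.comp v.continuous).continuousAt.mul
        ((continuousAt_ratFun fun h => ?_).inv₀ (ratFun_ne_zero _ _))
      exact (hcl hz).elim (hs2 z h).1 (hs2 z h).2
    · refine (continuousAt_ratFun fun h => ?_).continuousWithinAt
      have : IsClosed {z | z ∉ Ω} := hΩ.isClosed_compl
      rw [this.closure_eq] at hz
      exact hz (hs1 z h)
  obtain ⟨H, hH, hH2⟩ := exists_continuous_log hR fun z => by
    split_ifs
    · exact mul_ne_zero (Complex.exp_ne_zero _) (inv_ne_zero (ratFun_ne_zero _ _))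
    · exact ratFun_ne_zero _ _
  obtain ⟨r, hr⟩ := hb.subset_ball 0
  refine sum_eq_zero_of_hasLog_circle (r := r) (fun a ha => by simpa using hr (hs1 a ha)) hH fun z hz => ?_
  rw [hH2, if_neg]
  intro hzΩ
  have := hr hzΩ
  rw [Metric.mem_ball, dist_zero_right, hz] at this
  exact this.false


/-! ### Zeros in the same component of the complement -/

section Component

variable {X : Set ℂ} (hX : IsCompact X)
include hX

/-- The quotient is `1 - (b - a) / (z - a)`, which lies in the unit disk around `1` when `b` is
closer to `a` than `X` is. -/
theorem eventually_hasLogOn_div {a : ℂ} (ha : a ∉ X) :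
    ∀ᶠ b in 𝓝 a, HasLogOn X fun z => linFactor b z * (linFactor a z)⁻¹ := by
  obtain ⟨δ, hδ, hδ2⟩ := Metric.isOpen_iff.1 hX.isClosed.isOpen_compl a ha
  filter_upwards [Metric.ball_mem_nhds a hδ] with b hb
  have hza : ∀ z ∈ X, z ≠ a := by rintro z hz rfl; exact ha hz
  have hzb : ∀ z ∈ X, z ≠ b := by rintro z hz rfl; exact hδ2 hb hz
  have hd : ∀ z ∈ X, δ ≤ ‖z - a‖ := fun z hz => by
    by_contra! h
    exact hδ2 (by rwa [Metric.mem_ball, dist_eq_norm] : z ∈ Metric.ball a δ) hz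
  refine (HasLogOn.of_slitPlane (f := fun z => 1 + -((b - a) / (z - a))) ?_ fun z hz => ?_).congr
    fun z hz => ?_
  · refine continuousOn_const.add (ContinuousOn.neg (continuousOn_const.div (by fun_prop) fun z hz => ?_))
    exact sub_ne_zero.2 (hza z hz)
  · refine Complex.mem_slitPlane_of_norm_lt_one ?_
    rw [norm_neg, norm_div, div_lt_one (hδ.trans_le (hd z hz))]
    rw [Metric.mem_ball, dist_eq_norm] at hb
    exact hb.trans_le (hd z hz)
  · rw [linFactor_of_ne (hza z hz), linFactor_of_ne (hzb z hz)]
    have := sub_ne_zero.2 (hza z hz)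
    field_simp
    ring

theorem hasLogOn_div_of_preconnected {C : Set ℂ} (hC : IsPreconnected C) (hCX : C ⊆ Xᶜ) {a b : ℂ}
    (ha : a ∈ C) (hb : b ∈ C) : HasLogOn X fun z => linFactor b z * (linFactor a z)⁻¹ := by
  refine hC.induction₂ (fun a b => HasLogOn X fun z => linFactor b z * (linFactor a z)⁻¹)
    (fun a ha => nhdsWithin_le_nhds (eventually_hasLogOn_div hX (hCX ha))) ?_ ?_ ha hb
  · intro a b c _ _ _ hab hbc
    refine (hbc.mul hab).congr fun z _ => ?_
    have := linFactor_ne_zero b z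
    field_simp
  · intro a b _ _ hab
    refine hab.inv.congr fun z _ => ?_
    rw [mul_inv, inv_inv, mul_comm]

/-- The zero can be moved within `C` to a point `b` beyond `X`, where `z - b = -b * (1 - z / b)` and
`z / b` has norm below one. -/
theorem hasLogOn_of_unbounded {C : Set ℂ} (hC : IsPreconnected C) (hCX : C ⊆ Xᶜ)
    (hb : ¬ Bornology.IsBounded C) {a : ℂ} (ha : a ∈ C) : HasLogOn X (linFactor a) := by
  obtain ⟨r, hr⟩ := hX.isBounded.subset_ball 0
  obtain ⟨b, hbC, hbr⟩ : ∃ b ∈ C, max r 1 ≤ ‖b‖ := by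
    by_contra! h
    exact hb ((Metric.isBounded_iff_subset_ball 0).2 ⟨max r 1, fun z hz => by simpa using h z hz⟩)
  have hb0 : b ≠ 0 := norm_pos_iff.1 (one_pos.trans_le ((le_max_right r 1).trans hbr))
  have hlog : HasLogOn X (linFactor b) := by
    refine ((HasLogOn.of_slitPlane (X := X) (f := fun z => 1 + -(z / b)) (by fun_prop) fun z hz => ?_).mul
      (HasLogOn.const (neg_ne_zero.2 hb0))).congr fun z hz => ?_
    · refine Complex.mem_slitPlane_of_norm_lt_one ?_
      rw [norm_neg, norm_div, div_lt_one (norm_pos_iff.2 hb0)]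
      have := hr hz
      rw [Metric.mem_ball, dist_zero_right] at this
      exact this.trans_le ((le_max_left r 1).trans hbr)
    · rw [linFactor_of_ne (by rintro rfl; exact hCX hbC hz)]
      field_simp
      ring
  refine ((hasLogOn_div_of_preconnected hX hC hCX hbC ha).mul hlog).congr fun z _ => ?_
  rw [inv_mul_cancel_right₀ (linFactor_ne_zero _ _)]

/-- A rational function that is infinitely divisible by two up to exponentials on a compact set has a
logarithm there. -/
theorem hasLogOn_ratFun_of_divisible {k : ℂ →₀ ℤ} (hk : ∀ a ∈ k.support, a ∉ X)
    (h : ∀ n : ℕ, ∃ l : ℂ →₀ ℤ, (∀ a ∈ l.support, a ∉ X) ∧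
      HasLogOn X fun z => ratFun k z * (ratFun l z ^ (2 ^ n))⁻¹) : HasLogOn X (ratFun k) := by
  classical
  let comp : ℂ → Set ℂ := connectedComponentIn Xᶜ
  -- `ρ` picks one point in each component of the complement. Moving zeros and poles there changes
  -- the rational function by an exponential only.
  let ρ : ℂ → ℂ := fun a => if hne : (comp a).Nonempty then hne.some else a
  have hcomp : ∀ a, a ∉ X → a ∈ comp a := fun a ha => mem_connectedComponentIn ha
  have hρ : ∀ a, a ∉ X → ρ a ∈ comp a := fun a ha => by
    have hne : (comp a).Nonempty := ⟨a, hcomp a ha⟩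
    simp only [ρ, dif_pos hne]
    exact hne.some_mem
  have hρeq : ∀ a b, comp a = comp b → b ∉ X → ρ a = ρ b := fun a b hab hb => by
    have hne : (comp b).Nonempty := ⟨b, hcomp b hb⟩
    simp only [ρ]
    simp only [hab, dif_pos hne]
  have hcompX : ∀ a, comp a ⊆ Xᶜ := fun a => connectedComponentIn_subset _ _
  have h1 : HasLogOn X fun z => ratFun k z * (ratFun (k.mapDomain ρ) z)⁻¹ := by
    refine (HasLogOn.prod k.support (F := fun a z => (linFactor a z * (linFactor (ρ a) z)⁻¹) ^ k a)
      fun a ha => ?_).congr fun z _ => ?_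
    · exact (hasLogOn_div_of_preconnected hX isPreconnected_connectedComponentIn (hcompX a)
        (hρ a (hk a ha)) (hcomp a (hk a ha))).zpow _
    · rw [ratFun_mapDomain, ratFun, Finsupp.prod, Finsupp.prod, ← Finset.prod_inv_distrib,
        ← Finset.prod_mul_distrib]
      exact Finset.prod_congr rfl fun a _ => by rw [mul_zpow, inv_zpow]
  have h2 : HasLogOn X (ratFun (k.mapDomain ρ)) := by
    refine HasLogOn.ratFun_of_forall fun b hb => ?_
    obtain ⟨a, ha, rfl⟩ : ∃ a ∈ k.support, ρ a = b := by
      have := Finsupp.mapDomain_support hb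
      simpa using this
    have haX := hk a ha
    have hΩ : IsOpen (comp a) := hX.isClosed.isOpen_compl.connectedComponentIn
    by_cases hbd : Bornology.IsBounded (comp a)
    swap
    · exact hasLogOn_of_unbounded hX isPreconnected_connectedComponentIn (hcompX a) hbd (hρ a haX)
    have hfr : frontier (comp a) ⊆ X := by
      intro z hz
      by_contra hzX
      have hz1 : z ∈ closure (comp a) := frontier_subset_closure hz
      have hz2 : comp z ∈ 𝓝 z :=
        (hX.isClosed.isOpen_compl.connectedComponentIn : IsOpen (comp z)).mem_nhds (hcomp z hzX)
      obtain ⟨w, hwz, hwa⟩ := mem_closure_iff_nhds.1 hz1 _ hz2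
      have e1 : comp z = comp w := connectedComponentIn_eq hwz
      have e2 : comp a = comp w := connectedComponentIn_eq hwa
      have : z ∈ comp a := by rw [e2, ← e1]; exact hcomp z hzX
      rw [hΩ.frontier_eq] at hz
      exact hz.2 this
    -- The divisor `k - 2 ^ n • l` belongs to a function with a logarithm, so its total over the
    -- bounded component vanishes.
    have hsum : ∀ n : ℕ, (2 ^ n : ℤ) ∣ (k.filter (· ∈ comp a)).sum (fun _ n => n) := by
      intro n
      obtain ⟨l, hl, hlog⟩ := h n
      have hlog' : HasLogOn X (ratFun (k + -(2 ^ n • l))) := hlog.congr fun z _ => by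
        rw [ratFun_add, ratFun_neg, ratFun_nsmul]
      have := sum_filter_eq_zero hX (k := k + -(2 ^ n • l)) (fun b hb => ?_) hlog' hΩ hfr hbd
      · rw [Finsupp.filter_add, Finsupp.filter_neg, Finsupp.filter_smul, Finsupp.sum_add_index'
          (fun _ => rfl) (fun _ _ _ => rfl), Finsupp.sum_neg_index (fun _ => rfl),
          Finsupp.sum_smul_index' (fun _ => rfl)] at this
        refine ⟨(l.filter (· ∈ comp a)).sum fun _ n => n, ?_⟩
        simp only [Finsupp.sum, Finset.sum_neg_distrib, nsmul_eq_mul, ← Finset.mul_sum] at this ⊢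
        push_cast at this
        linarith
      · rcases Finset.mem_union.1 (Finsupp.support_add hb) with h' | h'
        · exact hk b h'
        · rw [Finsupp.support_neg] at h'
          exact hl b (Finsupp.support_smul h')
    have hzero : (k.filter (· ∈ comp a)).sum (fun _ n => n) = 0 := by
      set S := (k.filter (· ∈ comp a)).sum (fun _ n => n)
      refine Int.eq_zero_of_abs_lt_dvd (hsum S.natAbs) ?_
      rw [Int.abs_eq_natAbs]
      exact_mod_cast Nat.lt_two_pow_self
    -- The vanishing total is exactly the coefficient of the collected divisor at `ρ a`, which was
    -- assumed nonzero.
    exfalso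
    refine Finsupp.mem_support_iff.1 hb ?_
    rw [← hzero, Finsupp.mapDomain, Finsupp.sum_apply]
    simp only [Finsupp.sum, Finsupp.support_filter, Finset.sum_filter]
    refine Finset.sum_congr rfl fun c hc => ?_
    have hcX := hk c hc
    have hiff : ρ c = ρ a ↔ c ∈ comp a := by
      constructor
      · intro heq
        have e1 : comp c = comp (ρ c) := connectedComponentIn_eq (hρ c hcX)
        have e2 : comp a = comp (ρ a) := connectedComponentIn_eq (hρ a haX)
        rw [e2, ← heq, ← e1]
        exact hcomp c hcX
      · intro hca
        exact (hρeq a c (connectedComponentIn_eq hca) hcX).symm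
    rw [Finsupp.single_apply]
    by_cases hca : c ∈ comp a
    · rw [if_pos (hiff.2 hca), if_pos hca, Finsupp.filter_apply_pos _ _ hca]
    · rw [if_neg fun h => hca (hiff.1 h), if_neg hca]
  refine (h1.mul h2).congr fun z _ => ?_
  rw [inv_mul_cancel_right₀ (ratFun_ne_zero _ _)]

end Component


/-! ### Nonvanishing functions on compact subsets of the plane -/

/-- A locally constant integer function on a compact subset of an interval is a step function. -/
theorem exists_step_function {Y : Set ℝ} {φ : ℝ → ℤ} {δ : ℝ} (hδ : 0 < δ)
    (hφ : ∀ y ∈ Y, ∀ y' ∈ Y, |y - y'| ≤ δ → φ y = φ y') (n : ℕ) (a b : ℝ) (hab : a ≤ b) (hn : b - a ≤ n * δ) :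
    ∃ (k : ℝ →₀ ℤ) (c : ℤ), (∀ x ∈ k.support, x ∈ Icc a b ∧ x ∉ Y) ∧
      ∀ y ∈ Y ∩ Icc a b, φ y = c + k.sum fun x m => if y < x then m else 0 := by
  classical
  induction n generalizing a b with
  | zero =>
    by_cases hne : ∃ y ∈ Y, y ∈ Icc a b
    · obtain ⟨y₀, hy₀, hy₀'⟩ := hne
      refine ⟨0, φ y₀, by simp, fun y hy => ?_⟩
      rw [Finsupp.sum_zero_index, add_zero]
      refine hφ y hy.1 y₀ hy₀ ?_
      simp only [Nat.cast_zero, zero_mul] at hn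
      rw [abs_le]
      constructor <;> linarith [hy.2.1, hy.2.2, hy₀'.1, hy₀'.2]
    · exact ⟨0, 0, by simp, fun y hy => (hne ⟨y, hy.1, hy.2⟩).elim⟩
  | succ n ih =>
    -- The last piece `[m, b]` has length at most `δ`, so `φ` is constant on its part of `Y`.
    set m := max a (b - δ) with hm
    have ham : a ≤ m := le_max_left _ _
    have hmb : m ≤ b := max_le hab (by linarith)
    obtain ⟨k₁, c₁, hk₁, h₁⟩ := ih a m ham (by
      push_cast at hn
      rcases le_total a (b - δ) with h | h
      · rw [hm, max_eq_right h]; linarith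
      · rw [hm, max_eq_left h, sub_self]; positivity)
    have hc : ∃ c : ℤ, ∀ y ∈ Y ∩ Icc m b, φ y = c := by
      by_cases hne : ∃ y ∈ Y, y ∈ Icc m b
      · obtain ⟨y₀, hy₀, hy₀'⟩ := hne
        refine ⟨φ y₀, fun y hy => hφ y hy.1 y₀ hy₀ ?_⟩
        have := le_max_right a (b - δ)
        rw [abs_le]
        constructor <;> linarith [hy.2.1, hy.2.2, hy₀'.1, hy₀'.2]
      · exact ⟨0, fun y hy => (hne ⟨y, hy.1, hy.2⟩).elim⟩
    obtain ⟨c₂, h₂⟩ := hc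
    have hsum0 : ∀ y, m ≤ y → (k₁.sum fun x m => if y < x then m else 0) = 0 := fun y hy =>
      Finset.sum_eq_zero fun x hx => if_neg (not_lt.2 ((hk₁ x hx).1.2.trans hy))
    -- If the cut point lies in `Y`, the two constants agree there and no jump is needed; otherwise
    -- the cut point itself may carry the jump.
    by_cases hmY : m ∈ Y
    · have hcc : c₁ = c₂ := by
        rw [← h₂ m ⟨hmY, le_rfl, hmb⟩, h₁ m ⟨hmY, ham, le_rfl⟩, hsum0 m le_rfl, add_zero]
      refine ⟨k₁, c₁, fun x hx => ⟨⟨(hk₁ x hx).1.1, (hk₁ x hx).1.2.trans hmb⟩, (hk₁ x hx).2⟩, fun y hy => ?_⟩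
      rcases le_total y m with h | h
      · exact h₁ y ⟨hy.1, hy.2.1, h⟩
      · rw [hsum0 y h, h₂ y ⟨hy.1, h, hy.2.2⟩, hcc, add_zero]
    · refine ⟨k₁ + Finsupp.single m (c₁ - c₂), c₂, fun x hx => ?_, fun y hy => ?_⟩
      · rcases Finset.mem_union.1 (Finsupp.support_add hx) with h | h
        · exact ⟨⟨(hk₁ x h).1.1, (hk₁ x h).1.2.trans hmb⟩, (hk₁ x h).2⟩
        · obtain rfl : x = m := Finset.mem_singleton.1 (Finsupp.support_single_subset h)
          exact ⟨⟨ham, hmb⟩, hmY⟩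
      · rw [Finsupp.sum_add_index' (by simp) (fun _ _ _ => by split_ifs <;> simp),
          Finsupp.sum_single_index (by simp)]
        rcases le_total y m with h | h
        · have hlt : y < m := lt_of_le_of_ne h (by rintro rfl; exact hmY hy.1)
          rw [h₁ y ⟨hy.1, hy.2.1, h⟩, if_pos hlt]; ring
        · rw [hsum0 y h, if_neg (not_lt.2 h), h₂ y ⟨hy.1, h, hy.2.2⟩]; ring

theorem neg_mul_mem_slitPlane_aux {w : ℂ} (h : 0 ≤ w.re) (h0 : w ≠ 0) : w ∈ Complex.slitPlane := by
  rcases h.eq_or_lt with h | h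
  · exact .inr fun him => h0 (Complex.ext h.symm him)
  · exact .inl h

/-- The two logarithms of `z - a` on opposite half-planes with `a` on the common boundary differ by a
step function. -/
theorem log_sub_log_neg {w : ℂ} (hre : w.re = 0) (h0 : w ≠ 0) :
    Complex.log w - (Complex.log (-w) + Real.pi * Complex.I) =
      if w.im < 0 then -(2 * Real.pi * Complex.I) else 0 := by
  have him : w.im ≠ 0 := fun h => h0 (Complex.ext hre h)
  have harg : ∀ w : ℂ, w.re = 0 → 0 < w.im → w.arg = Real.pi / 2 ∧ (-w).arg = -(Real.pi / 2) := by
    intro w hre him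
    exact ⟨Complex.arg_eq_pi_div_two_iff.2 ⟨hre, him⟩,
      Complex.arg_eq_neg_pi_div_two_iff.2 ⟨by simp [hre], by simpa using him⟩⟩
  split_ifs with h
  · have := harg (-w) (by simp [hre]) (by simpa using h)
    rw [neg_neg] at this
    rw [Complex.log, Complex.log, this.1, this.2, norm_neg]
    push_cast; ring
  · have := harg w hre (lt_of_le_of_ne (not_lt.1 h) him.symm)
    rw [Complex.log, Complex.log, this.1, this.2, norm_neg]
    push_cast; ring

/-- On `X ∩ S` the function `v` is a rational function with divisor in `S \ X` times an exponential. -/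
def FactorsOn (X : Set ℂ) (v : ℂ → ℂ) (S : Set ℂ) : Prop :=
  ∃ k : ℂ →₀ ℤ, (∀ a ∈ k.support, a ∈ S ∧ a ∉ X) ∧ HasLogOn (X ∩ S) fun z => v z * (ratFun k z)⁻¹

/-- After division by the rational functions of both sides there is a logarithm on each side of the
line `Re (c * z) = t`. On the line they differ by `2πi` times a locally constant integer, a step
function. Putting zeros or poles at its jumps cancels the mismatch, since the principal logarithms
of `z - a` from the two half-planes differ by a single step. The hypothesis `hS` makes `S` an
interval along the line, so that the jumps lie in `S`. -/
theorem FactorsOn.glue {X S : Set ℂ} (hX : IsCompact X) (hSc : IsClosed S) {v : ℂ → ℂ} {c : ℂ}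
    (hc : c ≠ 0) (t : ℝ)
    (hS : ∀ x₁ x₂ x : ℝ, x₁ ≤ x → x ≤ x₂ → (t + x₁ * Complex.I) / c ∈ S →
      (t + x₂ * Complex.I) / c ∈ S → (t + x * Complex.I) / c ∈ S)
    (hA : FactorsOn X v (S ∩ {z | (c * z).re ≤ t})) (hB : FactorsOn X v (S ∩ {z | t ≤ (c * z).re})) :
    FactorsOn X v S := by
  classical
  obtain ⟨kA, hkA, hA⟩ := hA
  obtain ⟨kB, hkB, hB⟩ := hB
  set A := X ∩ (S ∩ {z | (c * z).re ≤ t}) with hAdef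
  set B := X ∩ (S ∩ {z | t ≤ (c * z).re}) with hBdef
  set w : ℝ → ℂ := fun x => (t + x * Complex.I) / c with hw
  have hcw : ∀ x, c * w x = t + x * Complex.I := fun x => mul_div_cancel₀ _ hc
  have hwz : ∀ z, (c * z).re = t → w (c * z).im = z := fun z hz => by
    rw [hw]
    simp only
    rw [div_eq_iff hc, ← hz, Complex.re_add_im, mul_comm]
  have hwinj : Function.Injective w := fun x y hxy => by
    have : (c * w x).im = (c * w y).im := by rw [hxy]
    simpa [hcw] using this
  have hwc : Continuous w := by fun_prop
  -- logarithms of the factors of each side on the other side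
  have hlogB : HasLogOn A (ratFun kB) := HasLogOn.ratFun_of_forall fun b hb => by
    refine ((HasLogOn.of_slitPlane (f := fun z => -c * (z - b)) (by fun_prop) fun z hz => ?_).mul
      (HasLogOn.const (inv_ne_zero (neg_ne_zero.2 hc)))).congr fun z hz => ?_
    · have hne : z ≠ b := by rintro rfl; exact (hkB _ hb).2 hz.1
      refine neg_mul_mem_slitPlane_aux ?_ (mul_ne_zero (neg_ne_zero.2 hc) (sub_ne_zero.2 hne))
      have h1 : (c * z).re ≤ t := hz.2.2
      have h2 : t ≤ (c * b).re := (hkB b hb).1.2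
      rw [neg_mul, mul_sub, Complex.neg_re, Complex.sub_re]; linarith
    · rw [linFactor_of_ne (by rintro rfl; exact (hkB _ hb).2 hz.1)]
      field_simp
  have hlogA : HasLogOn B (ratFun kA) := HasLogOn.ratFun_of_forall fun b hb => by
    refine ((HasLogOn.of_slitPlane (f := fun z => c * (z - b)) (by fun_prop) fun z hz => ?_).mul
      (HasLogOn.const (inv_ne_zero hc))).congr fun z hz => ?_
    · have hne : z ≠ b := by rintro rfl; exact (hkA _ hb).2 hz.1
      refine neg_mul_mem_slitPlane_aux ?_ (mul_ne_zero hc (sub_ne_zero.2 hne))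
      have h1 : t ≤ (c * z).re := hz.2.2
      have h2 : (c * b).re ≤ t := (hkA b hb).1.2
      rw [mul_sub, Complex.sub_re]; linarith
    · rw [linFactor_of_ne (by rintro rfl; exact (hkA _ hb).2 hz.1)]
      field_simp
  obtain ⟨pA, hpA, hpA2⟩ := (hA.mul hlogB.inv).congr (g := fun z => v z * (ratFun (kA + kB) z)⁻¹)
    fun z _ => by rw [ratFun_add, mul_inv, mul_assoc]
  obtain ⟨pB, hpB, hpB2⟩ := (hB.mul hlogA.inv).congr (g := fun z => v z * (ratFun (kA + kB) z)⁻¹)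
    fun z _ => by rw [ratFun_add, mul_inv]; ring
  -- the jump along the common line
  set Y : Set ℝ := {y | w y ∈ X ∩ S} with hY
  have hwA : ∀ y ∈ Y, w y ∈ A := fun y hy => ⟨hy.1, hy.2, by
    rw [mem_ofPred_eq, hcw]; simp⟩
  have hwB : ∀ y ∈ Y, w y ∈ B := fun y hy => ⟨hy.1, hy.2, by
    rw [mem_ofPred_eq, hcw]; simp⟩
  have hjump : ∀ y, ∃ n : ℤ, y ∈ Y → pA (w y) = pB (w y) + n * (2 * Real.pi * Complex.I) := fun y => by
    by_cases hy : y ∈ Y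
    · obtain ⟨n, hn⟩ := Complex.exp_eq_exp_iff_exists_int.1
        ((hpA2 _ (hwA y hy)).trans (hpB2 _ (hwB y hy)).symm)
      exact ⟨n, fun _ => hn⟩
    · exact ⟨0, fun h => absurd h hy⟩
  choose φ hφ using hjump
  have hYc : IsCompact Y := by
    have : Y = (fun z => (c * z).im) '' (X ∩ (S ∩ {z | (c * z).re = t})) := by
      ext y
      constructor
      · intro hy
        refine ⟨w y, ⟨hy.1, hy.2, ?_⟩, ?_⟩
        · rw [mem_ofPred_eq, hcw]; simp
        · simp only [hcw]; simp
      · rintro ⟨z, hz, rfl⟩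
        change w (c * z).im ∈ X ∩ S
        rw [hwz z hz.2.2]
        exact ⟨hz.1, hz.2.1⟩
    rw [this]
    refine (hX.inter_right (hSc.inter (isClosed_eq ?_ continuous_const))).image ?_
    · exact Complex.continuous_re.comp (by fun_prop)
    · exact Complex.continuous_im.comp (by fun_prop)
  have hstep : ∃ (k : ℝ →₀ ℤ) (c₀ : ℤ), (∀ x ∈ k.support, w x ∈ S ∧ x ∉ Y) ∧
      ∀ y ∈ Y, φ y = c₀ + k.sum fun x m => if y < x then m else 0 := by
    rcases Y.eq_empty_or_nonempty with hYe | hYne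
    · exact ⟨0, 0, by simp, fun y hy => by rw [hYe] at hy; exact hy.elim⟩
    obtain ⟨a, ha⟩ := hYc.exists_isLeast hYne
    obtain ⟨b, hb⟩ := hYc.exists_isGreatest hYne
    have hD : ContinuousOn (fun y => pA (w y) - pB (w y)) Y :=
      (hpA.comp hwc.continuousOn hwA).sub (hpB.comp hwc.continuousOn hwB)
    -- Tolerance `1` suffices: distinct values of the difference are at least `2π` apart.
    obtain ⟨δ, hδ, hδ2⟩ := Metric.uniformContinuousOn_iff.1
      (hYc.uniformContinuousOn_of_continuous hD) 1 one_pos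
    obtain ⟨n, hn⟩ := exists_nat_ge ((b - a) / (δ / 2))
    obtain ⟨k, c₀, hk, hk2⟩ := exists_step_function (Y := Y) (φ := φ) (half_pos hδ) (fun y hy y' hy' hyy => by
        have h1 := hδ2 y hy y' hy' (by rw [Real.dist_eq]; linarith)
        rw [hφ y hy, hφ y' hy', dist_eq_norm] at h1
        have h2 : pB (w y) + φ y * (2 * Real.pi * Complex.I) - pB (w y) -
            (pB (w y') + φ y' * (2 * Real.pi * Complex.I) - pB (w y')) =
            ((φ y - φ y' : ℤ) : ℂ) * (2 * Real.pi * Complex.I) := by push_cast; ring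
        rw [h2, norm_mul, Complex.norm_intCast] at h1
        have h3 : ‖(2 * Real.pi * Complex.I : ℂ)‖ = 2 * Real.pi := by
          simp [abs_of_pos Real.pi_pos]
        rw [h3] at h1
        by_contra hne
        have h4 : (1 : ℝ) ≤ |((φ y - φ y' : ℤ) : ℝ)| := by
          exact_mod_cast Int.one_le_abs (sub_ne_zero.2 hne)
        nlinarith [Real.pi_gt_three]) n a b (hb.2 ha.1) (by
        rwa [div_le_iff₀ (half_pos hδ)] at hn)
    exact ⟨k, c₀, fun x hx => ⟨hS a b x (hk x hx).1.1 (hk x hx).1.2 ha.1.2 hb.1.2, (hk x hx).2⟩,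
      fun y hy => hk2 y ⟨hy, ha.2 hy, hb.2 hy⟩⟩
  obtain ⟨k, c₀, hk, hk2⟩ := hstep
  have hkX : ∀ x ∈ k.support, w x ∉ X := fun x hx h => (hk x hx).2 ⟨h, (hk x hx).1⟩
  -- `Lp` and `Lm` are logarithms of the correcting rational function on the right and left sides;
  -- the term `πi` in `Lm` undoes the sign change.
  let Lp : ℂ → ℂ := fun z => k.sum fun x m => m * (Complex.log (c * (z - w x)) - Complex.log c)
  let Lm : ℂ → ℂ := fun z => k.sum fun x m =>
    m * (Complex.log (-(c * (z - w x))) + Real.pi * Complex.I - Complex.log c)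
  have hne : ∀ x ∈ k.support, ∀ z ∈ X, c * (z - w x) ≠ 0 := fun x hx z hz =>
    mul_ne_zero hc (sub_ne_zero.2 (by rintro rfl; exact hkX x hx hz))
  have hre : ∀ x z, (c * (z - w x)).re = (c * z).re - t := fun x z => by
    rw [mul_sub, hcw]; simp
  have hLp : ContinuousOn Lp B := continuousOn_finsetSum _ fun x hx =>
    continuousOn_const.mul ((ContinuousOn.clog (by fun_prop) fun z hz =>
      neg_mul_mem_slitPlane_aux (by rw [hre]; exact sub_nonneg.2 hz.2.2) (hne x hx z hz.1)).sub continuousOn_const)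
  have hLm : ContinuousOn Lm A := continuousOn_finsetSum _ fun x hx =>
    continuousOn_const.mul (((ContinuousOn.clog (by fun_prop) fun z hz =>
      neg_mul_mem_slitPlane_aux (by rw [Complex.neg_re, hre, neg_sub]; exact sub_nonneg.2 hz.2.2)
        (neg_ne_zero.2 (hne x hx z hz.1))).add continuousOn_const).sub continuousOn_const)
  have hLpe : ∀ z ∈ X, Complex.exp (Lp z) = ratFun (k.mapDomain w) z := fun z hz => by
    rw [ratFun, Finsupp.prod_mapDomain_index_inj hwinj]
    simp only [Lp, Finsupp.sum, Complex.exp_sum, Finsupp.prod]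
    refine Finset.prod_congr rfl fun x hx => ?_
    rw [Complex.exp_int_mul, Complex.exp_sub, Complex.exp_log (hne x hx z hz), Complex.exp_log hc,
      mul_div_cancel_left₀ _ hc, linFactor_of_ne (by rintro rfl; exact hkX x hx hz)]
  have hLme : ∀ z ∈ X, Complex.exp (Lm z) = ratFun (k.mapDomain w) z := fun z hz => by
    rw [ratFun, Finsupp.prod_mapDomain_index_inj hwinj]
    simp only [Lm, Finsupp.sum, Complex.exp_sum, Finsupp.prod]
    refine Finset.prod_congr rfl fun x hx => ?_
    rw [Complex.exp_int_mul, Complex.exp_sub, Complex.exp_add,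
      Complex.exp_log (neg_ne_zero.2 (hne x hx z hz)), Complex.exp_log hc, Complex.exp_pi_mul_I,
      mul_neg_one, neg_neg,
      mul_div_cancel_left₀ _ hc, linFactor_of_ne (by rintro rfl; exact hkX x hx hz)]
  have hdiff : ∀ z ∈ X ∩ S, (c * z).re = t →
      pA z - Lm z = pB z - Lp z + c₀ * (2 * Real.pi * Complex.I) := by
    intro z hz hzt
    have hy : (c * z).im ∈ Y := by
      change w (c * z).im ∈ X ∩ S
      rwa [hwz z hzt]
    have h1 := hφ _ hy
    rw [hwz z hzt, hk2 _ hy] at h1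
    have h2 : Lp z - Lm z = -((k.sum fun x m => if (c * z).im < x then m else 0 : ℤ) : ℂ) *
        (2 * Real.pi * Complex.I) := by
      simp only [Lp, Lm, Finsupp.sum, ← Finset.sum_sub_distrib]
      push_cast
      rw [← Finset.sum_neg_distrib, Finset.sum_mul]
      refine Finset.sum_congr rfl fun x hx => ?_
      have h3 := log_sub_log_neg (w := c * (z - w x)) (by rw [hre, hzt, sub_self]) (hne x hx z hz.1)
      have him : (c * (z - w x)).im = (c * z).im - x := by rw [mul_sub, hcw]; simp
      rw [him] at h3
      simp only [sub_neg] at h3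
      rw [← mul_sub, sub_sub_sub_cancel_right, h3]
      split_ifs <;> simp
    push_cast at h1 h2
    linear_combination h1 + h2
  refine ⟨kA + kB + k.mapDomain w, fun a ha => ?_, ?_⟩
  · rcases Finset.mem_union.1 (Finsupp.support_add ha) with h | h
    · rcases Finset.mem_union.1 (Finsupp.support_add h) with h | h
      · exact ⟨(hkA a h).1.1, (hkA a h).2⟩
      · exact ⟨(hkB a h).1.1, (hkB a h).2⟩
    · obtain ⟨x, hx, rfl⟩ : ∃ x ∈ k.support, w x = a := by
        simpa using Finsupp.mapDomain_support h
      exact ⟨(hk x hx).1, hkX x hx⟩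
  · have hun : X ∩ S = A ∪ B := by
      ext z
      simp only [hAdef, hBdef, mem_union, mem_inter_iff, mem_ofPred_eq]
      have := le_total (c * z).re t
      tauto
    have hclA : IsClosed A := hX.isClosed.inter (hSc.inter (isClosed_le
      (Complex.continuous_re.comp (by fun_prop)) continuous_const))
    have hclB : IsClosed B := hX.isClosed.inter (hSc.inter (isClosed_le continuous_const
      (Complex.continuous_re.comp (by fun_prop))))
    refine ⟨fun z => if (c * z).re ≤ t then pA z - Lm z else
      pB z - Lp z + c₀ * (2 * Real.pi * Complex.I), ?_, fun z hz => ?_⟩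
    · rw [hun]
      refine ContinuousOn.union_of_isClosed ?_ ?_ hclA hclB
      · exact (hpA.sub hLm).congr fun z hz => if_pos hz.2.2
      · refine ((hpB.sub hLp).add
          (continuousOn_const (c := (c₀ : ℂ) * (2 * Real.pi * Complex.I)))).congr fun z hz => ?_
        split_ifs with h
        · exact hdiff z ⟨hz.1, hz.2.1⟩ (le_antisymm h hz.2.2)
        · rfl
    · simp only
      rw [ratFun_add, mul_inv]
      split_ifs with h
      · rw [Complex.exp_sub, hLme z hz.1, hpA2 z ⟨hz.1, hz.2, h⟩, div_eq_mul_inv, mul_assoc]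
      · rw [Complex.exp_add, Complex.exp_sub, hLpe z hz.1, hpB2 z ⟨hz.1, hz.2, (not_le.1 h).le⟩,
          Complex.exp_int_mul_two_pi_mul_I, mul_one, div_eq_mul_inv, mul_assoc]

/-- A closed rectangle. -/
def rect (a b c d : ℝ) : Set ℂ := {z | z.re ∈ Icc a b ∧ z.im ∈ Icc c d}

theorem isClosed_rect (a b c d : ℝ) : IsClosed (rect a b c d) :=
  (isClosed_Icc.preimage Complex.continuous_re).inter (isClosed_Icc.preimage Complex.continuous_im)

theorem FactorsOn.rect_glue_re {X : Set ℂ} (hX : IsCompact X) {v : ℂ → ℂ} {a b c d m : ℝ}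
    (ham : a ≤ m) (hmb : m ≤ b)
    (h₁ : FactorsOn X v (rect a m c d)) (h₂ : FactorsOn X v (rect m b c d)) :
    FactorsOn X v (rect a b c d) := by
  have e₁ : rect a b c d ∩ {z | ((1 : ℂ) * z).re ≤ m} = rect a m c d := by
    ext z
    simp only [rect, mem_inter_iff, mem_ofPred_eq, one_mul, mem_Icc]
    exact ⟨fun h => ⟨⟨h.1.1.1, h.2⟩, h.1.2⟩, fun h => ⟨⟨⟨h.1.1, h.1.2.trans hmb⟩, h.2⟩, h.1.2⟩⟩
  have e₂ : rect a b c d ∩ {z | m ≤ ((1 : ℂ) * z).re} = rect m b c d := by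
    ext z
    simp only [rect, mem_inter_iff, mem_ofPred_eq, one_mul, mem_Icc]
    exact ⟨fun h => ⟨⟨h.2, h.1.1.2⟩, h.1.2⟩, fun h => ⟨⟨⟨ham.trans h.1.1, h.1.2⟩, h.2⟩, h.1.1⟩⟩
  refine FactorsOn.glue hX (isClosed_rect a b c d) one_ne_zero m (fun x₁ x₂ x h1 h2 h3 h4 => ?_)
    (e₁.symm ▸ h₁) (e₂.symm ▸ h₂)
  simp only [rect, div_one, mem_ofPred_eq, Complex.add_re, Complex.ofReal_re, Complex.mul_re,
    Complex.I_re, Complex.I_im, Complex.ofReal_im, Complex.add_im, Complex.mul_im, mem_Icc] at h3 h4 ⊢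
  refine ⟨⟨?_, ?_⟩, ?_, ?_⟩ <;> linarith [h3.1.1, h3.1.2, h4.1.1, h4.1.2, h3.2.1, h4.2.2]

theorem FactorsOn.rect_glue_im {X : Set ℂ} (hX : IsCompact X) {v : ℂ → ℂ} {a b c d m : ℝ}
    (hcm : c ≤ m) (hmd : m ≤ d)
    (h₁ : FactorsOn X v (rect a b c m)) (h₂ : FactorsOn X v (rect a b m d)) :
    FactorsOn X v (rect a b c d) := by
  have e₁ : rect a b c d ∩ {z | ((-Complex.I) * z).re ≤ m} = rect a b c m := by
    ext z
    simp only [rect, mem_inter_iff, mem_ofPred_eq, neg_mul, Complex.neg_re, Complex.I_mul_re, neg_neg, mem_Icc]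
    exact ⟨fun h => ⟨h.1.1, h.1.2.1, h.2⟩, fun h => ⟨⟨h.1, h.2.1, h.2.2.trans hmd⟩, h.2.2⟩⟩
  have e₂ : rect a b c d ∩ {z | m ≤ ((-Complex.I) * z).re} = rect a b m d := by
    ext z
    simp only [rect, mem_inter_iff, mem_ofPred_eq, neg_mul, Complex.neg_re, Complex.I_mul_re, neg_neg, mem_Icc]
    exact ⟨fun h => ⟨h.1.1, h.2, h.1.2.2⟩, fun h => ⟨⟨h.1, hcm.trans h.2.1, h.2.2⟩, h.2.1⟩⟩
  -- The multiplier `-I` turns the imaginary part into the real part of `-I * z`.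
  refine FactorsOn.glue hX (isClosed_rect a b c d) (neg_ne_zero.2 Complex.I_ne_zero) m
    (fun x₁ x₂ x h1 h2 h3 h4 => ?_) (e₁.symm ▸ h₁) (e₂.symm ▸ h₂)
  have e : ∀ x : ℝ, ((m : ℂ) + x * Complex.I) / -Complex.I = -x + m * Complex.I := fun x => by
    rw [div_eq_iff (neg_ne_zero.2 Complex.I_ne_zero)]
    linear_combination (m : ℂ) * Complex.I_sq
  rw [e] at h3 h4 ⊢
  simp only [rect, mem_ofPred_eq, Complex.add_re, Complex.neg_re, Complex.ofReal_re, Complex.mul_re,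
    Complex.I_re, Complex.I_im, Complex.ofReal_im, Complex.add_im, Complex.neg_im, Complex.mul_im, mem_Icc] at h3 h4 ⊢
  refine ⟨⟨?_, ?_⟩, ?_, ?_⟩ <;> linarith [h3.1.1, h3.1.2, h4.1.1, h4.1.2, h3.2.1, h3.2.2]

/-- A nonvanishing continuous function on a compact subset of the plane is a rational function times an
exponential. -/
theorem exists_ratFun_factor {X : Set ℂ} (hX : IsCompact X) {v : ℂ → ℂ} (hv : ContinuousOn v X)
    (h0 : ∀ z ∈ X, v z ≠ 0) :
    ∃ k : ℂ →₀ ℤ, (∀ a ∈ k.support, a ∉ X) ∧ HasLogOn X fun z => v z * (ratFun k z)⁻¹ := by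
  rcases X.eq_empty_or_nonempty with rfl | hne
  · exact ⟨0, by simp, fun _ => 0, continuousOn_empty _, by simp⟩
  obtain ⟨ε, hε, hεv⟩ : ∃ ε > 0, ∀ z ∈ X, ε ≤ ‖v z‖ := by
    obtain ⟨z₀, hz₀, hmin⟩ := hX.exists_isMinOn hne hv.norm
    exact ⟨‖v z₀‖, norm_pos_iff.2 (h0 z₀ hz₀), fun z hz => hmin hz⟩
  obtain ⟨δ', hδ', huc⟩ := Metric.uniformContinuousOn_iff.1 (hX.uniformContinuousOn_of_continuous hv) ε hε
  -- Two points of a cell of side `δ` are at distance at most `2 * δ < δ'`, so `v` varies there by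
  -- less than its minimal modulus and has a logarithm.
  set δ := δ' / 3 with hδdef
  have hδ : 0 < δ := by positivity
  have hsmall : ∀ a b c d : ℝ, b - a ≤ δ → d - c ≤ δ → FactorsOn X v (rect a b c d) := by
    intro a b c d hab hcd
    refine ⟨0, by simp, ?_⟩
    by_cases hne : ∃ z₀, z₀ ∈ X ∩ rect a b c d
    · obtain ⟨z₀, hz₀, hz₀'⟩ := hne
      have hv0 := h0 z₀ hz₀
      refine ((HasLogOn.of_slitPlane (f := fun z => 1 + (v z - v z₀) / v z₀) ?_ fun z hz => ?_).mul
        (HasLogOn.const hv0)).congr fun z hz => ?_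
      · exact continuousOn_const.add (((hv.mono inter_subset_left).sub continuousOn_const).div_const _)
      · refine Complex.mem_slitPlane_of_norm_lt_one ?_
        rw [norm_div, div_lt_one (norm_pos_iff.2 hv0), ← dist_eq_norm]
        refine lt_of_lt_of_le (huc z hz.1 z₀ hz₀ ?_) (hεv z₀ hz₀)
        rw [dist_eq_norm]
        refine (Complex.norm_le_abs_re_add_abs_im _).trans_lt ?_
        have h1 : |(z - z₀).re| ≤ δ := by
          rw [Complex.sub_re, abs_le]
          constructor <;> linarith [hz.2.1.1, hz.2.1.2, hz₀'.1.1, hz₀'.1.2]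
        have h2 : |(z - z₀).im| ≤ δ := by
          rw [Complex.sub_im, abs_le]
          constructor <;> linarith [hz.2.2.1, hz.2.2.2, hz₀'.2.1, hz₀'.2.2]
        linarith
      · rw [ratFun_zero]
        field_simp
        ring
    · exact HasLogOn.one.congr fun z hz => (hne ⟨z, hz⟩).elim
  have hrow : ∀ (n : ℕ) (a b c d : ℝ), a ≤ b → b - a ≤ n * δ → d - c ≤ δ → FactorsOn X v (rect a b c d) := by
    intro n
    induction n with
    | zero => intro a b c d _ h1 h2; exact hsmall a b c d (by simp at h1; linarith) h2
    | succ n ih =>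
      intro a b c d hab h1 h2
      push_cast at h1
      have hle : max a (b - δ) - a ≤ n * δ := by
        rcases le_total a (b - δ) with h | h
        · rw [max_eq_right h]; linarith
        · rw [max_eq_left h, sub_self]; positivity
      exact FactorsOn.rect_glue_re hX (le_max_left a (b - δ)) (max_le hab (by linarith))
        (ih _ _ _ _ (le_max_left _ _) hle h2) (hsmall _ _ _ _ (by linarith [le_max_right a (b - δ)]) h2)
  have hall : ∀ (m : ℕ) (n : ℕ) (a b c d : ℝ), a ≤ b → c ≤ d → b - a ≤ n * δ → d - c ≤ m * δ →
      FactorsOn X v (rect a b c d) := by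
    intro m
    induction m with
    | zero => intro n a b c d hab _ h1 h2; exact hrow n a b c d hab h1 (by simp at h2; linarith)
    | succ m ih =>
      intro n a b c d hab hcd h1 h2
      push_cast at h2
      have hle : max c (d - δ) - c ≤ m * δ := by
        rcases le_total c (d - δ) with h | h
        · rw [max_eq_right h]; linarith
        · rw [max_eq_left h, sub_self]; positivity
      exact FactorsOn.rect_glue_im hX (le_max_left c (d - δ)) (max_le hcd (by linarith))
        (ih n _ _ _ _ hab (le_max_left _ _) h1 hle)
        (hrow n _ _ _ _ hab h1 (by linarith [le_max_right c (d - δ)]))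
  obtain ⟨r, hr⟩ := hX.isBounded.subset_closedBall 0
  have hr' : ∀ z ∈ X, ‖z‖ ≤ |r| := fun z hz => by simpa using (hr hz).trans' (by simp) |>.trans (le_abs_self r)
  obtain ⟨n, hn⟩ := exists_nat_ge ((|r| - -|r|) / δ)
  rw [div_le_iff₀ hδ] at hn
  have habs : -|r| ≤ |r| := by linarith [abs_nonneg r]
  obtain ⟨k, hk, hlog⟩ := hall n n (-|r|) |r| (-|r|) |r| habs habs hn hn
  refine ⟨k, fun a ha => (hk a ha).2, hlog.mono fun z hz => ⟨hz, ?_, ?_⟩⟩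
  · exact abs_le.1 ((Complex.abs_re_le_norm z).trans (hr' z hz))
  · exact abs_le.1 ((Complex.abs_im_le_norm z).trans (hr' z hz))

/-- A nonvanishing function on a planar compact space that has roots of all orders `2 ^ n` is an
exponential. -/
theorem exists_log_of_forall_root {Z : Type*} [TopologicalSpace Z] [CompactSpace Z] {G : Z → ℂ}
    (hG : Continuous G) (hinj : Function.Injective G) {v : Z → ℂ} (hv : Continuous v) (h0 : ∀ z, v z ≠ 0)
    (hroot : ∀ n : ℕ, ∃ u : Z → ℂ, Continuous u ∧ ∀ z, u z ^ 2 ^ n = v z) :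
    ∃ h : Z → ℂ, Continuous h ∧ ∀ z, Complex.exp (h z) = v z := by
  have hemb : Topology.IsClosedEmbedding G := hG.isClosedEmbedding hinj
  have hX : IsCompact (range G) := isCompact_range hG
  have ext : ∀ u : Z → ℂ, Continuous u → ∃ U : ℂ → ℂ, Continuous U ∧ ∀ z, U (G z) = u z := fun u hu =>
    let ⟨U, hU⟩ := ContinuousMap.exists_extension' hemb ⟨u, hu⟩
    ⟨U, U.continuous, fun z => congrFun hU z⟩
  obtain ⟨V, hV, hVv⟩ := ext v hv
  obtain ⟨k, hk, hlog⟩ := exists_ratFun_factor hX hV.continuousOn (by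
    rintro _ ⟨z, rfl⟩; rw [hVv]; exact h0 z)
  have hlogk : HasLogOn (range G) (ratFun k) := by
    refine hasLogOn_ratFun_of_divisible hX hk fun n => ?_
    obtain ⟨u, hu, huv⟩ := hroot n
    obtain ⟨U, hU, hUu⟩ := ext u hu
    have hu0 : ∀ z, u z ≠ 0 := fun z h => h0 z (by
      rw [← huv, h, zero_pow (pow_ne_zero n two_ne_zero)])
    obtain ⟨l, hl, hlogl⟩ := exists_ratFun_factor hX hU.continuousOn (by
      rintro _ ⟨z, rfl⟩; rw [hUu]; exact hu0 z)
    -- Both `V / ratFun k` and `U / ratFun l` are exponentials and `U ^ 2 ^ n = V`, so `ratFun k /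
    -- ratFun l ^ 2 ^ n` is one too.
    refine ⟨l, hl, (hlog.inv.mul (hlogl.zpow (2 ^ n : ℕ))).congr ?_⟩
    rintro _ ⟨z, rfl⟩
    rw [hVv, hUu, zpow_natCast, mul_pow, huv, mul_inv, inv_inv, inv_pow]
    field_simp [h0 z]
  obtain ⟨h, hh, hh2⟩ := hlog.mul hlogk
  refine ⟨h ∘ G, hh.comp_continuous hG fun z => mem_range_self z, fun z => ?_⟩
  rw [Function.comp, hh2 _ (mem_range_self z)]
  simp only
  rw [inv_mul_cancel_right₀ (ratFun_ne_zero _ _), hVv]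

/-- The dyadic solenoid does not embed into the plane. -/
theorem solenoid_not_planar {G : solenoid → ℂ} (hG : Continuous G) (hinj : Function.Injective G) : False := by
  have : Fact ((0 : ℝ) < 2) := ⟨two_pos⟩
  let u : ℕ → solenoid → ℂ := fun n θ => (AddCircle.toCircle (θ.1 n) : ℂ)
  have hu : ∀ n, Continuous (u n) := fun n =>
    continuous_subtype_val.comp (AddCircle.continuous_toCircle.comp (continuous_coord n))
  have hsq : ∀ n θ, u (n + 1) θ ^ 2 = u n θ := fun n θ => by
    simp only [u]
    rw [solenoid_double θ n, AddCircle.toCircle_add, Circle.coe_mul, sq]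
  have hpow : ∀ n θ, u n θ ^ 2 ^ n = u 0 θ := fun n θ => by
    induction n with
    | zero => simp
    | succ n ih => rw [pow_succ, mul_comm, pow_mul, hsq, ih]
  obtain ⟨h, hh, hh2⟩ := exists_log_of_forall_root hG hinj (hu 0) (fun θ => Circle.coe_ne_zero _)
    fun n => ⟨u n, hu n, hpow n⟩
  obtain ⟨c, hc⟩ := eq_add_of_exp_eq (hh.comp continuous_flow)
    (by fun_prop : Continuous fun s : ℝ => ((Real.pi * s : ℝ) : ℂ) * Complex.I) fun s => by
      rw [Function.comp, hh2]
      simp only [u, flow_apply, pow_zero, div_one, AddCircle.toCircle_apply_mk, Circle.coe_exp]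
      congr 3
      ring
  -- Along the flow through `0` the logarithm is `πis + c`. A bound `C` from compactness fails at
  -- the time with `πs = C + ‖c‖ + 1`.
  obtain ⟨C, hC⟩ := (isCompact_range hh).isBounded.exists_norm_le
  have h1 := hC _ (mem_range_self (flow ((C + ‖c‖ + 1) / Real.pi)))
  have h2 := hc ((C + ‖c‖ + 1) / Real.pi)
  rw [Function.comp, mul_div_cancel₀ _ Real.pi_ne_zero] at h2
  have hC0 : 0 ≤ C := (norm_nonneg _).trans h1
  have h3 : ‖((C + ‖c‖ + 1 : ℝ) : ℂ) * Complex.I‖ = C + ‖c‖ + 1 := by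
    rw [norm_mul, Complex.norm_I, mul_one, Complex.norm_real, Real.norm_of_nonneg (by positivity)]
  have h4 : ((C + ‖c‖ + 1 : ℝ) : ℂ) * Complex.I = h (flow ((C + ‖c‖ + 1) / Real.pi)) - c := by
    rw [h2]; ring
  rw [h4] at h3
  have := norm_sub_le (h (flow ((C + ‖c‖ + 1) / Real.pi))) c
  linarith


/-! ### Local roots of branched coverings of the sphere -/

theorem exp_two_pi_shift (w : ℂ) (n : ℤ) :
    Complex.exp (w + n * (2 * Real.pi * Complex.I)) = Complex.exp w := by
  rw [Complex.exp_add, Complex.exp_int_mul_two_pi_mul_I, mul_one]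

/-- The half-plane that `exp` maps onto a punctured disk of radius `exp ρ`. -/
def leftHalfPlane (ρ : ℝ) : Set ℂ := {w | w.re < ρ}

theorem convex_leftHalfPlane (ρ : ℝ) : Convex ℝ (leftHalfPlane ρ) := convex_halfSpace_re_lt ρ

theorem isOpen_leftHalfPlane (ρ : ℝ) : IsOpen (leftHalfPlane ρ) :=
  isOpen_lt Complex.continuous_re continuous_const

theorem leftHalfPlane_nonempty (ρ : ℝ) : (leftHalfPlane ρ).Nonempty :=
  ⟨((ρ - 1 : ℝ) : ℂ), by simp [leftHalfPlane]⟩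

theorem exp_image_leftHalfPlane (ρ : ℝ) :
    Complex.exp '' leftHalfPlane ρ = Metric.ball 0 (Real.exp ρ) \ {0} := by
  ext z
  constructor
  · rintro ⟨w, hw, rfl⟩
    refine ⟨?_, Complex.exp_ne_zero w⟩
    rw [Metric.mem_ball, dist_zero_right, Complex.norm_exp]
    exact Real.exp_lt_exp.2 hw
  · rintro ⟨hz, hz0⟩
    refine ⟨Complex.log z, ?_, Complex.exp_log hz0⟩
    rw [Metric.mem_ball, dist_zero_right] at hz
    rw [leftHalfPlane, mem_ofPred_eq, Complex.log_re]
    exact (Real.log_lt_iff_lt_exp (norm_pos_iff.2 hz0)).2 hz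

theorem isPreconnected_punctured_ball (ρ : ℝ) :
    IsPreconnected (Metric.ball (0 : ℂ) (Real.exp ρ) \ {0}) := by
  rw [← exp_image_leftHalfPlane]
  exact (convex_leftHalfPlane ρ).isPreconnected.image _ Complex.continuous_exp.continuousOn

theorem isLocalHomeomorph_cexp : IsLocalHomeomorph Complex.exp := by
  have h1 : IsLocalHomeomorph ((↑) : {z : ℂ // z ≠ 0} → ℂ) :=
    (isOpen_ne.isOpenEmbedding_subtypeVal).isLocalHomeomorph
  exact h1.comp Complex.isCoveringMap_exp.isLocalHomeomorph

section Root

variable {M N : Type*} [TopologicalSpace M] [TopologicalSpace N] [T1Space M]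

/-- The half-plane `H` is simply connected and covers the punctured disk by `exp`, so it lifts to `U
\ {x}`. Connectedness puts `β \ {x}` in the image of one lift `Λ`. The periods of `Λ` are the
multiples of some `m`, in units of `2πi`, so `Λ w ↦ exp (w / m)` is well defined, injective, and an
`m`-th root of the coordinate downstairs. -/
theorem exists_root_of_punctured_covering {F : M → N} {U : Set M} {V : Set N} {x : M} {y : N} {k : ℕ}
    (hk : IsPuncturedCovering F U x V y k) (hU : IsOpen U) (hV : IsOpen V) (hy : IsClosed ({y} : Set N)) {σ : ℂ → N}
    (hσ : IsOpenEmbedding σ) (hσ0 : σ 0 = y) {ρ : ℝ} (hσV : σ '' Metric.ball 0 (Real.exp ρ) ⊆ V)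
    {β : Set M} (hβU : β ⊆ U) (hβ : IsPreconnected (β \ {x})) (hβ2 : F '' β ⊆ σ '' Metric.ball 0 (Real.exp ρ))
    (hne : (β \ {x}).Nonempty) :
    ∃ m : ℕ, 1 ≤ m ∧ ∃ Φ : M → ℂ, ContinuousOn Φ (β \ {x}) ∧ InjOn Φ (β \ {x}) ∧
      ∀ a ∈ β \ {x}, σ (Φ a ^ m) = F a := by
  set H := leftHalfPlane ρ with hH
  have : ContractibleSpace H := (convex_leftHalfPlane ρ).contractibleSpace (leftHalfPlane_nonempty ρ)
  have : LocallyPathConnectedSpace H := (isOpen_leftHalfPlane ρ).locallyPathConnectedSpace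
  have : PreconnectedSpace H := isPreconnected_iff_preconnectedSpace.1 (convex_leftHalfPlane ρ).isPreconnected
  have hbase : ∀ w : H, σ (Complex.exp w) ∈ V \ {y} := fun w => by
    have h1 : Complex.exp w ∈ Metric.ball 0 (Real.exp ρ) \ {0} := by
      rw [← exp_image_leftHalfPlane]; exact mem_image_of_mem _ w.2
    refine ⟨hσV (mem_image_of_mem _ h1.1), fun h => h1.2 ?_⟩
    rw [mem_singleton_iff, ← hσ0] at h
    exact hσ.injective h
  let ε : C(H, (V \ {y} : Set N)) := ⟨fun w => ⟨σ (Complex.exp w), hbase w⟩,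
    (hσ.continuous.comp (Complex.continuous_exp.comp continuous_subtype_val)).subtype_mk _⟩
  have hεloc : IsLocalHomeomorph ε := by
    have h1 : IsLocalHomeomorph fun w : H => σ (Complex.exp w) :=
      hσ.isLocalHomeomorph.comp (isLocalHomeomorph_cexp.comp
        (isOpen_leftHalfPlane ρ).isOpenEmbedding_subtypeVal.isLocalHomeomorph)
    refine IsLocalHomeomorph.of_comp (g := ((↑) : (V \ {y} : Set N) → N)) h1 ?_ ε.continuous
    exact (hV.sdiff hy).isOpenEmbedding_subtypeVal.isLocalHomeomorph
  set p := hk.mapsTo.restrict with hp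
  have hcov : IsCoveringMap p := hk.isCoveringMap
  have shift_mem : ∀ (n : ℤ) (w : H), (w : ℂ) + n * (2 * Real.pi * Complex.I) ∈ H := fun n w => by
    have := w.2
    simp only [hH, leftHalfPlane, mem_ofPred_eq] at this ⊢
    simpa using this
  let T : ℤ → C(H, H) := fun n => ⟨fun w => ⟨w + n * (2 * Real.pi * Complex.I), shift_mem n w⟩,
    (continuous_subtype_val.add continuous_const).subtype_mk _⟩
  have hεT : ∀ n w, ε (T n w) = ε w := fun n w => Subtype.ext (by
    simp only [ε, T, ContinuousMap.coe_mk]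
    rw [exp_two_pi_shift])
  have hTadd : ∀ m n w, T m (T n w) = T (m + n) w := fun m n w => Subtype.ext (by
    simp only [T, ContinuousMap.coe_mk]
    push_cast; ring)
  have hεeq : ∀ w w', ε w = ε w' → ∃ n, w = T n w' := fun w w' h => by
    have h1 : σ (Complex.exp w) = σ (Complex.exp w') := congrArg Subtype.val h
    obtain ⟨n, hn⟩ := Complex.exp_eq_exp_iff_exists_int.1 (hσ.injective h1)
    exact ⟨n, Subtype.ext hn⟩
  -- two lifts of `ε` agree up to a shift as soon as their ranges meet
  have hmeet : ∀ Λ Λ' : C(H, (U \ {x} : Set M)), p ∘ Λ = ε → p ∘ Λ' = ε → ∀ w w', Λ w = Λ' w' →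
      ∃ n, ∀ v, Λ (T n v) = Λ' v := by
    intro Λ Λ' h h' w w' hww
    have h1 : ε w = ε w' := by
      rw [← congrFun h w, ← congrFun h' w', Function.comp, Function.comp, hww]
    obtain ⟨n, rfl⟩ := hεeq w w' h1
    refine ⟨n, fun v => congrFun (hcov.eq_of_comp_eq (g₁ := Λ ∘ T n) (g₂ := Λ')
      (Λ.continuous.comp (T n).continuous) Λ'.continuous ?_ w' hww) v⟩
    rw [← Function.comp_assoc, h, h']
    exact funext fun v => hεT n v
  have hlift : ∀ a ∈ β \ {x}, ∃ Λ : C(H, (U \ {x} : Set M)), p ∘ Λ = ε ∧ ∃ w, (Λ w : M) = a := by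
    intro a ha
    have haU : a ∈ U \ {x} := ⟨hβU ha.1, ha.2⟩
    obtain ⟨z, hz, hza⟩ := hβ2 (mem_image_of_mem F ha.1)
    have hz0 : z ≠ 0 := by
      rintro rfl
      exact (hk.mapsTo haU).2 (by rw [mem_singleton_iff, ← hza, hσ0])
    have : z ∈ Complex.exp '' leftHalfPlane ρ := by
      rw [exp_image_leftHalfPlane]; exact ⟨hz, hz0⟩
    obtain ⟨w, hw, rfl⟩ := this
    obtain ⟨Λ, ⟨hΛ0, hΛ⟩, -⟩ := hcov.existsUnique_continuousMap_lifts ε (⟨w, hw⟩ : H) ⟨a, haU⟩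
      (Subtype.ext hza.symm)
    exact ⟨Λ, hΛ, ⟨w, hw⟩, congrArg Subtype.val hΛ0⟩
  have hopen : ∀ Λ : C(H, (U \ {x} : Set M)), p ∘ Λ = ε → IsOpenMap fun w => (Λ w : M) := fun Λ hΛ => by
    have h1 : IsLocalHomeomorph Λ :=
      IsLocalHomeomorph.of_comp (hΛ ▸ hεloc) hcov.isLocalHomeomorph Λ.continuous
    exact ((hU.sdiff isClosed_singleton).isOpenEmbedding_subtypeVal.isOpenMap).comp h1.isOpenMap
  obtain ⟨a₀, ha₀⟩ := hne
  obtain ⟨Λ, hΛ, w₀, hw₀⟩ := hlift a₀ ha₀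
  have hsub : β \ {x} ⊆ range fun w => (Λ w : M) := by
    -- `O` is the union of the images of all lifts disjoint from `Λ`. Images that meet coincide up
    -- to a shift, so `O` and the image of `Λ` are disjoint open sets covering `β \ {x}`.
    let O : Set M := ⋃ (Λ' : {Λ' : C(H, (U \ {x} : Set M)) // p ∘ Λ' = ε ∧
      Disjoint (range fun w => (Λ w : M)) (range fun w => (Λ' w : M))}), range fun w => (Λ'.1 w : M)
    have hO : IsOpen O := isOpen_iUnion fun Λ' => (hopen Λ'.1 Λ'.2.1).isOpen_range
    refine hβ.subset_left_of_subset_union (hopen Λ hΛ).isOpen_range hO ?_ ?_ ⟨a₀, ha₀, w₀, hw₀⟩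
    · rw [disjoint_iUnion_right]
      exact fun Λ' => Λ'.2.2
    · intro a ha
      by_cases h : a ∈ range fun w => (Λ w : M)
      · exact .inl h
      · obtain ⟨Λ', hΛ', w, rfl⟩ := hlift a ha
        refine .inr (mem_iUnion.2 ⟨⟨Λ', hΛ', ?_⟩, w, rfl⟩)
        rw [disjoint_left]
        rintro _ ⟨v, rfl⟩ ⟨v', hv'⟩
        obtain ⟨n, hn⟩ := hmeet Λ Λ' hΛ hΛ' v v' (Subtype.ext hv'.symm)
        exact h ⟨T n w, congrArg Subtype.val (hn w)⟩
  -- the group of periods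
  let P : AddSubgroup ℤ :=
    { carrier := {n | ∀ v, Λ (T n v) = Λ v}
      zero_mem' := fun v => by congr 1; exact Subtype.ext (by simp [T])
      add_mem' := fun {a b} ha hb v => by rw [← hTadd, ha, hb]
      neg_mem' := fun {a} ha v => by
        rw [← ha (T (-a) v), hTadd, add_neg_cancel]
        congr 1; exact Subtype.ext (by simp [T]) }
  have hPmeet : ∀ n w, Λ (T n w) = Λ w → n ∈ P := fun n w h v => by
    refine congrFun (hcov.eq_of_comp_eq (g₁ := Λ ∘ T n) (g₂ := Λ)
      (Λ.continuous.comp (T n).continuous) Λ.continuous ?_ w h) v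
    rw [← Function.comp_assoc, hΛ]
    exact funext fun v => hεT n v
  obtain ⟨g, hg⟩ : ∃ g : ℤ, P = AddSubgroup.zmultiples g := by
    obtain ⟨g, hg⟩ := Int.subgroup_cyclic P
    exact ⟨g, by rw [hg, AddSubgroup.zmultiples_eq_closure]⟩
  -- Without periods, the shifts of `w₀` would give infinitely many points in one finite fibre.
  have hg0 : g ≠ 0 := by
    rintro rfl
    have hfin : ((U \ {x}) ∩ F ⁻¹' {F a₀}).Finite := by
      refine finite_of_encard_eq_coe (hk.encard_fiber (F a₀) ?_)
      exact hk.mapsTo ⟨hβU ha₀.1, ha₀.2⟩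
    have hmaps : ∀ n : ℤ, (Λ (T n w₀) : M) ∈ (U \ {x}) ∩ F ⁻¹' {F a₀} := fun n => by
      refine ⟨(Λ (T n w₀)).2, ?_⟩
      have h1 : p (Λ (T n w₀)) = p (Λ w₀) :=
        (congrFun hΛ (T n w₀)).trans ((hεT n w₀).trans (congrFun hΛ w₀).symm)
      have h2 : F (Λ (T n w₀)) = F (Λ w₀) := congrArg Subtype.val h1
      rw [mem_preimage, mem_singleton_iff, h2, hw₀]
    have := hfin.to_subtype
    obtain ⟨n, n', hnn, heq⟩ := Finite.exists_ne_map_eq_of_infinite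
      fun n : ℤ => (⟨Λ (T n w₀), hmaps n⟩ : ((U \ {x}) ∩ F ⁻¹' {F a₀} : Set M))
    have heq' : Λ (T n w₀) = Λ (T n' w₀) := Subtype.ext (congrArg (fun a => a.1) heq)
    have : n - n' ∈ P := hPmeet (n - n') (T n' w₀) (by rw [hTadd, sub_add_cancel, heq'])
    rw [hg, AddSubgroup.zmultiples_zero_eq_bot, AddSubgroup.mem_bot] at this
    exact hnn (sub_eq_zero.1 this)
  set m := g.natAbs with hm
  have hm0 : (m : ℂ) ≠ 0 := Nat.cast_ne_zero.2 (Int.natAbs_ne_zero.2 hg0)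
  have hPm : ∀ n, n ∈ P ↔ (m : ℤ) ∣ n := fun n => by
    rw [hg, Int.mem_zmultiples_iff, hm, Int.natAbs_dvd]
  have hexp : ∀ w w', Λ w = Λ w' ↔ Complex.exp ((w : ℂ) / m) = Complex.exp ((w' : ℂ) / m) := by
    intro w w'
    constructor
    · intro h
      have h1 : ε w = ε w' := by rw [← congrFun hΛ w, ← congrFun hΛ w', Function.comp, Function.comp, h]
      obtain ⟨n, rfl⟩ := hεeq w w' h1
      obtain ⟨j, rfl⟩ := (hPm n).1 (hPmeet n w' h)
      have e : ((T (m * j) w' : H) : ℂ) / m = (w' : ℂ) / m + j * (2 * Real.pi * Complex.I) := by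
        simp only [T, ContinuousMap.coe_mk]
        push_cast
        field_simp
      rw [e, exp_two_pi_shift]
    · intro h
      obtain ⟨j, hj⟩ := Complex.exp_eq_exp_iff_exists_int.1 h
      have : w = T (m * j) w' := Subtype.ext (by
        simp only [T, ContinuousMap.coe_mk]
        push_cast
        field_simp at hj
        linear_combination hj)
      rw [this]
      exact (hPm (m * j)).2 (dvd_mul_right _ _) w'
  have hsec : ∀ a, ∃ w : H, a ∈ β \ {x} → (Λ w : M) = a := fun a => by
    by_cases h : a ∈ β \ {x}
    · obtain ⟨w, hw⟩ := hsub h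
      exact ⟨w, fun _ => hw⟩
    · exact ⟨w₀, fun h' => absurd h' h⟩
  choose s hs using hsec
  have hΦΛ : ∀ w, (Λ w : M) ∈ β \ {x} → Complex.exp ((s (Λ w) : ℂ) / m) = Complex.exp ((w : ℂ) / m) :=
    fun w hw => (hexp _ _).1 (Subtype.ext (hs _ hw))
  refine ⟨m, Nat.one_le_iff_ne_zero.2 (Int.natAbs_ne_zero.2 hg0), fun a => Complex.exp ((s a : ℂ) / m),
    fun a ha => ?_, fun a ha b hb hab => ?_, fun a ha => ?_⟩
  · obtain ⟨w, rfl⟩ := hsub ha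
    have hle : 𝓝 (Λ w : M) ≤ map (fun w => (Λ w : M)) (𝓝 w) := (hopen Λ hΛ).nhds_le w
    rw [ContinuousWithinAt, hΦΛ w ha]
    have hc : Tendsto (fun w : H => Complex.exp ((w : ℂ) / m)) (𝓝 w) (𝓝 (Complex.exp ((w : ℂ) / m))) :=
      (by fun_prop : Continuous fun w : H => Complex.exp ((w : ℂ) / m)).continuousAt
    rw [tendsto_iff_forall_eventually_mem] at hc ⊢
    intro S hS
    have h1 := hc S hS
    have h2 : ∀ᶠ a in 𝓝 (Λ w : M), ∃ w', (Λ w' : M) = a ∧ Complex.exp ((w' : ℂ) / m) ∈ S := by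
      refine hle (mem_map.2 ?_)
      filter_upwards [h1] with w' hw' using ⟨w', rfl, hw'⟩
    filter_upwards [nhdsWithin_le_nhds h2, self_mem_nhdsWithin] with a ⟨w', hw', hS'⟩ ha'
    subst hw'
    rwa [hΦΛ w' ha']
  · rw [← hs a ha, ← hs b hb]
    exact congrArg Subtype.val ((hexp _ _).2 hab)
  · rw [← Complex.exp_nat_mul, mul_div_cancel₀ _ hm0]
    have := congrArg Subtype.val (congrFun hΛ (s a))
    have h2 : F (Λ (s a)) = σ (Complex.exp (s a)) := this
    rw [← h2, hs a ha]

end Root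

/-- The inverse of a stereographic projection, centred at a given point. -/
theorem exists_sphere_chart {v y : Sphere2} (hy : y ≠ v) :
    ∃ σ : ℂ → Sphere2, IsOpenEmbedding σ ∧ σ 0 = y ∧ range σ = {v}ᶜ := by
  have : Fact (Module.finrank ℝ (EuclideanSpace ℝ (Fin 3)) = 2 + 1) := ⟨by simp⟩
  let s := stereographic' 2 v
  have hsrc : s.source = {v}ᶜ := stereographic'_source v
  have htgt : s.target = univ := stereographic'_target v
  let L : ℂ ≃ₜ EuclideanSpace ℝ (Fin 2) := Complex.orthonormalBasisOneI.repr.toHomeomorph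
  let τ : ℂ ≃ₜ EuclideanSpace ℝ (Fin 2) := L.trans (Homeomorph.addRight (s y))
  have hL0 : L 0 = 0 := map_zero Complex.orthonormalBasisOneI.repr
  have hemb : IsOpenEmbedding s.symm := s.symm.isOpenEmbedding htgt
  refine ⟨s.symm ∘ τ, hemb.comp τ.isOpenEmbedding, ?_, ?_⟩
  · have : τ 0 = s y := by simp [τ, hL0]
    rw [Function.comp, this]
    exact s.left_inv (by rw [hsrc]; exact hy)
  · rw [range_comp, τ.surjective.range_eq, ← htgt, ← hsrc]
    exact s.symm.image_source_eq_target

/-- The neighbourhood `β` is a round disk in a chart centred at `x`, which keeps it connected after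
the puncture. -/
theorem exists_sphere_root {F : Sphere2 → Sphere2} (hF : IsBranchedCovering F) (x : Sphere2) {σ : ℂ → Sphere2}
    (hσ : IsOpenEmbedding σ) (hσ0 : σ 0 = F x) :
    ∃ m : ℕ, 1 ≤ m ∧ ∃ (Φ : Sphere2 → ℂ) (β : Set Sphere2), β ∈ 𝓝 x ∧ ContinuousOn Φ (β \ {x}) ∧
      InjOn Φ (β \ {x}) ∧ ∀ a ∈ β \ {x}, σ (Φ a ^ m) = F a := by
  obtain ⟨k, hk1, V, 𝒰, U, hV, hU, hxU, hk⟩ := hF.exists_hasLocalDegree x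
  have hUo := hV.isOpen_sheet U hU
  have hσV : σ ⁻¹' V ∈ 𝓝 (0 : ℂ) :=
    hσ.continuous.continuousAt.preimage_mem_nhds (hV.isOpen.mem_nhds (by rw [hσ0]; exact hV.mem))
  obtain ⟨r, hr, hrV⟩ := Metric.mem_nhds_iff.1 hσV
  obtain ⟨ρ, rfl⟩ : ∃ ρ, Real.exp ρ = r := ⟨Real.log r, Real.exp_log hr⟩
  obtain ⟨σ', hσ', hσ'0, -⟩ := exists_sphere_chart (v := -x) (y := x) (ne_neg_of_mem_unit_sphere ℝ x)
  have hopen : IsOpen (F ⁻¹' (σ '' Metric.ball 0 (Real.exp ρ))) :=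
    (hσ.isOpenMap _ Metric.isOpen_ball).preimage hF.1
  have hx0 : x ∈ F ⁻¹' (σ '' Metric.ball 0 (Real.exp ρ)) := ⟨0, Metric.mem_ball_self hr, hσ0⟩
  have hn : σ' ⁻¹' (U ∩ F ⁻¹' (σ '' Metric.ball 0 (Real.exp ρ))) ∈ 𝓝 (0 : ℂ) :=
    hσ'.continuous.continuousAt.preimage_mem_nhds
      ((hUo.inter hopen).mem_nhds (by rw [hσ'0]; exact ⟨hxU, hx0⟩))
  obtain ⟨r', hr', hr'V⟩ := Metric.mem_nhds_iff.1 hn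
  obtain ⟨ρ', rfl⟩ : ∃ ρ, Real.exp ρ = r' := ⟨Real.log r', Real.exp_log hr'⟩
  set β := σ' '' Metric.ball 0 (Real.exp ρ') with hβ
  have hβx : β \ {x} = σ' '' (Metric.ball 0 (Real.exp ρ') \ {0}) := by
    rw [image_sdiff hσ'.injective, image_singleton, hσ'0]
  obtain ⟨m, hm, Φ, h1, h2, h3⟩ := exists_root_of_punctured_covering hk hUo hV.isOpen isClosed_singleton hσ hσ0
    (image_subset_iff.2 hrV) (β := β) (by rintro _ ⟨z, hz, rfl⟩; exact (hr'V hz).1)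
    (by rw [hβx]; exact (isPreconnected_punctured_ball ρ').image _ hσ'.continuous.continuousOn)
    (by rintro _ ⟨_, ⟨z, hz, rfl⟩, rfl⟩; exact (hr'V hz).2)
    (by
      rw [hβx, ← exp_image_leftHalfPlane]
      exact ((leftHalfPlane_nonempty ρ').image _).image _)
  exact ⟨m, hm, Φ, β, (hσ'.isOpenMap _ Metric.isOpen_ball).mem_nhds ⟨0, Metric.mem_ball_self hr', hσ'0⟩,
    h1, h2, h3⟩


/-! ### Lifting boxes around the zero of the solenoid -/

/-- The kernel of the coordinate `M` of the solenoid. -/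
def transversal (M : ℕ) : AddSubgroup solenoid where
  carrier := {ζ | ζ.1 M = 0}
  zero_mem' := rfl
  add_mem' {a b} ha hb := by
    change a.1 M + b.1 M = 0
    rw [show a.1 M = 0 from ha, show b.1 M = 0 from hb, add_zero]
  neg_mem' {a} ha := by
    change -a.1 M = 0
    rw [show a.1 M = 0 from ha, neg_zero]

theorem mem_transversal {M : ℕ} {ζ : solenoid} : ζ ∈ transversal M ↔ ζ.1 M = 0 := Iff.rfl

theorem transversal_antitone : Antitone transversal := fun _ _ h ζ hζ =>
  solenoid_eq_of_le (θ := ζ) (θ' := 0) h hζ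

theorem isClosed_transversal (M : ℕ) : IsClosed (transversal M : Set solenoid) :=
  isClosed_eq (continuous_coord M) continuous_const

/-- The subgroups `transversal M` are compact and decrease to `{0}`. -/
theorem eventually_transversal {P : solenoid → Prop} (h : ∀ᶠ ζ in 𝓝 0, P ζ) :
    ∀ᶠ M in atTop, ∀ ζ ∈ transversal M, P ζ := by
  obtain ⟨M, hM⟩ := exists_subset_nhds_of_isCompact' (V := fun M => (transversal M : Set solenoid))
    (U := {ζ | P ζ}) (Antitone.directed_ge fun _ _ h => transversal_antitone h)
    (fun M => (isClosed_transversal M).isCompact) isClosed_transversal (fun ζ hζ => by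
      have : ζ = 0 := by
        ext n
        exact mem_iInter.1 hζ n
      rw [this]; exact h)
  filter_upwards [eventually_ge_atTop M] with n hn ζ hζ
  exact hM (transversal_antitone hn hζ)

theorem exists_box_subset {N : Set solenoid} (hN : N ∈ 𝓝 (0 : solenoid)) :
    ∃ ε ∈ Ioo (0 : ℝ) 1, ∀ᶠ M in atTop, ∀ ζ ∈ transversal M, ∀ s, |s| ≤ ε → ζ + flow s ∈ N := by
  have hc : Continuous fun z : solenoid × ℝ => z.1 + flow z.2 :=
    continuous_fst.add (continuous_flow.comp continuous_snd)
  have h0 : (fun z : solenoid × ℝ => z.1 + flow z.2) ⁻¹' N ∈ 𝓝 ((0, 0) : solenoid × ℝ) :=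
    hc.continuousAt.preimage_mem_nhds (by simpa using hN)
  obtain ⟨A, hA, B, hB, hAB⟩ := mem_nhds_prod_iff.1 h0
  obtain ⟨δ, hδ, hδB⟩ := Metric.mem_nhds_iff.1 hB
  refine ⟨min (1 / 2) (δ / 2), ⟨by positivity, (min_le_left _ _).trans_lt (by norm_num)⟩, ?_⟩
  filter_upwards [eventually_transversal (P := (· ∈ A)) hA] with M hM ζ hζ s hs
  refine hAB (mk_mem_prod (hM ζ hζ) (hδB ?_))
  rw [Metric.mem_ball, dist_zero_right, Real.norm_eq_abs]
  exact (hs.trans (min_le_right _ _)).trans_lt (half_lt_self hδ)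

/-- A flow time in the kernel of coordinate `M` is a multiple of `2 * 2 ^ M`, so times less than `2`
apart cannot return to the transversal. -/
theorem transversal_add_flow_injective {M : ℕ} {ζ ζ' : solenoid} (hζ : ζ ∈ transversal M)
    (hζ' : ζ' ∈ transversal M) {s s' : ℝ} (hs : |s - s'| < 2) (h : ζ + flow s = ζ' + flow s') :
    ζ = ζ' ∧ s = s' := by
  have h1 : flow (s - s') = ζ' - ζ := by
    rw [map_sub, sub_eq_sub_iff_add_eq_add, add_comm, h, add_comm]
  have h2 : (((s - s') / 2 ^ M : ℝ) : AddCircle (2 : ℝ)) = 0 := by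
    rw [← flow_apply, h1]
    exact (transversal M).sub_mem hζ' hζ
  obtain ⟨n, hn⟩ := (AddCircle.coe_eq_zero_iff (2 : ℝ)).1 h2
  have hpow : (1 : ℝ) ≤ 2 ^ M := one_le_pow₀ (by norm_num)
  have h3 : s - s' = n * 2 * 2 ^ M := by
    rw [zsmul_eq_mul] at hn
    field_simp at hn
    linarith
  have h4 : n = 0 := by
    by_contra hn0
    have : (1 : ℝ) ≤ |(n : ℝ)| := by exact_mod_cast Int.one_le_abs hn0
    rw [h3, abs_mul, abs_mul, abs_of_pos (by positivity : (0 : ℝ) < 2 ^ M), abs_two] at hs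
    nlinarith
  have h5 : s = s' := by
    rw [h4] at h3; simp at h3; linarith
  subst h5
  exact ⟨add_right_cancel h, rfl⟩

/-- A punctured half-box at the zero of the solenoid, in the coordinates `(ζ, s) ↦ ζ + flow s`. -/
def halfBox (M : ℕ) (s₀ : ℝ) : Set (solenoid × ℝ) :=
  {z | z.1 ∈ transversal M ∧ z.2 ∈ Icc 0 s₀ ∧ z ≠ 0}

theorem halfBox_mono {M M' : ℕ} (h : M ≤ M') (s₀ : ℝ) : halfBox M' s₀ ⊆ halfBox M s₀ :=
  fun _ hz => ⟨transversal_antitone h hz.1, hz.2⟩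

theorem fold_ne_point_of_mem_halfBox {M : ℕ} {s₀ : ℝ} (hs₀ : s₀ ≤ 1) {z : solenoid × ℝ}
    (hz : z ∈ halfBox M s₀) : fold (z.1 + flow z.2) ≠ knasterPoint := fun h => by
  have h1 : z.1 + flow z.2 = 0 + flow 0 := by
    rw [fold_eq_point_iff.1 h, map_zero, add_zero]
  obtain ⟨h2, h3⟩ := transversal_add_flow_injective hz.1 (transversal M).zero_mem
    (by rw [sub_zero, abs_of_nonneg hz.2.1.1]; linarith [hz.2.1.2]) h1
  exact hz.2.2 (Prod.ext h2 h3)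

theorem mk_mem_halfBox {M : ℕ} {s₀ : ℝ} (hs₀ : 0 < s₀) {ζ : solenoid} (hζ : ζ ∈ transversal M) :
    (ζ, s₀) ∈ halfBox M s₀ :=
  ⟨hζ, ⟨hs₀.le, le_rfl⟩, fun h => hs₀.ne' (congrArg Prod.snd h)⟩

theorem mk_mem_halfBox_of_ne {M : ℕ} {s₀ : ℝ} {ζ : solenoid} (hζ : ζ ∈ transversal M)
    (h0 : ζ ≠ 0) {s : ℝ} (hs : s ∈ Icc 0 s₀) : (ζ, s) ∈ halfBox M s₀ :=
  ⟨hζ, hs, fun h => h0 (congrArg Prod.fst h)⟩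

/-- A lift through `f` of the punctured half-box, into the punctured sheet `U \ {c}`. -/
structure IsBoxLift (f : Knaster → Knaster) (U : Set Knaster) (c : Knaster) (M : ℕ) (s₀ : ℝ)
    (Q : solenoid × ℝ → Knaster) : Prop where
  continuousOn : ContinuousOn Q (halfBox M s₀)
  mem : ∀ z ∈ halfBox M s₀, Q z ∈ U \ {c}
  map_eq : ∀ z ∈ halfBox M s₀, f (Q z) = fold (z.1 + flow z.2)

theorem IsBoxLift.mono {f : Knaster → Knaster} {U : Set Knaster} {c : Knaster} {M M' : ℕ} {s₀ : ℝ}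
    {Q : solenoid × ℝ → Knaster} (h : IsBoxLift f U c M s₀ Q) (hM : M ≤ M') :
    IsBoxLift f U c M' s₀ Q :=
  ⟨h.1.mono (halfBox_mono hM s₀), fun z hz => h.2 z (halfBox_mono hM s₀ hz),
    fun z hz => h.3 z (halfBox_mono hM s₀ hz)⟩

/-- The homotopy is lifted from its start and read off at its end; where it is stationary,
uniqueness makes the lifted path constant. -/
theorem exists_lift_of_homotopy {E B A : Type*} [TopologicalSpace E] [TopologicalSpace B]
    [TopologicalSpace A] {p : E → B} (hp : IsCoveringMap p) (H : C(unitInterval × A, B)) (S : C(A, E))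
    (hS : ∀ a, H (0, a) = p (S a)) :
    ∃ L : C(A, E), (∀ a, p (L a) = H (1, a)) ∧ ∀ a, (∀ u, H (u, a) = H (0, a)) → L a = S a := by
  let L := hp.liftHomotopy H S hS
  have hL : ∀ w, p (L w) = H w := fun w => congrFun (hp.liftHomotopy_lifts H S hS) w
  have hL0 : ∀ a, L (0, a) = S a := hp.liftHomotopy_zero H S hS
  refine ⟨L.comp ((ContinuousMap.const A 1).prodMk (ContinuousMap.id A)), fun a => hL _, fun a ha => ?_⟩
  rw [← hL0]
  have hc : Continuous fun u : unitInterval => L (u, a) :=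
    L.continuous.comp (continuous_id.prodMk continuous_const)
  refine congrFun (hp.eq_of_comp_eq (g₂ := fun _ => L (0, a)) hc continuous_const ?_ 0 rfl) 1
  funext u
  change p _ = p _
  rw [hL, hL, ha]

theorem IsPuncturedCovering.exists_section {X Y : Type*} [TopologicalSpace X] [TopologicalSpace Y]
    {f : X → Y} {U : Set X} {V : Set Y} {x : X} {y : Y} {k : ℕ} (hk : IsPuncturedCovering f U x V y k)
    (hV : IsOpen (V \ {y})) {a : X} (ha : a ∈ U \ {x}) :
    ∃ O ∈ 𝓝 (f a), O ⊆ V \ {y} ∧ ∃ τ : Y → X, ContinuousOn τ O ∧ (∀ v ∈ O, τ v ∈ U \ {x}) ∧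
      (∀ v ∈ O, f (τ v) = v) ∧ τ (f a) = a := by
  classical
  obtain ⟨e, hae, hpe⟩ := hk.isCoveringMap.isLocalHomeomorph ⟨a, ha⟩
  have hopen : IsOpen (((↑) : (V \ {y} : Set Y) → Y) '' e.target) := hV.isOpenMap_subtype_val _ e.open_target
  have hea : e ⟨a, ha⟩ = ⟨f a, hk.mapsTo ha⟩ := by rw [← hpe]; rfl
  have hsub : ((↑) : (V \ {y} : Set Y) → Y) '' e.target ⊆ V \ {y} := by rintro _ ⟨v, -, rfl⟩; exact v.2
  have hmem : ∀ v (h : v ∈ V \ {y}), v ∈ ((↑) : (V \ {y} : Set Y) → Y) '' e.target → ⟨v, h⟩ ∈ e.target := by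
    rintro _ h ⟨v, hv, rfl⟩; exact hv
  -- The value `a` off `V \ {y}` is a filler; only values on `O` are used.
  let τ : Y → X := fun v => if h : v ∈ V \ {y} then (e.symm ⟨v, h⟩ : (U \ {x} : Set X)) else a
  have hτ : ∀ v (h : v ∈ V \ {y}), τ v = (e.symm ⟨v, h⟩ : (U \ {x} : Set X)) := fun v h => dif_pos h
  refine ⟨_, hopen.mem_nhds ⟨e ⟨a, ha⟩, e.map_source hae, by rw [hea]⟩, hsub, τ, ?_, fun v hv => ?_,
    fun v hv => ?_, ?_⟩
  · rw [continuousOn_iff_continuous_domRestrict]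
    have h1 : Continuous fun v : (((↑) : (V \ {y} : Set Y) → Y) '' e.target) =>
        e.symm ⟨v.1, hsub v.2⟩ :=
      e.symm.continuousOn.comp_continuous (continuous_subtype_val.subtype_mk _) fun v => hmem _ _ v.2
    exact (continuous_subtype_val.comp h1).congr fun v => (hτ v (hsub v.2)).symm
  · rw [hτ v (hsub hv)]; exact (e.symm ⟨v, hsub hv⟩).2
  · rw [hτ v (hsub hv)]
    have h1 := e.right_inv (hmem v (hsub hv) hv)
    rw [← hpe] at h1
    exact congrArg Subtype.val h1
  · rw [hτ (f a) (hk.mapsTo ha), ← hea, e.left_inv hae]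

theorem halfBox_contract {M : ℕ} {s₀ : ℝ} (hs₀ : 0 < s₀) {z : solenoid × ℝ} (hz : z ∈ halfBox M s₀) {u : ℝ}
    (hu : u ∈ Icc (0 : ℝ) 1) : (z.1, (1 - u) * s₀ + u * z.2) ∈ halfBox M s₀ := by
  have h3 := mul_nonneg (sub_nonneg.2 hu.2) hs₀.le
  have h4 := mul_nonneg hu.1 hz.2.1.1
  refine ⟨hz.1, ⟨add_nonneg h3 h4, ?_⟩, fun h => ?_⟩
  · nlinarith [mul_nonneg hu.1 (sub_nonneg.2 hz.2.1.2)]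
  · have h1 : z.1 = 0 := congrArg Prod.fst h
    have h2 : (1 - u) * s₀ + u * z.2 = 0 := congrArg Prod.snd h
    have h5 : 1 - u = 0 := by
      have : (1 - u) * s₀ = 0 := by linarith
      exact (mul_eq_zero.1 this).resolve_right hs₀.ne'
    have h6 : u = 1 := by linarith
    rw [h6] at h2
    exact hz.2.2 (Prod.ext h1 (by simpa using h2))

/-- The half-box contracts along the flow to its far face `s = s₀`. A local section lifts that face
near `ζ = 0`, which fixes `M`, and homotopy lifting carries the lift over the half-box. The puncture
is never met, since `s = 0` is reached over `ζ = 0` only from the excluded point. -/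
theorem exists_boxLift {f : Knaster → Knaster} {U V : Set Knaster} {c : Knaster} {k : ℕ}
    (hk : IsPuncturedCovering f U c V knasterPoint k) (hV : IsOpen V) {s₀ : ℝ} (hs₀ : s₀ ∈ Ioo (0 : ℝ) 1)
    {M₁ : ℕ} (hbox : ∀ ζ ∈ transversal M₁, ∀ s ∈ Icc 0 s₀, fold (ζ + flow s) ∈ V) {a : Knaster}
    (ha : a ∈ U \ {c}) (hfa : f a = fold (flow s₀)) :
    ∃ M ≥ M₁, ∃ Q, IsBoxLift f U c M s₀ Q ∧ Q (0, s₀) = a := by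
  obtain ⟨O, hO, hOV, τ, hτc, hτU, hτf, hτa⟩ := hk.exists_section (hV.sdiff isClosed_singleton) ha
  have hstart : ∀ᶠ ζ in 𝓝 (0 : solenoid), fold (ζ + flow s₀) ∈ O := by
    have hc : Continuous fun ζ : solenoid => fold (ζ + flow s₀) :=
      continuous_fold.comp (continuous_id.add continuous_const)
    exact hc.continuousAt.preimage_mem_nhds (x := 0) (t := O) (by simpa [← hfa] using hO)
  obtain ⟨M, hM, hMM⟩ := ((eventually_transversal hstart).and (eventually_ge_atTop M₁)).exists
  have hbox' : ∀ z ∈ halfBox M s₀, fold (z.1 + flow z.2) ∈ V \ {knasterPoint} :=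
    fun z hz => ⟨hbox _ (transversal_antitone hMM hz.1) _ hz.2.1, fold_ne_point_of_mem_halfBox hs₀.2.le hz⟩
  let h : unitInterval × halfBox M s₀ → Knaster := fun w =>
    fold (w.2.1.1 + flow ((1 - (w.1 : ℝ)) * s₀ + (w.1 : ℝ) * w.2.1.2))
  have hcont : Continuous h := by
    have h1 : Continuous fun w : unitInterval × halfBox M s₀ => (1 - (w.1 : ℝ)) * s₀ + (w.1 : ℝ) * w.2.1.2 := by
      fun_prop
    have h2 : Continuous fun w : unitInterval × halfBox M s₀ => w.2.1.1 := by fun_prop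
    exact continuous_fold.comp (h2.add (continuous_flow.comp h1))
  have hbox2 : ∀ ζ s, (ζ, s) ∈ halfBox M s₀ → fold (ζ + flow s) ∈ V \ {knasterPoint} :=
    fun ζ s hz => hbox' (ζ, s) hz
  have hmaps : ∀ w, h w ∈ V \ {knasterPoint} := by
    rintro ⟨⟨u, hu⟩, ⟨⟨ζ, s⟩, hz⟩⟩
    have h1 := halfBox_contract hs₀.1 hz hu
    exact hbox2 ζ _ h1
  let H : C(unitInterval × halfBox M s₀, (V \ {knasterPoint} : Set Knaster)) :=
    ⟨fun w => ⟨h w, hmaps w⟩, hcont.subtype_mk _⟩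
  let S : C(halfBox M s₀, (U \ {c} : Set Knaster)) :=
    ⟨fun z => ⟨τ (fold (z.1.1 + flow s₀)), hτU _ (hM _ z.2.1)⟩, by
      refine (hτc.comp_continuous ?_ fun z => hM _ z.2.1).subtype_mk _
      exact continuous_fold.comp ((continuous_fst.comp continuous_subtype_val).add continuous_const)⟩
  have hHS : ∀ z, H (0, z) = MapsTo.restrict f _ _ hk.mapsTo (S z) := fun z => by
    refine Subtype.ext ?_
    change fold (z.1.1 + flow ((1 - (0 : ℝ)) * s₀ + 0 * z.1.2)) = f (τ (fold (z.1.1 + flow s₀)))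
    rw [hτf _ (hM _ z.2.1), sub_zero, one_mul, zero_mul, add_zero]
  obtain ⟨L, hL, hL0⟩ := exists_lift_of_homotopy hk.isCoveringMap H S hHS
  classical
  have hz₀ : ((0 : solenoid), s₀) ∈ halfBox M s₀ := mk_mem_halfBox hs₀.1 (transversal M).zero_mem
  let Q : solenoid × ℝ → Knaster := fun z => if h : z ∈ halfBox M s₀ then L ⟨z, h⟩ else c
  have hQ : ∀ z (h : z ∈ halfBox M s₀), Q z = L ⟨z, h⟩ := fun z h => dif_pos h
  refine ⟨M, hMM, Q, ⟨?_, fun z hz => ?_, fun z hz => ?_⟩, ?_⟩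
  · rw [continuousOn_iff_continuous_domRestrict]
    exact (continuous_subtype_val.comp L.continuous).congr fun z => (hQ z.1 z.2).symm
  · rw [hQ z hz]; exact (L _).2
  · rw [hQ z hz]
    have h1 : f (L ⟨z, hz⟩) = fold (z.1 + flow ((1 - (1 : ℝ)) * s₀ + 1 * z.2)) :=
      congrArg Subtype.val (hL ⟨z, hz⟩)
    rw [h1, sub_self, zero_mul, one_mul, zero_add]
  · rw [hQ _ hz₀, hL0 ⟨_, hz₀⟩ fun u => Subtype.ext ?_]
    · change τ (fold (0 + flow s₀)) = a
      rw [zero_add, ← hfa, hτa]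
    · change fold (0 + flow ((1 - (u : ℝ)) * s₀ + u * s₀)) = fold (0 + flow ((1 - (0 : ℝ)) * s₀ + 0 * s₀))
      congr 3
      ring


/-! ### The two lifts of a box at a critical point -/

/-- Two values near `α` lie on the same side of a value near `γ`, so one of them lies between it and
the other. -/
theorem mem_uIcc_or_mem_uIcc {μ e₁ e₂ α γ η : ℝ} (hμ : |μ - γ| < η) (h₁ : |e₁ - α| < η)
    (h₂ : |e₂ - α| < η) (h : 2 * η ≤ |α - γ|) : e₁ ∈ uIcc μ e₂ ∨ e₂ ∈ uIcc μ e₁ := by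
  rw [abs_lt] at hμ h₁ h₂
  simp only [mem_uIcc]
  rcases le_abs.1 h with h | h <;> rcases le_total e₁ e₂ with h' | h'
  · exact .inl (.inl ⟨by linarith, h'⟩)
  · exact .inr (.inl ⟨by linarith, h'⟩)
  · exact .inr (.inr ⟨h', by linarith⟩)
  · exact .inl (.inr ⟨h', by linarith⟩)

section BoxLift

variable {f : Knaster → Knaster} {U V : Set Knaster} {c : Knaster} {k M : ℕ} {s₀ : ℝ}
  {Q Q₁ Q₂ : solenoid × ℝ → Knaster}

theorem IsBoxLift.continuousOn_slice (hQ : IsBoxLift f U c M s₀ Q) {ζ : solenoid} {I : Set ℝ}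
    (hI : ∀ s ∈ I, (ζ, s) ∈ halfBox M s₀) : ContinuousOn (fun s => Q (ζ, s)) I :=
  hQ.continuousOn.comp (continuousOn_const.prodMk continuousOn_id) hI

/-- Two lifts of the flow segment from `s` to `s₀` that agree at `s` agree at `s₀`. -/
theorem IsBoxLift.ne_of_ne (hk : IsPuncturedCovering f U c V knasterPoint k)
    (h₁ : IsBoxLift f U c M s₀ Q₁) (h₂ : IsBoxLift f U c M s₀ Q₂) {ζ : solenoid}
    (hne : Q₁ (ζ, s₀) ≠ Q₂ (ζ, s₀)) {s : ℝ} (hs : (ζ, s) ∈ halfBox M s₀) : Q₁ (ζ, s) ≠ Q₂ (ζ, s) := by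
  intro heq
  have hI : ∀ t ∈ Icc s s₀, (ζ, t) ∈ halfBox M s₀ := fun t ht => by
    refine ⟨hs.1, ⟨hs.2.1.1.trans ht.1, ht.2⟩, fun h => ?_⟩
    have h1 : ζ = 0 := congrArg Prod.fst h
    have h2 : t = 0 := congrArg Prod.snd h
    have h3 : s = 0 := le_antisymm (h2 ▸ ht.1) hs.2.1.1
    exact hs.2.2 (by rw [h1, h3]; rfl)
  have : PreconnectedSpace (Icc s s₀) := isPreconnected_iff_preconnectedSpace.1 isPreconnected_Icc
  let L₁ : Icc s s₀ → (U \ {c} : Set Knaster) := fun t => ⟨Q₁ (ζ, t), h₁.mem _ (hI t t.2)⟩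
  let L₂ : Icc s s₀ → (U \ {c} : Set Knaster) := fun t => ⟨Q₂ (ζ, t), h₂.mem _ (hI t t.2)⟩
  have hc₁ : Continuous L₁ :=
    (continuousOn_iff_continuous_domRestrict.1 (h₁.continuousOn_slice hI)).subtype_mk _
  have hc₂ : Continuous L₂ :=
    (continuousOn_iff_continuous_domRestrict.1 (h₂.continuousOn_slice hI)).subtype_mk _
  have hss : s ≤ s₀ := hs.2.1.2
  have := hk.isCoveringMap.eq_of_comp_eq hc₁ hc₂ (funext fun t => Subtype.ext
    ((h₁.map_eq _ (hI t t.2)).trans (h₂.map_eq _ (hI t t.2)).symm)) ⟨s, left_mem_Icc.2 hss⟩ (Subtype.ext heq)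
  exact hne (congrArg Subtype.val (congrFun this ⟨s₀, right_mem_Icc.2 hss⟩))

theorem IsBoxLift.eq_or_eq (hk : IsPuncturedCovering f U c V knasterPoint 2)
    (h₁ : IsBoxLift f U c M s₀ Q₁) (h₂ : IsBoxLift f U c M s₀ Q₂) {z : solenoid × ℝ} (hz : z ∈ halfBox M s₀)
    (hne : Q₁ z ≠ Q₂ z) {x : Knaster} (hx : x ∈ U \ {c}) (hfx : f x = fold (z.1 + flow z.2)) :
    x = Q₁ z ∨ x = Q₂ z := by
  have hv : fold (z.1 + flow z.2) ∈ V \ {knasterPoint} := hfx ▸ hk.mapsTo hx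
  obtain ⟨a, b, -, hab⟩ := encard_eq_two.1 (hk.encard_fiber _ hv)
  have m₀ : x ∈ (U \ {c}) ∩ f ⁻¹' {fold (z.1 + flow z.2)} := ⟨hx, hfx⟩
  have m₁ : Q₁ z ∈ (U \ {c}) ∩ f ⁻¹' {fold (z.1 + flow z.2)} := ⟨h₁.mem z hz, h₁.map_eq z hz⟩
  have m₂ : Q₂ z ∈ (U \ {c}) ∩ f ⁻¹' {fold (z.1 + flow z.2)} := ⟨h₂.mem z hz, h₂.map_eq z hz⟩
  rw [hab] at m₀ m₁ m₂
  grind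

/-- A lift of the two leaf segments through `ζ` and `-ζ` does not glue to an injective path: such a
path would turn around at `c`. -/
theorem IsBoxLift.neg_ne (hQ : IsBoxLift f U c M s₀ Q) (hs₀ : s₀ ∈ Ioo (0 : ℝ) 1) {W : Set Knaster}
    {φ : Knaster → ℝ} (hφ : Continuous φ) (hQW : ∀ z ∈ halfBox M s₀, Q z ∈ W)
    (hinj : ∀ C ⊆ W, IsPreconnected C → InjOn φ C) {ζ : solenoid} (hζ : ζ ∈ transversal M) (hζ0 : ζ ≠ 0)
    {α γ η : ℝ} (h0 : |φ (Q (ζ, 0)) - γ| < η) (h₁ : |φ (Q (ζ, s₀)) - α| < η)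
    (h₂ : |φ (Q (-ζ, s₀)) - α| < η) (h : 2 * η ≤ |α - γ|) : Q (-ζ, 0) ≠ Q (ζ, 0) := by
  intro heq
  have hmem : ∀ s ∈ Icc 0 s₀, (ζ, s) ∈ halfBox M s₀ := fun s hs => mk_mem_halfBox_of_ne hζ hζ0 hs
  have hmem' : ∀ s ∈ Icc 0 s₀, (-ζ, s) ∈ halfBox M s₀ := fun s hs =>
    mk_mem_halfBox_of_ne ((transversal M).neg_mem hζ) (neg_ne_zero.2 hζ0) hs
  have c₁ := hQ.continuousOn_slice hmem
  have c₂ := hQ.continuousOn_slice hmem'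
  have hz : (0 : ℝ) ∈ Icc 0 s₀ := left_mem_Icc.2 hs₀.1.le
  have hz' : s₀ ∈ Icc 0 s₀ := right_mem_Icc.2 hs₀.1.le
  set C := (fun s => Q (ζ, s)) '' Icc 0 s₀ ∪ (fun s => Q (-ζ, s)) '' Icc 0 s₀ with hC
  have hCp : IsPreconnected C := IsPreconnected.union (Q (ζ, 0)) ⟨0, hz, rfl⟩ ⟨0, hz, heq⟩
    (isPreconnected_Icc.image _ c₁) (isPreconnected_Icc.image _ c₂)
  have hCW : C ⊆ W := by
    rintro _ (⟨s, hs, rfl⟩ | ⟨s, hs, rfl⟩)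
    exacts [hQW _ (hmem s hs), hQW _ (hmem' s hs)]
  have hCi := hinj C hCW hCp
  -- Equal values of `φ` on the connected set `C` mean equal points. Downstairs the two segments
  -- form the leaf through `ζ` at times `s` and `-s'`, so they can only meet at time `0`, never when
  -- one time is `s₀`.
  have key : ∀ s ∈ Icc 0 s₀, ∀ s' ∈ Icc 0 s₀, (s = s₀ ∨ s' = s₀) → φ (Q (ζ, s)) ≠ φ (Q (-ζ, s')) := by
    intro s hs s' hs' hor hφs
    have h1 : Q (ζ, s) = Q (-ζ, s') := hCi (.inl ⟨s, hs, rfl⟩) (.inr ⟨s', hs', rfl⟩) hφs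
    have h2 : fold (ζ + flow s) = fold (-ζ + flow s') := by
      rw [← hQ.map_eq _ (hmem s hs), ← hQ.map_eq _ (hmem' s' hs'), h1]
    rcases fold_eq_iff.1 h2 with h3 | h3
    · have h4 := (transversal_add_flow_injective hζ ((transversal M).neg_mem hζ) (by
        rw [abs_lt]; constructor <;> linarith [hs.1, hs.2, hs'.1, hs'.2, hs₀.2]) h3).1
      exact hζ0 (solenoid_eq_zero_of_eq_neg h4)
    · have h4 : ζ + flow s = ζ + flow (-s') := by rw [h3, map_neg]; abel
      have h5 := (transversal_add_flow_injective hζ hζ (by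
        rw [abs_lt]; constructor <;> linarith [hs.1, hs.2, hs'.1, hs'.2, hs₀.2]) h4).2
      rcases hor with rfl | rfl <;> linarith [hs₀.1, hs.1, hs'.1]
  have hu : uIcc 0 s₀ = Icc 0 s₀ := uIcc_of_le hs₀.1.le
  rcases mem_uIcc_or_mem_uIcc h0 h₁ h₂ h with h4 | h4
  · rw [← heq] at h4
    obtain ⟨s, hs, hs'⟩ := intermediate_value_uIcc (f := fun s => φ (Q (-ζ, s)))
      (by rw [hu]; exact hφ.comp_continuousOn c₂) h4
    exact key s₀ hz' s (hu ▸ hs) (.inl rfl) hs'.symm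
  · obtain ⟨s, hs, hs'⟩ := intermediate_value_uIcc (f := fun s => φ (Q (ζ, s)))
      (by rw [hu]; exact hφ.comp_continuousOn c₁) h4
    exact key s (hu ▸ hs) s₀ hz' (.inr rfl) hs'

end BoxLift

/-- The degree at `c` is two, so the half-box has two lifts, started at the two points `a`, `b` over
`fold (flow s₀)`. The points `ζ` and `-ζ` have the same image, so `Q₁ (-ζ, 0)` is one of the two
lifts of `fold ζ`; `IsBoxLift.neg_ne` rules out `Q₁ (ζ, 0)`. -/
theorem exists_boxLift_pair {f : Knaster → Knaster} (hf : IsBranchedCovering f) {c : Knaster}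
    (hc : f c = knasterPoint) (hcp : c ≠ knasterPoint) {N : Set Knaster} (hN : N ∈ 𝓝 c) :
    ∃ (U : Set Knaster), ∃ s₀ ∈ Ioo (0 : ℝ) 1, ∃ (M : ℕ) (Q₁ Q₂ : solenoid × ℝ → Knaster),
      IsBoxLift f U c M s₀ Q₁ ∧ IsBoxLift f U c M s₀ Q₂ ∧
      (∀ z ∈ halfBox M s₀, Q₁ z ∈ N ∧ Q₂ z ∈ N ∧ Q₁ z ≠ Q₂ z) ∧
      ∀ ζ ∈ transversal M, ζ ≠ 0 → Q₁ (-ζ, 0) = Q₂ (ζ, 0) := by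
  have hdeg := hf.hasLocalDegree_localDegree c
  rw [localDegree_of_map_eq hf hc hcp] at hdeg
  obtain ⟨V, 𝒰, U, hV, hU, hcU, hk⟩ := hdeg
  have hx := eq_of_mem_sheet hV hU hcU rfl
  rw [hc] at hV hk hx
  obtain ⟨W, φ, hW, hcW, hφ, hinjc, hinj, -⟩ := exists_leaf_coordinate c
  replace hinj := hinj hcp
  have hsheet : ∃ V' ∈ 𝓝 knasterPoint, ∀ x ∈ U, f x ∈ V' → x ∈ W ∩ N := by
    have h1 : Tendsto id (comap f (𝓝 knasterPoint) ⊓ 𝓟 U) (𝓝 c) :=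
      hV.tendsto_sheet hf.1 hU hx (mem_inf_of_right (mem_principal_self U))
        (tendsto_comap.mono_left inf_le_left)
    have h2 := h1 (inter_mem (hW.mem_nhds hcW) hN)
    rw [mem_map, mem_inf_principal, mem_comap] at h2
    obtain ⟨V', hV', h3⟩ := h2
    exact ⟨V', hV', fun x hx hfx => h3 hfx hx⟩
  obtain ⟨V', hV', hWN⟩ := hsheet
  have hfold : fold ⁻¹' (V ∩ V') ∈ 𝓝 (0 : solenoid) :=
    continuous_fold.continuousAt.preimage_mem_nhds
      (by rw [fold_zero]; exact inter_mem (hV.isOpen.mem_nhds hV.mem) hV')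
  obtain ⟨s₀, hs₀, hM₀⟩ := exists_box_subset hfold
  obtain ⟨M₀, hM₀⟩ := hM₀.exists
  have hbox : ∀ ζ ∈ transversal M₀, ∀ s ∈ Icc 0 s₀, fold (ζ + flow s) ∈ V ∩ V' := fun ζ hζ s hs =>
    hM₀ ζ hζ s (by rw [abs_of_nonneg hs.1]; exact hs.2)
  have hx₀ : fold (flow s₀) ∈ V \ {knasterPoint} := by
    have h1 := hbox 0 (transversal M₀).zero_mem s₀ (right_mem_Icc.2 hs₀.1.le)
    have h2 := fold_ne_point_of_mem_halfBox hs₀.2.le (mk_mem_halfBox hs₀.1 (transversal M₀).zero_mem)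
    rw [zero_add] at h1
    simp only [zero_add] at h2
    exact ⟨h1.1, h2⟩
  obtain ⟨a, b, hab, hfib⟩ := encard_eq_two.1 (hk.encard_fiber _ hx₀)
  have ha : a ∈ (U \ {c}) ∩ f ⁻¹' {fold (flow s₀)} := by rw [hfib]; simp
  have hb : b ∈ (U \ {c}) ∩ f ⁻¹' {fold (flow s₀)} := by rw [hfib]; simp
  obtain ⟨M₁, hM₁, Q₁, hQ₁, hQ₁a⟩ := exists_boxLift hk hV.isOpen hs₀ (fun ζ hζ s hs => (hbox ζ hζ s hs).1) ha.1 ha.2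
  obtain ⟨M₂, hM₂, Q₂, hQ₂, hQ₂b⟩ := exists_boxLift hk hV.isOpen hs₀ (fun ζ hζ s hs => (hbox ζ hζ s hs).1) hb.1 hb.2
  set M₃ := max M₁ M₂ with hM₃
  have hM₀₃ : M₀ ≤ M₃ := hM₁.trans (le_max_left _ _)
  replace hQ₁ := hQ₁.mono (le_max_left M₁ M₂)
  replace hQ₂ := hQ₂.mono (le_max_right M₁ M₂)
  have hin : ∀ {Q}, IsBoxLift f U c M₃ s₀ Q → ∀ z ∈ halfBox M₃ s₀, Q z ∈ W ∩ N := fun hQ z hz =>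
    hWN _ (hQ.mem z hz).1 (by
      rw [hQ.map_eq z hz]
      exact (hbox _ (transversal_antitone hM₀₃ hz.1) _ hz.2.1).2)
  -- The lift over `ζ = 0` is a path from `a` that tends to `c`. Adding `c` keeps it connected, so
  -- `φ` separates its two ends.
  have hac : φ a ≠ φ c := by
    have hmem : ∀ s ∈ Ioc 0 s₀, ((0 : solenoid), s) ∈ halfBox M₃ s₀ := fun s hs =>
      ⟨(transversal M₃).zero_mem, ⟨hs.1.le, hs.2⟩, fun h => hs.1.ne' (congrArg Prod.snd h)⟩
    have hpre : IsPreconnected ((fun s => Q₁ (0, s)) '' Ioc 0 s₀) :=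
      isPreconnected_Ioc.image _ (hQ₁.continuousOn_slice hmem)
    have hev : ∀ᶠ s in 𝓝[>] (0 : ℝ), s ∈ Ioc 0 s₀ := Ioc_mem_nhdsGT hs₀.1
    have hlim : Tendsto (fun s => Q₁ (0, s)) (𝓝[>] 0) (𝓝 c) := by
      refine hV.tendsto_sheet hf.1 hU hx (hev.mono fun s hs => (hQ₁.mem _ (hmem s hs)).1) ?_
      have h1 : Tendsto (fun s => fold (0 + flow s)) (𝓝[>] 0) (𝓝 knasterPoint) := by
        have : Continuous fun s => fold (0 + flow s) := continuous_fold.comp (continuous_const.add continuous_flow)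
        have h := (this.tendsto 0).mono_left (nhdsWithin_le_nhds (s := Ioi 0))
        simpa [fold_zero] using h
      exact h1.congr' (hev.mono fun s hs => (hQ₁.map_eq _ (hmem s hs)).symm)
    have hcl : c ∈ closure ((fun s => Q₁ (0, s)) '' Ioc 0 s₀) :=
      mem_closure_of_tendsto hlim (hev.mono fun s hs => mem_image_of_mem _ hs)
    have hpre' := hpre.subset_closure (subset_insert c _) (insert_subset hcl subset_closure)
    refine fun h => ha.1.2 (hinj _ ?_ hpre' (.inr ⟨s₀, right_mem_Ioc.2 hs₀.1, hQ₁a⟩) (mem_insert _ _) h)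
    rintro _ (rfl | ⟨s, hs, rfl⟩)
    exacts [hcW, (hin hQ₁ _ (hmem s hs)).1]
  set η := |φ a - φ c| / 2 with hη
  have hη0 : 0 < η := half_pos (abs_pos.2 (sub_ne_zero.2 hac))
  have hend : ∀ {Q}, IsBoxLift f U c M₃ s₀ Q →
      Tendsto (fun ζ => Q (ζ, s₀)) (𝓝[transversal M₃] 0) (𝓝 (Q (0, s₀))) := fun hQ => by
    have := hQ.continuousOn.comp (f := fun ζ => (ζ, s₀)) (s := (transversal M₃ : Set solenoid))
      (continuousOn_id.prodMk continuousOn_const) fun ζ hζ => mk_mem_halfBox hs₀.1 hζ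
    exact this 0 (transversal M₃).zero_mem
  have hmid : Tendsto (fun ζ => Q₁ (ζ, 0)) (𝓝[transversal M₃ \ {0}] 0) (𝓝 c) := by
    have hz : (0 : ℝ) ∈ Icc 0 s₀ := left_mem_Icc.2 hs₀.1.le
    refine hV.tendsto_sheet hf.1 hU hx ?_ ?_
    · filter_upwards [self_mem_nhdsWithin] with ζ hζ
      exact (hQ₁.mem _ (mk_mem_halfBox_of_ne hζ.1 hζ.2 hz)).1
    · have h1 : Tendsto (fun ζ : solenoid => fold (ζ + flow 0)) (𝓝[transversal M₃ \ {0}] 0) (𝓝 knasterPoint) := by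
        have : Continuous fun ζ : solenoid => fold (ζ + flow 0) :=
          continuous_fold.comp (continuous_id.add continuous_const)
        have h := (this.tendsto 0).mono_left (nhdsWithin_le_nhds (s := (transversal M₃ : Set solenoid) \ {0}))
        simpa [fold_zero] using h
      refine h1.congr' ?_
      filter_upwards [self_mem_nhdsWithin] with ζ hζ
      exact (hQ₁.map_eq _ (mk_mem_halfBox_of_ne hζ.1 hζ.2 hz)).symm
  have e₁ : ∀ᶠ ζ in 𝓝 (0 : solenoid), ζ ∈ transversal M₃ → Q₁ (ζ, s₀) ≠ Q₂ (ζ, s₀) :=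
    eventually_nhdsWithin_iff.1 (((hend hQ₁).prodMk_nhds (hend hQ₂)).eventually
      ((isOpen_ne_fun continuous_fst continuous_snd).mem_nhds (by change _ ≠ _; rwa [hQ₁a, hQ₂b])))
  have e₂ : ∀ᶠ ζ in 𝓝 (0 : solenoid), ζ ∈ transversal M₃ → |φ (Q₁ (ζ, s₀)) - φ a| < η := by
    have := (hφ.tendsto _).comp (hend hQ₁)
    rw [hQ₁a] at this
    exact eventually_nhdsWithin_iff.1 (this.eventually (Metric.ball_mem_nhds _ hη0))
  have e₃ : ∀ᶠ ζ in 𝓝 (0 : solenoid), ζ ∈ (transversal M₃ : Set solenoid) \ {0} → |φ (Q₁ (ζ, 0)) - φ c| < η :=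
    eventually_nhdsWithin_iff.1 (((hφ.tendsto _).comp hmid).eventually (Metric.ball_mem_nhds _ hη0))
  obtain ⟨M, hM, hMM⟩ := ((eventually_transversal (e₁.and (e₂.and e₃))).and (eventually_ge_atTop M₃)).exists
  have hsub : ∀ ζ ∈ transversal M, ζ ∈ transversal M₃ := fun ζ hζ => transversal_antitone hMM hζ
  have hne : ∀ z ∈ halfBox M s₀, Q₁ z ≠ Q₂ z := fun z hz =>
    hQ₁.ne_of_ne hk hQ₂ ((hM _ hz.1).1 (hsub _ hz.1)) (halfBox_mono hMM s₀ hz)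
  refine ⟨U, s₀, hs₀, M, Q₁, Q₂, hQ₁.mono hMM, hQ₂.mono hMM, fun z hz => ?_, fun ζ hζ hζ0 => ?_⟩
  · exact ⟨(hin hQ₁ z (halfBox_mono hMM s₀ hz)).2, (hin hQ₂ z (halfBox_mono hMM s₀ hz)).2, hne z hz⟩
  · have hz : (0 : ℝ) ∈ Icc 0 s₀ := left_mem_Icc.2 hs₀.1.le
    have hζ' := (transversal M).neg_mem hζ
    have m₁ : (ζ, 0) ∈ halfBox M s₀ := mk_mem_halfBox_of_ne hζ hζ0 hz
    have m₂ : (-ζ, 0) ∈ halfBox M s₀ := mk_mem_halfBox_of_ne hζ' (neg_ne_zero.2 hζ0) hz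
    have h1 : Q₁ (-ζ, 0) ≠ Q₁ (ζ, 0) := by
      refine (hQ₁.mono hMM).neg_ne hs₀ hφ (fun z hz => (hin hQ₁ z (halfBox_mono hMM s₀ hz)).1) hinj hζ hζ0
        (α := φ a) (γ := φ c) (η := η) ((hM ζ hζ).2.2 ⟨hsub ζ hζ, hζ0⟩) ((hM ζ hζ).2.1 (hsub ζ hζ))
        ((hM _ hζ').2.1 (hsub _ hζ')) (by rw [hη]; linarith)
    refine ((hQ₁.mono hMM).eq_or_eq hk (hQ₂.mono hMM) m₁ (hne _ m₁) ((hQ₁.mono hMM).mem _ m₂) ?_).resolve_left h1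
    rw [(hQ₁.mono hMM).map_eq _ m₂, ← fold_neg]
    congr 1
    simp


/-! ### An odd root on a half-box -/

theorem exists_ne_zero_mem_transversal (M : ℕ) : ∃ ζ ∈ transversal M, ζ ≠ 0 := by
  refine ⟨flow (2 * 2 ^ M), ?_, fun h => ?_⟩
  · rw [mem_transversal, flow_apply, mul_div_cancel_right₀ _ (by positivity)]
    exact AddCircle.coe_period 2
  · rw [← map_zero flow] at h
    exact absurd (flow_injective h) (by positivity)

theorem eventually_eq_of_finite_range {α : Type*} {l : Filter α} {u : α → ℂ} {w : ℂ} {S : Set ℂ} (hS : S.Finite)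
    (hu : Tendsto u l (𝓝 w)) (h : ∀ᶠ a in l, u a ∈ S) : ∀ᶠ a in l, u a = w := by
  have h1 : (S \ {w})ᶜ ∈ 𝓝 w := (hS.sdiff).isClosed.isOpen_compl.mem_nhds fun h => h.2 rfl
  filter_upwards [h, hu h1] with a ha ha'
  by_contra hne
  exact ha' ⟨ha, hne⟩

theorem finite_setOf_pow_eq_one {m : ℕ} (hm : 1 ≤ m) : {w : ℂ | w ^ m = 1}.Finite := by
  have : {w : ℂ | w ^ m = 1} = ((Polynomial.nthRoots m (1 : ℂ)).toFinset : Set ℂ) := by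
    ext w
    simp [Polynomial.mem_nthRoots (show 0 < m from hm)]
  rw [this]
  exact Finset.finite_toSet _

/-- Along the two lifts `ψ` gives two `m`-th roots of the same function, and their ratio `ω` is a
root of unity other than `1`. It is constant along flow lines, and along the far face near `ζ = 0`.
The exchange of the lifts under negation gives `ω (-ζ, 0) * ω (ζ, 0) = 1`, so the common value is
`-1`. -/
theorem exists_odd_root_halfBox {f : Knaster → Knaster} (hf : IsBranchedCovering f) {c : Knaster}
    (hc : f c = knasterPoint) (hcp : c ≠ knasterPoint) {g : Knaster → ℂ} (hg : Function.Injective g)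
    (hg0 : g knasterPoint = 0) {N : Set Knaster} (hN : N ∈ 𝓝 c) {ψ : Knaster → ℂ} {m : ℕ} (hm : 1 ≤ m)
    (hψ : ContinuousOn ψ (N \ {c})) (hψi : InjOn ψ (N \ {c})) (hψm : ∀ x ∈ N \ {c}, ψ x ^ m = g (f x)) :
    Even m ∧ ∃ s₀ ∈ Ioo (0 : ℝ) 1, ∃ M ≥ 1, ∃ q : solenoid × ℝ → ℂ, ContinuousOn q (halfBox M s₀) ∧
      (∀ z ∈ halfBox M s₀, q z ^ m = g (fold (z.1 + flow z.2))) ∧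
      (∀ ζ ∈ transversal M, ζ ≠ 0 → q (-ζ, 0) = -q (ζ, 0)) ∧
      ∀ ζ ∈ transversal M, ‖q (ζ, s₀) - q (0, s₀)‖ < ‖q (0, s₀)‖ := by
  obtain ⟨U, s₀, hs₀, M₁, Q₁, Q₂, hQ₁, hQ₂, hQ, hneg⟩ := exists_boxLift_pair hf hc hcp hN
  have hmap₁ : MapsTo Q₁ (halfBox M₁ s₀) (N \ {c}) := fun z hz => ⟨(hQ z hz).1, (hQ₁.mem z hz).2⟩
  have hmap₂ : MapsTo Q₂ (halfBox M₁ s₀) (N \ {c}) := fun z hz => ⟨(hQ z hz).2.1, (hQ₂.mem z hz).2⟩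
  set q₁ := fun z => ψ (Q₁ z) with hq₁
  set q₂ := fun z => ψ (Q₂ z) with hq₂
  have hc₁ : ContinuousOn q₁ (halfBox M₁ s₀) := hψ.comp hQ₁.continuousOn hmap₁
  have hc₂ : ContinuousOn q₂ (halfBox M₁ s₀) := hψ.comp hQ₂.continuousOn hmap₂
  have hp₁ : ∀ z ∈ halfBox M₁ s₀, q₁ z ^ m = g (fold (z.1 + flow z.2)) := fun z hz => by
    rw [hq₁, hψm _ (hmap₁ hz), hQ₁.map_eq z hz]
  have hp₂ : ∀ z ∈ halfBox M₁ s₀, q₂ z ^ m = g (fold (z.1 + flow z.2)) := fun z hz => by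
    rw [hq₂, hψm _ (hmap₂ hz), hQ₂.map_eq z hz]
  have hgne : ∀ z ∈ halfBox M₁ s₀, g (fold (z.1 + flow z.2)) ≠ 0 := fun z hz h =>
    fold_ne_point_of_mem_halfBox hs₀.2.le hz (hg (h.trans hg0.symm))
  have hm0 : m ≠ 0 := by lia
  have hne₁ : ∀ z ∈ halfBox M₁ s₀, q₁ z ≠ 0 := fun z hz h => hgne z hz (by rw [← hp₁ z hz, h, zero_pow hm0])
  set ω := fun z => q₂ z / q₁ z with hω
  have hωc : ContinuousOn ω (halfBox M₁ s₀) := hc₂.div hc₁ hne₁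
  have hωm : ∀ z ∈ halfBox M₁ s₀, ω z ∈ {w : ℂ | w ^ m = 1} := fun z hz => by
    rw [mem_ofPred_eq, hω, div_pow, hp₁ z hz, hp₂ z hz, div_self (hgne z hz)]
  have hω1 : ∀ z ∈ halfBox M₁ s₀, ω z ≠ 1 := fun z hz h => by
    have h1 : q₂ z = q₁ z := (div_eq_one_iff_eq (hne₁ z hz)).1 h
    exact (hQ z hz).2.2 (hψi (hmap₁ hz) (hmap₂ hz) h1.symm)
  have hfin := finite_setOf_pow_eq_one hm
  have hconst : ∀ ζ, ∀ I : Set ℝ, IsPreconnected I → (∀ s ∈ I, (ζ, s) ∈ halfBox M₁ s₀) → ∀ s ∈ I, ∀ t ∈ I,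
      ω (ζ, s) = ω (ζ, t) := fun ζ I hI hmem s hs t ht => by
    exact hI.constant_of_mapsTo (T := {w : ℂ | w ^ m = 1}) (f := fun s => ω (ζ, s)) hfin.isDiscrete
      (hωc.comp (continuousOn_const.prodMk continuousOn_id) hmem) (fun s hs => hωm _ (hmem s hs)) hs ht
  have hslice : ∀ {u : solenoid × ℝ → ℂ}, ContinuousOn u (halfBox M₁ s₀) →
      Tendsto (fun ζ => u (ζ, s₀)) (𝓝[transversal M₁] 0) (𝓝 (u (0, s₀))) := fun hu => by
    have := hu.comp (f := fun ζ => (ζ, s₀)) (s := (transversal M₁ : Set solenoid))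
      (continuousOn_id.prodMk continuousOn_const) fun ζ hζ => mk_mem_halfBox hs₀.1 hζ
    exact this 0 (transversal M₁).zero_mem
  have hz₀ : ((0 : solenoid), s₀) ∈ halfBox M₁ s₀ := mk_mem_halfBox hs₀.1 (transversal M₁).zero_mem
  have e₁ : ∀ᶠ ζ in 𝓝 (0 : solenoid), ζ ∈ transversal M₁ → ω (ζ, s₀) = ω (0, s₀) :=
    eventually_nhdsWithin_iff.1 (eventually_eq_of_finite_range hfin (hslice hωc) (by
      filter_upwards [self_mem_nhdsWithin] with ζ hζ using hωm _ (mk_mem_halfBox hs₀.1 hζ)))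
  have e₂ : ∀ᶠ ζ in 𝓝 (0 : solenoid), ζ ∈ transversal M₁ → ‖q₁ (ζ, s₀) - q₁ (0, s₀)‖ < ‖q₁ (0, s₀)‖ := by
    have := (hslice hc₁).eventually (Metric.ball_mem_nhds _ (norm_pos_iff.2 (hne₁ _ hz₀)))
    simp only [dist_eq_norm] at this
    exact eventually_nhdsWithin_iff.1 this
  obtain ⟨M, ⟨hM, hM1⟩, hMM⟩ := (((eventually_transversal (e₁.and e₂)).and (eventually_ge_atTop 1)).and
    (eventually_ge_atTop M₁)).exists
  have hsub : ∀ ζ ∈ transversal M, ζ ∈ transversal M₁ := fun ζ hζ => transversal_antitone hMM hζ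
  have hI : (0 : ℝ) ∈ Icc 0 s₀ := left_mem_Icc.2 hs₀.1.le
  have hωζ : ∀ ζ ∈ transversal M, ζ ≠ 0 → ω (ζ, 0) = ω (0, s₀) := fun ζ hζ hζ0 => by
    rw [← (hM ζ hζ).1 (hsub ζ hζ)]
    exact hconst ζ (Icc 0 s₀) isPreconnected_Icc (fun s hs => mk_mem_halfBox_of_ne (hsub ζ hζ) hζ0 hs) _ hI _
      (right_mem_Icc.2 hs₀.1.le)
  have hωneg : ∀ ζ ∈ transversal M, ζ ≠ 0 → ω (-ζ, 0) * ω (ζ, 0) = 1 := fun ζ hζ hζ0 => by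
    have hζ' := (transversal M).neg_mem hζ
    have h1 := hneg ζ (hsub ζ hζ) hζ0
    have h2 := hneg (-ζ) (hsub _ hζ') (neg_ne_zero.2 hζ0)
    rw [neg_neg] at h2
    have n₁ := hne₁ (ζ, 0) (mk_mem_halfBox_of_ne (hsub ζ hζ) hζ0 hI)
    have n₂ := hne₁ (-ζ, 0) (mk_mem_halfBox_of_ne (hsub _ hζ') (neg_ne_zero.2 hζ0) hI)
    simp only [hω, hq₁, hq₂] at n₁ n₂ ⊢
    rw [← h1, ← h2]
    field_simp
  have hω0 : ω (0, s₀) = -1 := by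
    obtain ⟨ζ, hζ, hζ0⟩ := exists_ne_zero_mem_transversal M
    have h1 := hωneg ζ hζ hζ0
    rw [hωζ ζ hζ hζ0, hωζ _ ((transversal M).neg_mem hζ) (neg_ne_zero.2 hζ0)] at h1
    exact (mul_self_eq_one_iff.1 h1).resolve_left (hω1 _ hz₀)
  refine ⟨?_, s₀, hs₀, M, hM1, q₁, hc₁.mono (halfBox_mono hMM s₀), fun z hz => hp₁ z (halfBox_mono hMM s₀ hz),
    fun ζ hζ hζ0 => ?_, fun ζ hζ => (hM ζ hζ).2 (hsub ζ hζ)⟩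
  · have h1 : ω (0, s₀) ^ m = 1 := hωm _ hz₀
    rw [hω0] at h1
    exact (neg_one_pow_eq_one_iff_even (by norm_num)).1 h1
  · have h1 : ω (ζ, 0) = -1 := (hωζ ζ hζ hζ0).trans hω0
    have n₁ := hne₁ (ζ, 0) (mk_mem_halfBox_of_ne (hsub ζ hζ) hζ0 hI)
    simp only [hω, hq₁, hq₂] at h1 n₁ ⊢
    rw [div_eq_iff n₁] at h1
    rw [hneg ζ (hsub ζ hζ) hζ0, h1]
    ring


/-! ### Even logarithms and odd extensions on the solenoid -/

theorem mem_slitPlane_of_norm_sub_lt {z : ℂ} (h : ‖z - 1‖ < 1) : z ∈ Complex.slitPlane :=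
  Complex.ball_one_subset_slitPlane (by rwa [Metric.mem_ball, dist_eq_norm])

/-- For large `n` the function `κ` hardly varies along `transversal n`. Up to sign, `θ` differs by
such an element from `α θ`, a point of the leaf of `0` given by `‖θ.1 n‖`. A logarithm along that
leaf, evaluated at `‖θ.1 n‖`, plus a principal logarithm of `κ θ / κ (α θ)` is even by construction.
-/
theorem exists_even_log {κ : solenoid → ℂ} (hκ : Continuous κ) (h0 : ∀ θ, κ θ ≠ 0) (heven : ∀ θ, κ (-θ) = κ θ) :
    ∃ H : solenoid → ℂ, Continuous H ∧ (∀ θ, H (-θ) = H θ) ∧ ∀ θ, Complex.exp (H θ) = κ θ := by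
  have h1 : ∀ᶠ ζ in 𝓝 (0 : solenoid), ∀ θ ∈ (univ : Set solenoid), ‖κ (θ + ζ) - κ θ‖ < ‖κ θ‖ := by
    refine isCompact_univ.eventually_forall_of_forall_eventually fun θ _ => ?_
    have hc : Continuous fun w : solenoid × solenoid => ‖κ (w.2 + w.1) - κ w.2‖ := by fun_prop
    refine hc.continuousAt.eventually_lt (g := fun w : solenoid × solenoid => ‖κ w.2‖) (by fun_prop) ?_
    simpa using h0 θ
  obtain ⟨n, hn⟩ := (eventually_transversal h1).exists
  let α : solenoid → solenoid := fun θ => flow (2 ^ n * ‖θ.1 n‖)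
  have hα : Continuous α := continuous_flow.comp (continuous_const.mul (continuous_coord n).norm)
  have hαn : ∀ θ, (α θ).1 n = (‖θ.1 n‖ : ℝ) := fun θ => by
    simp only [α]
    rw [flow_apply, mul_div_cancel_left₀ _ (by positivity)]
  have hclose : ∀ θ, ‖κ θ / κ (α θ) - 1‖ < 1 := fun θ => by
    have key : ‖κ θ - κ (α θ)‖ < ‖κ (α θ)‖ := by
      have hnorm : ‖(α θ).1 n‖ = ‖θ.1 n‖ := by
        rw [hαn, norm_coe_of_abs_le (by rw [abs_norm]; exact circle_norm_le_one _), abs_norm]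
      rcases eq_or_eq_neg_of_norm_eq hnorm with h | h
      · have := hn (θ - α θ) (by
          change θ.1 n - (α θ).1 n = 0
          rw [h, sub_self]) (α θ) (mem_univ _)
        rwa [add_sub_cancel] at this
      · have := hn (-θ - α θ) (by
          change -θ.1 n - (α θ).1 n = 0
          rw [h, sub_self]) (α θ) (mem_univ _)
        rwa [add_sub_cancel, heven] at this
    rw [div_sub_one (h0 _), norm_div]
    exact (div_lt_one (norm_pos_iff.2 (h0 _))).2 key
  obtain ⟨l, hl, hl'⟩ := exists_continuous_log (f := fun r : ℝ => κ (flow (2 ^ n * r)))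
    (hκ.comp (continuous_flow.comp (by fun_prop))) fun _ => h0 _
  refine ⟨fun θ => l ‖θ.1 n‖ + Complex.log (κ θ / κ (α θ)), ?_, fun θ => ?_, fun θ => ?_⟩
  · refine (hl.comp (continuous_coord n).norm).add ?_
    exact (hκ.div (hκ.comp hα) fun _ => h0 _).clog fun θ => mem_slitPlane_of_norm_sub_lt (hclose θ)
  · have h2 : ‖(-θ).1 n‖ = ‖θ.1 n‖ := norm_neg _
    have h3 : α (-θ) = α θ := by simp only [α]; rw [h2]
    simp only [h2, h3, heven]
  · rw [Complex.exp_add, hl', Complex.exp_log (div_ne_zero (h0 _) (h0 _))]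
    exact mul_div_cancel₀ _ (h0 (α θ))

theorem exists_odd_extension {D : Set solenoid} (hD : IsClosed D) (hcov : ∀ θ, θ ∈ D ∨ -θ ∈ D) {F : solenoid → ℂ}
    (hF : ContinuousOn F (D \ {0})) (hodd : ∀ θ ∈ D, -θ ∈ D → θ ≠ 0 → F (-θ) = -F θ) :
    ∃ G : solenoid → ℂ, ContinuousOn G {0}ᶜ ∧ (∀ θ ≠ 0, G (-θ) = -G θ) ∧ ∀ θ ∈ D, θ ≠ 0 → G θ = F θ := by
  classical
  let G : solenoid → ℂ := fun θ => if θ ∈ D then F θ else -F (-θ)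
  have hGD : ∀ θ ∈ D, G θ = F θ := fun θ h => if_pos h
  have hGD' : ∀ θ, -θ ∈ D → θ ≠ 0 → G θ = -F (-θ) := fun θ h h0 => by
    by_cases hθ : θ ∈ D
    · rw [hGD θ hθ, hodd θ hθ h h0, neg_neg]
    · exact if_neg hθ
  refine ⟨G, ?_, fun θ h0 => ?_, fun θ h _ => hGD θ h⟩
  · intro θ hθ
    have hopen : IsOpen ({0}ᶜ : Set solenoid) := isOpen_compl_singleton
    have h1 : ContinuousWithinAt G (D ∩ {0}ᶜ) θ := by
      by_cases h : θ ∈ D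
      · exact (hF θ ⟨h, hθ⟩).congr (fun y hy => hGD y hy.1) (hGD θ h)
      · exact continuousWithinAt_of_notMem_closure fun h' => h (hD.closure_subset (closure_mono inter_subset_left h'))
    have h2 : ContinuousWithinAt G (-D ∩ {0}ᶜ) θ := by
      by_cases h : -θ ∈ D
      · have h3 : ContinuousWithinAt (fun y => -F (-y)) (-D ∩ {0}ᶜ) θ :=
          ((hF (-θ) ⟨h, neg_ne_zero.2 hθ⟩).comp continuous_neg.continuousWithinAt
            fun y hy => ⟨hy.1, neg_ne_zero.2 hy.2⟩).neg
        exact h3.congr (fun y hy => hGD' y hy.1 hy.2) (hGD' θ h hθ)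
      · exact continuousWithinAt_of_notMem_closure fun h' =>
          h (hD.neg.closure_subset (closure_mono inter_subset_left h'))
    refine (h1.union h2).mono fun y hy => ?_
    rcases hcov y with h | h
    exacts [.inl ⟨h, hy⟩, .inr ⟨h, hy⟩]
  · by_cases h : θ ∈ D
    · rw [hGD θ h, hGD' (-θ) (by rwa [neg_neg]) (neg_ne_zero.2 h0), neg_neg]
    · have h' := (hcov θ).resolve_left h
      rw [hGD _ h', hGD' θ h' h0, neg_neg]

/-- The half of the solenoid on which the coordinate `M` lies in the upper half of the circle. -/
def upperHalf (M : ℕ) : Set solenoid := {θ | θ.1 M = (‖θ.1 M‖ : ℝ)}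

theorem isClosed_upperHalf (M : ℕ) : IsClosed (upperHalf M) :=
  isClosed_eq (continuous_coord M) ((AddCircle.continuous_mk' (2 : ℝ)).comp (continuous_coord M).norm)

theorem mem_upperHalf_or_neg_mem (M : ℕ) (θ : solenoid) : θ ∈ upperHalf M ∨ -θ ∈ upperHalf M := by
  have h1 : ‖θ.1 M‖ = ‖((‖θ.1 M‖ : ℝ) : AddCircle (2 : ℝ))‖ := by
    rw [norm_coe_of_abs_le (by rw [abs_norm]; exact circle_norm_le_one _), abs_norm]
  rcases eq_or_eq_neg_of_norm_eq h1 with h | h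
  · exact .inl h
  · refine .inr ?_
    change -θ.1 M = (‖-θ.1 M‖ : ℝ)
    rw [norm_neg, ← neg_eq_iff_eq_neg.2 h]

/-- Coordinate `M` equals its own negative. These are the two faces where an odd extension from the
half must satisfy a condition. -/
theorem norm_eq_zero_or_one_of_mem_upperHalf {M : ℕ} {θ : solenoid} (h : θ ∈ upperHalf M)
    (h' : -θ ∈ upperHalf M) : ‖θ.1 M‖ = 0 ∨ ‖θ.1 M‖ = 1 := by
  have h1 : -θ.1 M = (‖-θ.1 M‖ : ℝ) := h'
  have h2 : θ.1 M = (‖θ.1 M‖ : ℝ) := h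
  rw [norm_neg] at h1
  have h3 : ((‖θ.1 M‖ + ‖θ.1 M‖ : ℝ) : AddCircle (2 : ℝ)) = 0 := by
    rw [AddCircle.coe_add]
    nth_rewrite 1 [← h2]
    rw [← h1, add_neg_cancel]
  obtain ⟨n, hn⟩ := (AddCircle.coe_eq_zero_iff (2 : ℝ)).1 h3
  rw [zsmul_eq_mul] at hn
  have h4 : (n : ℝ) = ‖θ.1 M‖ := by linarith
  have h5 := circle_norm_le_one (θ.1 M)
  have h6 := norm_nonneg (θ.1 M)
  rw [← h4] at h5 h6 ⊢
  have h7 : n ≤ 1 := by exact_mod_cast h5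
  have h8 : 0 ≤ n := by exact_mod_cast h6
  interval_cases n <;> simp

/-- An odd real function on the circle `ℝ / 2ℤ`, nonzero at `± 1 / 2`. -/
noncomputable def oddCoord (x : AddCircle (2 : ℝ)) : ℝ :=
  ‖x + ((1 / 2 : ℝ) : AddCircle (2 : ℝ))‖ - ‖x - ((1 / 2 : ℝ) : AddCircle (2 : ℝ))‖

theorem continuous_oddCoord : Continuous oddCoord := by
  unfold oddCoord
  fun_prop

theorem oddCoord_neg (x : AddCircle (2 : ℝ)) : oddCoord (-x) = -oddCoord x := by
  rw [oddCoord, oddCoord, ← norm_neg (-x + _), ← norm_neg (-x - _)]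
  simp only [neg_add, neg_sub, neg_neg]
  rw [sub_neg_eq_add, add_comm _ x, ← sub_eq_add_neg]

theorem oddCoord_ne_zero {x : AddCircle (2 : ℝ)} (hx : ‖x + x‖ = 1) : oddCoord x ≠ 0 := by
  intro h
  rcases eq_or_eq_neg_of_norm_eq (sub_eq_zero.1 h) with h | h
  · have h1 : ((1 : ℝ) : AddCircle (2 : ℝ)) = 0 := by
      rw [show (1 : ℝ) = 1 / 2 + 1 / 2 by norm_num, AddCircle.coe_add]
      rw [sub_eq_add_neg, add_right_inj] at h
      nth_rewrite 1 [h]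
      rw [neg_add_cancel]
    have h2 := norm_coe_of_abs_le (t := 1) (by simp)
    rw [h1] at h2
    simp at h2
  · have h1 : x + x = 0 := by
      rw [neg_sub, sub_eq_add_neg, add_comm x, add_right_inj] at h
      nth_rewrite 1 [h]
      rw [neg_add_cancel]
    rw [h1] at hx
    simp at hx


/-! ### Extending a local odd root over the solenoid -/

/-- The half is swept out by `θ = ζ + flow s` with `s = 2 ^ M * ‖θ.1 M‖`. The factor `L` follows `q`
up to `s₀` and is then interpolated to the constant `q (0, s₀)`, without zeros by `hclose`. The
factor `B` is `1` near the face `‖θ.1 M‖ = 0`, where `q` is odd already, and becomes odd on the face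
`‖θ.1 M‖ = 1`. -/
theorem exists_upperHalf_extension {s₀ : ℝ} (hs₀ : s₀ ∈ Ioo (0 : ℝ) 1) {M : ℕ} (hM : 1 ≤ M)
    {q : solenoid × ℝ → ℂ} (hq : ContinuousOn q (halfBox M s₀)) (hq0 : ∀ z ∈ halfBox M s₀, q z ≠ 0)
    (hodd : ∀ ζ ∈ transversal M, ζ ≠ 0 → q (-ζ, 0) = -q (ζ, 0))
    (hclose : ∀ ζ ∈ transversal M, ‖q (ζ, s₀) - q (0, s₀)‖ < ‖q (0, s₀)‖) :
    ∃ F : solenoid → ℂ, ContinuousOn F (upperHalf M \ {0}) ∧ (∀ θ ∈ upperHalf M, θ ≠ 0 → F θ ≠ 0) ∧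
      (∀ θ ∈ upperHalf M, -θ ∈ upperHalf M → θ ≠ 0 → F (-θ) = -F θ) ∧
      ∀ θ ∈ upperHalf M, θ ≠ 0 → ‖θ.1 M‖ < 1 / 2 → 2 ^ M * ‖θ.1 M‖ ≤ s₀ →
        ∃ z ∈ halfBox M s₀, z.1 + flow z.2 = θ ∧ F θ = q z := by
  let s : solenoid → ℝ := fun θ => 2 ^ M * ‖θ.1 M‖
  have hs : Continuous s := continuous_const.mul (continuous_coord M).norm
  have hs_nonneg : ∀ θ, 0 ≤ s θ := fun θ => by positivity
  have hs_neg : ∀ θ, s (-θ) = s θ := fun θ => congrArg (2 ^ M * ·) (norm_neg (θ.1 M))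
  let ζ : solenoid → solenoid := fun θ => θ - flow (s θ)
  have hζ : Continuous ζ := continuous_id.sub (continuous_flow.comp hs)
  have hζT : ∀ θ ∈ upperHalf M, ζ θ ∈ transversal M := fun θ hθ => by
    change θ.1 M - (flow (s θ)).1 M = 0
    rw [flow_apply, mul_div_cancel_left₀ _ (by positivity), ← hθ, sub_self]
  have hadd : ∀ θ, ζ θ + flow (s θ) = θ := fun θ => sub_add_cancel _ _
  have hbox : ∀ θ ∈ upperHalf M, θ ≠ 0 → (ζ θ, min (s θ) s₀) ∈ halfBox M s₀ := fun θ hθ h0 => by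
    refine ⟨hζT θ hθ, ⟨le_min (hs_nonneg θ) hs₀.1.le, min_le_right _ _⟩, fun h => h0 ?_⟩
    have h1 : ζ θ = 0 := congrArg Prod.fst h
    have h2 : min (s θ) s₀ = 0 := congrArg Prod.snd h
    have h3 : s θ = 0 := by
      rcases min_choice (s θ) s₀ with h3 | h3
      · rwa [h3] at h2
      · exact absurd (h3 ▸ h2) hs₀.1.ne'
    rw [← hadd θ, h1, h3, map_zero, add_zero]
  let χ : solenoid → ℝ := fun θ => max 0 (min 1 (s θ - s₀))
  have hχ : Continuous χ := continuous_const.max (continuous_const.min (hs.sub continuous_const))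
  let L : solenoid → ℂ := fun θ => (1 - χ θ : ℝ) * q (ζ θ, min (s θ) s₀) + (χ θ : ℝ) * q (0, s₀)
  let b : solenoid → ℝ := fun θ => max 0 (2 * ‖θ.1 M‖ - 1)
  have hb : Continuous b :=
    continuous_const.max ((continuous_const.mul (continuous_coord M).norm).sub continuous_const)
  have hb_neg : ∀ θ, b (-θ) = b θ := fun θ => congrArg (fun r : ℝ => max 0 (2 * r - 1)) (norm_neg (θ.1 M))
  -- The real part vanishes only when `b θ = 1`, that is on the far face, where `oddCoord` of the
  -- next coordinate is nonzero.
  let B : solenoid → ℂ := fun θ => (1 - b θ : ℝ) + (b θ * oddCoord (θ.1 (M + 1)) : ℝ) * Complex.I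
  have hB : Continuous B := by
    have h1 : Continuous fun θ : solenoid => oddCoord (θ.1 (M + 1)) := continuous_oddCoord.comp (continuous_coord _)
    have h2 : Continuous fun θ => ((1 - b θ : ℝ) : ℂ) := Complex.continuous_ofReal.comp (continuous_const.sub hb)
    exact h2.add ((Complex.continuous_ofReal.comp (hb.mul h1)).mul continuous_const)
  have hB0 : ∀ θ, B θ ≠ 0 := fun θ h => by
    have hre := congrArg Complex.re h
    have him := congrArg Complex.im h
    simp [B] at hre him
    have h1 : b θ = 1 := by linarith
    have h2 : ‖θ.1 M‖ = 1 := by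
      have h3 : max 0 (2 * ‖θ.1 M‖ - 1) = 1 := h1
      have h4 := circle_norm_le_one (θ.1 M)
      rcases max_choice 0 (2 * ‖θ.1 M‖ - 1) with h5 | h5 <;> rw [h5] at h3 <;> linarith
    rcases him with h3 | h3
    · rw [h1] at h3; exact one_ne_zero h3
    · exact oddCoord_ne_zero (by rw [← solenoid_double, h2]) h3
  have hL0 : ∀ θ ∈ upperHalf M, θ ≠ 0 → L θ ≠ 0 := fun θ hθ h0 => by
    rcases le_total (s θ) s₀ with h | h
    · have h1 : χ θ = 0 := max_eq_left ((min_le_right _ _).trans (by linarith))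
      simpa [L, h1] using hq0 _ (hbox θ hθ h0)
    · intro h1
      have h2 : q (0, s₀) = -(((1 - χ θ : ℝ) : ℂ) * (q (ζ θ, s₀) - q (0, s₀))) := by
        simp only [L, min_eq_right h] at h1
        push_cast at h1 ⊢
        linear_combination h1
      have h3 := hclose _ (hζT θ hθ)
      have h4 : ‖q (0, s₀)‖ ≤ ‖q (ζ θ, s₀) - q (0, s₀)‖ := by
        rw [h2, norm_neg, norm_mul, ← h2]
        refine mul_le_of_le_one_left (norm_nonneg _) ?_
        rw [Complex.norm_real, Real.norm_eq_abs, abs_le]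
        have h5 : 0 ≤ χ θ := le_max_left _ _
        have h6 : χ θ ≤ 1 := max_le zero_le_one (min_le_left _ _)
        constructor <;> linarith
      exact h3.not_ge h4
  have hLc : ContinuousOn L (upperHalf M \ {0}) := by
    have h1 : ContinuousOn (fun θ => q (ζ θ, min (s θ) s₀)) (upperHalf M \ {0}) :=
      hq.comp (hζ.prodMk (hs.min continuous_const)).continuousOn fun θ hθ => hbox θ hθ.1 hθ.2
    have h2 : Continuous fun θ => ((1 - χ θ : ℝ) : ℂ) := Complex.continuous_ofReal.comp (continuous_const.sub hχ)
    have h3 : Continuous fun θ => ((χ θ : ℝ) : ℂ) := Complex.continuous_ofReal.comp hχ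
    exact (h2.continuousOn.mul h1).add (h3.mul continuous_const).continuousOn
  refine ⟨fun θ => B θ * L θ, hB.continuousOn.mul hLc, fun θ hθ h0 => mul_ne_zero (hB0 θ) (hL0 θ hθ h0),
    fun θ hθ hθ' h0 => ?_, fun θ hθ h0 hr hsθ => ?_⟩
  · rcases norm_eq_zero_or_one_of_mem_upperHalf hθ hθ' with h | h
    · have hs0 : s θ = 0 := by simp only [s, h, mul_zero]
      have hζθ : ζ θ = θ := by simp only [ζ, hs0, map_zero, sub_zero]
      have hζθ' : ζ (-θ) = -θ := by simp only [ζ, hs_neg, hs0, map_zero, sub_zero]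
      have hχ0 : χ θ = 0 := max_eq_left ((min_le_right _ _).trans (by linarith [hs₀.1]))
      have hχ0' : χ (-θ) = 0 := max_eq_left ((min_le_right _ _).trans (by rw [hs_neg]; linarith [hs₀.1]))
      have hb0 : b θ = 0 := max_eq_left (by rw [h]; norm_num)
      have h1 := hζT θ hθ
      rw [hζθ] at h1
      have h2 := hodd θ h1 h0
      simp [B, L, hb_neg, hb0, hχ0, hχ0', hs_neg, hs0, hζθ, hζθ', min_eq_left hs₀.1.le, h2]
    -- This is where `1 ≤ M` enters: the interpolation ends at `s₀ + 1 < 2`, before the far face.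
    · have hs1 : 2 ≤ s θ := by
        simp only [s, h, mul_one]
        calc (2 : ℝ) = 2 ^ 1 := (pow_one 2).symm
          _ ≤ 2 ^ M := pow_le_pow_right₀ (by norm_num) hM
      have hχ1 : χ θ = 1 := by
        have h1 : min 1 (s θ - s₀) = 1 := min_eq_left (by linarith [hs₀.2])
        simp only [χ, h1]; norm_num
      have hχ1' : χ (-θ) = 1 := by simp only [χ] at hχ1 ⊢; rwa [hs_neg]
      have hb1 : b θ = 1 := by simp only [b, h]; norm_num
      have hodd' : oddCoord ((-θ).1 (M + 1)) = -oddCoord (θ.1 (M + 1)) := oddCoord_neg _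
      simp only [B, L, hb_neg, hb1, hχ1, hχ1', hodd']
      push_cast
      ring
  · have hχ0 : χ θ = 0 := max_eq_left ((min_le_right _ _).trans (by linarith))
    have hb0 : b θ = 0 := max_eq_left (by linarith)
    have hmin : min (s θ) s₀ = s θ := min_eq_left hsθ
    refine ⟨_, hbox θ hθ h0, ?_, ?_⟩
    · simp only [hmin, hadd]
    · simp [B, L, hχ0, hb0]

/-- With `G` the odd extension of `q`, the quotient `k / G ^ m` is `1` near `0` and even because `m`
is. Its even logarithm `H` makes `R = G * exp (H / m)` an odd `m`-th root of `k`. If `R x = R y`,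
then `x = y` or `x = -y`, and the latter forces `R y = 0`; so `R` embeds the solenoid in the plane.
-/
theorem false_of_odd_root {k : solenoid → ℂ} (hk : Continuous k) (hk0 : k 0 = 0)
    (hkinj : ∀ θ θ', k θ = k θ' → θ = θ' ∨ θ = -θ') (heven : ∀ θ, k (-θ) = k θ) {m : ℕ} (hm : Even m) (hm1 : 1 ≤ m)
    {s₀ : ℝ} (hs₀ : s₀ ∈ Ioo (0 : ℝ) 1) {M : ℕ} (hM : 1 ≤ M) {q : solenoid × ℝ → ℂ}
    (hq : ContinuousOn q (halfBox M s₀)) (hqm : ∀ z ∈ halfBox M s₀, q z ^ m = k (z.1 + flow z.2))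
    (hodd : ∀ ζ ∈ transversal M, ζ ≠ 0 → q (-ζ, 0) = -q (ζ, 0))
    (hclose : ∀ ζ ∈ transversal M, ‖q (ζ, s₀) - q (0, s₀)‖ < ‖q (0, s₀)‖) : False := by
  classical
  have hm0 : m ≠ 0 := by lia
  have hmC : (m : ℂ) ≠ 0 := Nat.cast_ne_zero.2 hm0
  have hkne : ∀ θ ≠ 0, k θ ≠ 0 := fun θ h0 h => by
    rcases hkinj θ 0 (h.trans hk0.symm) with h1 | h1
    exacts [h0 h1, h0 (h1.trans neg_zero)]
  have hq0 : ∀ z ∈ halfBox M s₀, q z ≠ 0 := fun z hz h => by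
    have h1 := hqm z hz
    rw [h, zero_pow hm0] at h1
    have h2 : z.1 + flow z.2 ≠ 0 := fun h => fold_ne_point_of_mem_halfBox hs₀.2.le hz (fold_eq_point_iff.2 h)
    exact hkne _ h2 h1.symm
  obtain ⟨F, hFc, hF0, hFodd, hFq⟩ := exists_upperHalf_extension hs₀ hM hq hq0 hodd hclose
  obtain ⟨G, hGc, hGodd, hGF⟩ := exists_odd_extension (isClosed_upperHalf M) (mem_upperHalf_or_neg_mem M) hFc hFodd
  have hG0 : ∀ θ ≠ 0, G θ ≠ 0 := fun θ h0 h => by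
    rcases mem_upperHalf_or_neg_mem M θ with h1 | h1
    · exact hF0 θ h1 h0 (by rw [← hGF θ h1 h0, h])
    · exact hF0 _ h1 (neg_ne_zero.2 h0) (by rw [← hGF _ h1 (neg_ne_zero.2 h0), hGodd θ h0, h, neg_zero])
  have hGm : ∀ θ ≠ 0, G (-θ) ^ m = G θ ^ m := fun θ h0 => by rw [hGodd θ h0, hm.neg_pow]
  have hnear : ∀ᶠ θ in 𝓝 (0 : solenoid), θ ≠ 0 → G θ ^ m = k θ := by
    have h1 : ∀ᶠ θ : solenoid in 𝓝 0, ‖θ.1 M‖ < 1 / 2 :=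
      (continuous_coord M).norm.continuousAt.eventually_lt continuousAt_const (by
        change ‖(0 : AddCircle (2 : ℝ))‖ < 1 / 2
        rw [norm_zero]; norm_num)
    have h2 : ∀ᶠ θ : solenoid in 𝓝 0, 2 ^ M * ‖θ.1 M‖ < s₀ :=
      (continuous_const.mul (continuous_coord M).norm).continuousAt.eventually_lt continuousAt_const (by
        change 2 ^ M * ‖(0 : AddCircle (2 : ℝ))‖ < s₀
        rw [norm_zero, mul_zero]; exact hs₀.1)
    have key : ∀ θ ∈ upperHalf M, θ ≠ 0 → ‖θ.1 M‖ < 1 / 2 → 2 ^ M * ‖θ.1 M‖ < s₀ → G θ ^ m = k θ := by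
      intro θ hθ h0 h3 h4
      obtain ⟨z, hz, hzθ, hFz⟩ := hFq θ hθ h0 h3 h4.le
      rw [hGF θ hθ h0, hFz, hqm z hz, hzθ]
    filter_upwards [h1, h2] with θ h3 h4 h0
    rcases mem_upperHalf_or_neg_mem M θ with h | h
    · exact key θ h h0 h3 h4
    · have hn : ‖(-θ).1 M‖ = ‖θ.1 M‖ := norm_neg _
      rw [← hGm θ h0, ← heven θ]
      exact key _ h (neg_ne_zero.2 h0) (by rwa [hn]) (by rwa [hn])
  let κ : solenoid → ℂ := fun θ => if θ = 0 then 1 else k θ / G θ ^ m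
  have hκ : ∀ θ ≠ 0, κ θ = k θ / G θ ^ m := fun θ h0 => if_neg h0
  have hκc : Continuous κ := by
    rw [continuous_iff_continuousAt]
    intro θ
    by_cases h0 : θ = 0
    · subst h0
      refine continuousAt_const.congr (f := fun _ => (1 : ℂ)) ?_
      filter_upwards [hnear] with θ hθ
      by_cases h0 : θ = 0
      · exact (if_pos h0).symm
      · rw [hκ θ h0, hθ h0, div_self (hkne θ h0)]
    · have hn : ({0}ᶜ : Set solenoid) ∈ 𝓝 θ := isOpen_compl_singleton.mem_nhds h0
      have h1 : ContinuousAt (fun θ => k θ / G θ ^ m) θ :=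
        hk.continuousAt.div ((hGc.continuousAt hn).pow m) (pow_ne_zero m (hG0 θ h0))
      exact h1.congr (by filter_upwards [hn] with y hy using (hκ y hy).symm)
  have hκ0 : ∀ θ, κ θ ≠ 0 := fun θ => by
    by_cases h0 : θ = 0
    · rw [show κ θ = 1 from if_pos h0]; exact one_ne_zero
    · rw [hκ θ h0]; exact div_ne_zero (hkne θ h0) (pow_ne_zero m (hG0 θ h0))
  have hκe : ∀ θ, κ (-θ) = κ θ := fun θ => by
    by_cases h0 : θ = 0
    · rw [h0, neg_zero]
    · rw [hκ θ h0, hκ _ (neg_ne_zero.2 h0), heven, hGm θ h0]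
  obtain ⟨H, hH, hHe, hHκ⟩ := exists_even_log hκc hκ0 hκe
  let R : solenoid → ℂ := fun θ => if θ = 0 then 0 else G θ * Complex.exp (H θ / m)
  have hR0 : R 0 = 0 := if_pos rfl
  have hR : ∀ θ ≠ 0, R θ = G θ * Complex.exp (H θ / m) := fun θ h0 => if_neg h0
  have hRm : ∀ θ, R θ ^ m = k θ := fun θ => by
    by_cases h0 : θ = 0
    · rw [h0, hR0, zero_pow hm0, hk0]
    · rw [hR θ h0, mul_pow, ← Complex.exp_nat_mul, mul_div_cancel₀ _ hmC, hHκ, hκ θ h0,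
        mul_div_cancel₀ _ (pow_ne_zero m (hG0 θ h0))]
  have hRodd : ∀ θ, R (-θ) = -R θ := fun θ => by
    by_cases h0 : θ = 0
    · rw [h0, neg_zero, hR0, neg_zero]
    · rw [hR θ h0, hR _ (neg_ne_zero.2 h0), hGodd θ h0, hHe, neg_mul]
  refine solenoid_not_planar (G := R) ?_ fun x y hxy => ?_
  · rw [continuous_iff_continuousAt]
    intro θ
    by_cases h0 : θ = 0
    · subst h0
      rw [ContinuousAt, hR0, tendsto_zero_iff_norm_tendsto_zero]
      have h1 : Tendsto (fun θ => ‖k θ‖) (𝓝 0) (𝓝 0) := by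
        simpa [hk0] using (hk.tendsto 0).norm
      -- Neither `G` nor `R` is controlled at `0` directly; the modulus of `R` is that of an `m`-th
      -- root of `k`.
      have h2 : ∀ θ, ‖R θ‖ = ‖k θ‖ ^ ((m : ℝ)⁻¹) := fun θ => by
        rw [← hRm θ, norm_pow, Real.pow_rpow_inv_natCast (norm_nonneg _) hm0]
      simp only [h2]
      have h3 := h1.rpow_const (p := (m : ℝ)⁻¹) (.inr (by positivity))
      rwa [Real.zero_rpow (by positivity)] at h3
    · have hn : ({0}ᶜ : Set solenoid) ∈ 𝓝 θ := isOpen_compl_singleton.mem_nhds h0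
      have h1 : ContinuousAt (fun θ => G θ * Complex.exp (H θ / m)) θ :=
        (hGc.continuousAt hn).mul (Complex.continuous_exp.comp (hH.div_const _)).continuousAt
      exact h1.congr (by filter_upwards [hn] with y hy using (hR y hy).symm)
  · rcases hkinj x y (by rw [← hRm, ← hRm, hxy]) with h | h
    · exact h
    · have h1 : R y = 0 := by
        rw [h, hRodd] at hxy
        exact self_eq_neg.1 hxy.symm
      have h2 : y = 0 := by
        by_contra h0
        exact hkne y h0 (by rw [← hRm, h1, zero_pow hm0])
      rw [h, h2, neg_zero]


/-! ### Branched coverings of the Knaster continuum do not extend to the sphere -/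

/-- An embedding onto the sphere would be a homeomorphism, but a segment in a chart shows that the
sphere has no endpoint. -/
theorem exists_notMem_range {e : Knaster → Sphere2} (he : IsEmbedding e) : ∃ v, v ∉ range e := by
  by_contra! h
  let E : Knaster ≃ₜ Sphere2 := he.toHomeomorphOfSurjective h
  obtain ⟨σ, hσ, hσ0, -⟩ := exists_sphere_chart (ne_neg_of_mem_unit_sphere ℝ (E knasterPoint))
  have hlin : Function.Injective fun t : unitInterval => ((2 * (t : ℝ) - 1 : ℝ) : ℂ) := fun s t hst => by
    have := Complex.ofReal_injective hst
    exact Subtype.ext (by linarith)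
  have hc : Continuous fun t : unitInterval => ((2 * (t : ℝ) - 1 : ℝ) : ℂ) := by fun_prop
  have h1 := (isEndpoint_iff knasterPoint).2 rfl
    (fun t => E.symm (σ ((2 * (t : ℝ) - 1 : ℝ) : ℂ)))
    (E.symm.continuous.comp (hσ.continuous.comp hc))
    (E.symm.injective.comp (hσ.injective.comp hlin)) ⟨1 / 2, by norm_num, by norm_num⟩ (by
      norm_num
      rw [hσ0, E.symm_apply_apply])
  rcases h1 with h1 | h1
  · have := congrArg Subtype.val h1
    norm_num at this
  · have := congrArg Subtype.val h1
    norm_num at this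

/-- A stereographic chart that omits a point off the image of `e` and is centred at `e knasterPoint`
turns `e` into an injective planar function with zero at `knasterPoint`. -/
theorem not_exists_extension {f : Knaster → Knaster} (hf : IsBranchedCovering f) {c : Knaster}
    (hc : f c = knasterPoint) (hcp : c ≠ knasterPoint) :
    ¬ ∃ (e : Knaster → Sphere2) (F : Sphere2 → Sphere2),
      IsEmbedding e ∧ IsBranchedCovering F ∧ ∀ x : Knaster, F (e x) = e (f x) := by
  rintro ⟨e, F, he, hF, hFe⟩
  obtain ⟨v, hv⟩ := exists_notMem_range he
  obtain ⟨σ, hσ, hσ0, hσr⟩ := exists_sphere_chart (v := v) (y := e knasterPoint) fun h => hv ⟨_, h⟩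
  have hg : ∀ x, ∃ z, σ z = e x := fun x => by
    have : e x ∈ range σ := by
      rw [hσr]; exact fun h => hv ⟨x, h⟩
    exact this
  choose g hg using hg
  have hgc : Continuous g := by
    rw [hσ.isInducing.continuous_iff, show σ ∘ g = e from funext hg]
    exact he.continuous
  have hgi : Function.Injective g := fun x y h => he.injective (by rw [← hg, ← hg, h])
  have hg0 : g knasterPoint = 0 := hσ.injective (by rw [hg, hσ0])
  obtain ⟨m, hm1, Φ, β, hβ, hΦ, hΦi, hΦm⟩ := exists_sphere_root hF (e c) hσ (by rw [hFe, hc, hσ0])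
  have hmaps : MapsTo e (e ⁻¹' β \ {c}) (β \ {e c}) := fun x hx => ⟨hx.1, fun h => hx.2 (he.injective h)⟩
  obtain ⟨hm, s₀, hs₀, M, hM, q, hq, hqm, hodd, hclose⟩ :=
    exists_odd_root_halfBox hf hc hcp hgi hg0 (he.continuous.continuousAt.preimage_mem_nhds hβ)
      (ψ := fun x => Φ (e x)) hm1 (hΦ.comp he.continuous.continuousOn hmaps)
      (hΦi.comp he.injective.injOn hmaps) fun x hx => hσ.injective (by
        rw [hΦm _ (hmaps hx), hFe, hg])
  refine false_of_odd_root (k := fun θ => g (fold θ)) (hgc.comp continuous_fold) ?_ (fun θ θ' h => ?_)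
    (fun θ => ?_) hm hm1 hs₀ hM hq hqm hodd hclose
  · rw [fold_zero, hg0]
  · exact fold_eq_iff.1 (hgi h)
  · rw [fold_neg]

theorem totalRamification_eq {f : Knaster → Knaster} (hf : IsBranchedCovering f)
    (hfin : (criticalPoints f).Finite) : totalRamification f = (criticalPoints f).ncard := by
  have h1 : ∀ x ∈ criticalPoints f, critMultiplicity f x = 1 := fun x hx => by
    rw [criticalPoints_eq hf] at hx
    rw [critMultiplicity, localDegree_of_map_eq hf hx.1 hx.2]
  rw [totalRamification, finsum_mem_congr rfl h1, finsum_mem_eq_finite_toFinset_sum _ hfin,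
    Finset.sum_const, smul_eq_mul, mul_one, ncard_eq_toFinset_card _ hfin]

end KnasterBranched

open KnasterBranched in
theorem mainTheorem7 (d : ℕ) (hd : 1 ≤ d) (f : Knaster → Knaster)
    (hf : IsBranchedCoveringOfDegree f d) :
    (∀ q : Knaster, IsEndpoint q ↔ q = knasterPoint) ∧
    f knasterPoint = knasterPoint ∧
    localDegree f knasterPoint = 1 ∧
    (∀ x : Knaster, f x = knasterPoint → x ≠ knasterPoint →
      x ∈ criticalPoints f ∧ critMultiplicity f x = 1) ∧
    criticalValues f ⊆ {knasterPoint} ∧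
    Odd d ∧
    (criticalPoints f).Finite ∧
    (criticalPoints f).ncard = (d - 1) / 2 ∧
    (2 ≤ d →
      criticalValues f = {knasterPoint} ∧
      (d : ℤ) - 1 ≠ (totalRamification f : ℤ) ∧
      ¬ ∃ (e : Knaster → Sphere2) (F : Sphere2 → Sphere2),
          Topology.IsEmbedding e ∧ IsBranchedCovering F ∧ ∀ x : Knaster, F (e x) = e (f x)) := by
  have hb := hf.1
  obtain ⟨hfin, hcard⟩ := degree_eq hf
  refine ⟨isEndpoint_iff, map_knasterPoint hb, localDegree_knasterPoint hb, fun x hx hxp => ?_,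
    criticalValues_subset hb, ⟨_, hcard⟩, hfin, by lia, fun hd2 => ?_⟩
  · have h2 := localDegree_of_map_eq hb hx hxp
    exact ⟨h2.ge, by rw [critMultiplicity, h2]⟩
  · have hpos : (criticalPoints f).ncard ≠ 0 := by lia
    obtain ⟨c, hc⟩ := Set.nonempty_of_ncard_ne_zero hpos
    have hc' := hc
    rw [criticalPoints_eq hb] at hc'
    refine ⟨(criticalValues_subset hb).antisymm ?_, ?_, not_exists_extension hb hc'.1 hc'.2⟩
    · rintro _ rfl
      exact ⟨c, hc, hc'.1⟩
    -- All multiplicities are one, so `d - 1` is twice the total ramification, which is positive.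
    · rw [totalRamification_eq hb hfin]
      lia
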